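/- Let $\omega:[0,\infty)\to[0,\infty)$ be a non-quasianalytic weight function, i.e. a continuous increasing (in the wide sense) function such that: ($\alpha$) there is $L\ge 1$ with $\omega(2t)\le L(\omega(t)+1)$ for all $t\ge0$; ($\beta$) $\int_1^\infty \omega(t)t^{-2}\,dt<\infty$; ($\gamma$) $\log t=o(\omega(t))$ as $t\to\infty$; ($\delta$) $\varphi(t):=\omega(e^t)$ is convex; normalized by $\omega|_{[0,1]}\equiv 0$. Put $\omega(x):=\omega(|x|)$ for vectors $x$ ($|\cdot|$ the Euclidean norm), $\varphi^*(t):=\sup_{s\ge0}\{st-\varphi(s)\}$ for $t\ge 0$, $\langle z\rangle:=(1+|z|^2)^{1/2}$, and $D_j=-i\,\partial/\partial x_j$. Let $\mathcal S_\omega(\mathbb R^d)$ be the space of all $u\in L^1(\mathbb R^d)$ such that $u$ and $\widehat u(\xi)=\int u(x)e^{-i\langle x,\xi\rangle}dx$ are $C^\infty$ and, for all $\lambda>0$ and $\alpha\in\mathbb N_0^d$, $$\sup_{x}e^{\lambda\omega(x)}|D^\alpha u(x)|<\infty,\qquad \sup_{\xi}e^{\lambda\omega(\xi)}|D^\alpha\widehat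 u(\xi)|<\infty,$$ with the locally convex topology given by these seminorms. Let $m\in\mathbb R$, $0<\rho\le1$, and let $a\in \mathrm{GA}^{m,\omega}_\rho$, i.e. $a\in C^\infty(\mathbb R^{3d})$ and for every integer $n\ge1$ there is $C_n>0$ with $$|D_x^\alpha D_y^\beta D_\xi^\gamma a(x,y,\xi)|\le C_n\,\frac{\langle x-y\rangle^{\rho|\alpha+\beta+\gamma|}}{\langle(x,y,\xi)\rangle^{\rho|\alpha+\beta+\gamma|}}\,e^{n\rho\varphi^*(|\alpha+\beta+\gamma|/n)}\,e^{m(\omega(x)+\omega(y)+\omega(\xi))}$$ for all $x,y,\xi\in\mathbb R^d$ and $\alpha,\beta,\gamma\in\mathbb N_0^d$. **Theorem 3.3.** (1) For every $f\in\mathcal S_\omega(\mathbb R^d)$ and $x\in\mathbb R^d$ the iterated integral $$Af(x)=\int_{\mathbb R^d}\Big(\int_{\mathbb R^d}e^{i(x-y)\xi}a(x,y,\xi)f(y)\,dy\Big)d\xi$$ exists (the inner integrand is integrable in $y$ for every $\xi$, and the inner integral is integrable in $\xi$), and $f\mapsto Af$ is a well-defined, linear and continuous operator $A:\mathcal S_\omega(\mathbb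 R^d)\to\mathcal S_\omega(\mathbb R^d)$. (2) For every $\chi\in\mathcal S_\omega(\mathbb R^{2d})$ with $\chi(0,0)=1$ and every $f\in\mathcal S_\omega(\mathbb R^d)$, the regularized integrals $$A_{\delta,\chi}f(x)=\int_{\mathbb R^d}\int_{\mathbb R^d}e^{i(x-y)\xi}a(x,y,\xi)\chi(\delta x,\delta\xi)f(y)\,dy\,d\xi\qquad(\delta\ne0)$$ converge absolutely for every $x$, define elements of $\mathcal S_\omega(\mathbb R^d)$, and $A_{\delta,\chi}f\to Af$ in $\mathcal S_\omega(\mathbb R^d)$ as $\delta\to0$. In particular the limit does not depend on the choice of $\chi$. -/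

import Mathlib

open MeasureTheory Filter Topology
open scoped NNReal

noncomputable section

namespace UltraPseudo

/-- Euclidean space `ℝ^d` with the Euclidean norm. -/
abbrev Eucl (d : ℕ) := EuclideanSpace ℝ (Fin d)

/-- Non-quasianalytic weight functions `ω : [0,∞) → [0,∞)` in the sense of Braun, Meise and Taylor,
normalized by `ω = 0` on `[0,1]`. Only the values of `ω` on `[0,∞)` are ever used; "increasing" is
meant in the wide sense, as the normalization requires. -/
structure IsWeight (ω : ℝ → ℝ) : Prop where
  nonneg : ∀ t, 0 ≤ t → 0 ≤ ω t
  continuousOn : ContinuousOn ω (Set.Ici 0)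
  monotoneOn : MonotoneOn ω (Set.Ici 0)
  doubling : ∃ L : ℝ, 1 ≤ L ∧ ∀ t, 0 ≤ t → ω (2 * t) ≤ L * (ω t + 1)
  nonquasianalytic : IntegrableOn (fun t => ω t / t ^ 2) (Set.Ioi 1)
  log_isLittleO : Real.log =o[atTop] ω
  convex : ConvexOn ℝ Set.univ (fun t => ω (Real.exp t))
  normalized : ∀ t, 0 ≤ t → t ≤ 1 → ω t = 0

/-- The Young conjugate `φ*(t) = sup_{s ≥ 0} (s t - φ(s))` of `φ(s) = ω(e^s)`. For a weight function
the supremum is finite, because `s = o(φ(s))` as `s → ∞`. -/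
def youngConj (ω : ℝ → ℝ) (t : ℝ) : ℝ :=
  ⨆ s : ℝ≥0, ((s : ℝ) * t - ω (Real.exp (s : ℝ)))

/-- The operator `D_j = -i ∂/∂x_j`. -/
def partialD {d : ℕ} (j : Fin d) (u : Eucl d → ℂ) : Eucl d → ℂ :=
  fun x => -Complex.I * fderiv ℝ u x (EuclideanSpace.single j 1)

/-- The operator `D^α = D_1^{α_1} ⋯ D_d^{α_d}`. -/
def multiD {d : ℕ} (α : Fin d → ℕ) (u : Eucl d → ℂ) : Eucl d → ℂ :=
  (List.finRange d).foldr (fun j v => (partialD j)^[α j] v) u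

/-- The Fourier transform `û(ξ) = ∫ u(x) e^{-i⟨x,ξ⟩} dx`. -/
def fourierT {d : ℕ} (u : Eucl d → ℂ) : Eucl d → ℂ :=
  fun ξ => ∫ x, u x * Complex.exp (-(Complex.I * ((inner ℝ x ξ : ℝ) : ℂ)))

/-- The function `x ↦ e^{l ω(|x|)} |D^α u(x)|`. -/
def weighted {d : ℕ} (ω : ℝ → ℝ) (l : ℝ) (α : Fin d → ℕ) (u : Eucl d → ℂ) : Eucl d → ℝ :=
  fun x => Real.exp (l * ω ‖x‖) * ‖multiD α u x‖

/-- Membership in the space `S_ω(ℝ^d)` of Björck. -/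
structure MemSω {d : ℕ} (ω : ℝ → ℝ) (u : Eucl d → ℂ) : Prop where
  integrable : Integrable u
  smooth : ContDiff ℝ (⊤ : ℕ∞) u
  smooth_fourier : ContDiff ℝ (⊤ : ℕ∞) (fourierT u)
  bdd : ∀ l : ℝ, 0 < l → ∀ α : Fin d → ℕ, BddAbove (Set.range (weighted ω l α u))
  bdd_fourier : ∀ l : ℝ, 0 < l → ∀ α : Fin d → ℕ,
    BddAbove (Set.range (weighted ω l α (fourierT u)))

section Helpers

variable {d : ℕ}

lemma partialD_contDiff (j : Fin d) {u : Eucl d → ℂ} (hu : ContDiff ℝ (⊤ : ℕ∞) u) :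
    ContDiff ℝ (⊤ : ℕ∞) (partialD j u) := by
  unfold partialD
  have h : ContDiff ℝ (⊤ : ℕ∞) (fderiv ℝ u) := hu.fderiv_right (by simp)
  exact contDiff_const.mul (h.clm_apply contDiff_const)

lemma partialD_iter_contDiff (j : Fin d) (k : ℕ) {u : Eucl d → ℂ} (hu : ContDiff ℝ (⊤ : ℕ∞) u) :
    ContDiff ℝ (⊤ : ℕ∞) ((partialD j)^[k] u) := by
  induction k with
  | zero => exact hu
  | succ k ih => rw [Function.iterate_succ_apply']; exact partialD_contDiff j ih

lemma partialD_add (j : Fin d) {u v : Eucl d → ℂ} (hu : ContDiff ℝ (⊤ : ℕ∞) u) (hv : ContDiff ℝ (⊤ : ℕ∞) v) :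
    partialD j (u + v) = partialD j u + partialD j v := by
  funext x
  have h1 : DifferentiableAt ℝ u x := hu.differentiable (by simp) x
  have h2 : DifferentiableAt ℝ v x := hv.differentiable (by simp) x
  simp only [partialD, Pi.add_apply, fderiv_add h1 h2, add_apply]
  ring

lemma partialD_smul (j : Fin d) (c : ℂ) {u : Eucl d → ℂ} (hu : ContDiff ℝ (⊤ : ℕ∞) u) :
    partialD j (c • u) = c • partialD j u := by
  funext x
  have h1 : DifferentiableAt ℝ u x := hu.differentiable (by simp) x
  simp only [partialD, Pi.smul_apply, fderiv_const_smul h1 c, smul_eq_mul,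
    smul_apply]
  ring

lemma partialD_iter_add (j : Fin d) (k : ℕ) {u v : Eucl d → ℂ} (hu : ContDiff ℝ (⊤ : ℕ∞) u)
    (hv : ContDiff ℝ (⊤ : ℕ∞) v) :
    (partialD j)^[k] (u + v) = (partialD j)^[k] u + (partialD j)^[k] v := by
  induction k with
  | zero => rfl
  | succ k ih =>
    simp only [Function.iterate_succ_apply']
    rw [ih, partialD_add j (partialD_iter_contDiff j k hu) (partialD_iter_contDiff j k hv)]

lemma partialD_iter_smul (j : Fin d) (k : ℕ) (c : ℂ) {u : Eucl d → ℂ} (hu : ContDiff ℝ (⊤ : ℕ∞) u) :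
    (partialD j)^[k] (c • u) = c • (partialD j)^[k] u := by
  induction k with
  | zero => rfl
  | succ k ih =>
    simp only [Function.iterate_succ_apply']
    rw [ih, partialD_smul j c (partialD_iter_contDiff j k hu)]

lemma foldr_contDiff (l : List (Fin d)) (α : Fin d → ℕ) {u : Eucl d → ℂ} (hu : ContDiff ℝ (⊤ : ℕ∞) u) :
    ContDiff ℝ (⊤ : ℕ∞) (l.foldr (fun j v => (partialD j)^[α j] v) u) := by
  induction l with
  | nil => exact hu
  | cons j l ih => exact partialD_iter_contDiff j (α j) ih

lemma multiD_add (α : Fin d → ℕ) {u v : Eucl d → ℂ} (hu : ContDiff ℝ (⊤ : ℕ∞) u)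
    (hv : ContDiff ℝ (⊤ : ℕ∞) v) : multiD α (u + v) = multiD α u + multiD α v := by
  unfold multiD
  induction List.finRange d with
  | nil => rfl
  | cons j l ih =>
    simp only [List.foldr_cons]
    rw [ih, partialD_iter_add j _ (foldr_contDiff l α hu) (foldr_contDiff l α hv)]

lemma multiD_smul (α : Fin d → ℕ) (c : ℂ) {u : Eucl d → ℂ} (hu : ContDiff ℝ (⊤ : ℕ∞) u) :
    multiD α (c • u) = c • multiD α u := by
  unfold multiD
  induction List.finRange d with
  | nil => rfl
  | cons j l ih =>
    simp only [List.foldr_cons]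
    rw [ih, partialD_iter_smul j _ c (foldr_contDiff l α hu)]

lemma fourierT_integrand {u : Eucl d → ℂ} (hu : Integrable u) (ξ : Eucl d) :
    Integrable (fun x => u x * Complex.exp (-(Complex.I * ((inner ℝ x ξ : ℝ) : ℂ)))) := by
  refine hu.mul_bdd (c := 1) (Continuous.aestronglyMeasurable (by fun_prop)) ?_
  refine Eventually.of_forall fun x => ?_
  rw [Complex.norm_exp]
  simp

lemma fourierT_add {u v : Eucl d → ℂ} (hu : Integrable u) (hv : Integrable v) :
    fourierT (u + v) = fourierT u + fourierT v := by
  funext ξ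
  simp only [fourierT, Pi.add_apply, add_mul]
  exact integral_add (fourierT_integrand hu ξ) (fourierT_integrand hv ξ)

lemma fourierT_smul (c : ℂ) (u : Eucl d → ℂ) : fourierT (c • u) = c • fourierT u := by
  funext ξ
  simp only [fourierT, Pi.smul_apply, smul_eq_mul, mul_assoc]
  exact integral_const_mul c _

lemma weighted_nonneg (ω : ℝ → ℝ) (l : ℝ) (α : Fin d → ℕ) (u : Eucl d → ℂ) (x : Eucl d) :
    0 ≤ weighted ω l α u x :=
  mul_nonneg (Real.exp_pos _).le (norm_nonneg _)

lemma weighted_add_le (ω : ℝ → ℝ) (l : ℝ) (α : Fin d → ℕ) {u v : Eucl d → ℂ}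
    (hu : ContDiff ℝ (⊤ : ℕ∞) u) (hv : ContDiff ℝ (⊤ : ℕ∞) v) (x : Eucl d) :
    weighted ω l α (u + v) x ≤ weighted ω l α u x + weighted ω l α v x := by
  simp only [weighted, multiD_add α hu hv, Pi.add_apply, ← mul_add]
  exact mul_le_mul_of_nonneg_left (norm_add_le _ _) (Real.exp_pos _).le

lemma weighted_smul (ω : ℝ → ℝ) (l : ℝ) (α : Fin d → ℕ) (c : ℂ) {u : Eucl d → ℂ}
    (hu : ContDiff ℝ (⊤ : ℕ∞) u) (x : Eucl d) :
    weighted ω l α (c • u) x = ‖c‖ * weighted ω l α u x := by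
  simp only [weighted, multiD_smul α c hu, Pi.smul_apply, norm_smul]
  ring

lemma weighted_bdd_add (ω : ℝ → ℝ) (l : ℝ) (α : Fin d → ℕ) {u v : Eucl d → ℂ}
    (hu : ContDiff ℝ (⊤ : ℕ∞) u) (hv : ContDiff ℝ (⊤ : ℕ∞) v)
    (bu : BddAbove (Set.range (weighted ω l α u))) (bv : BddAbove (Set.range (weighted ω l α v))) :
    BddAbove (Set.range (weighted ω l α (u + v))) := by
  obtain ⟨B, hB⟩ := bu
  obtain ⟨C, hC⟩ := bv
  refine ⟨B + C, ?_⟩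
  rintro _ ⟨x, rfl⟩
  exact (weighted_add_le ω l α hu hv x).trans
    (add_le_add (hB (Set.mem_range_self x)) (hC (Set.mem_range_self x)))

lemma weighted_bdd_smul (ω : ℝ → ℝ) (l : ℝ) (α : Fin d → ℕ) (c : ℂ) {u : Eucl d → ℂ}
    (hu : ContDiff ℝ (⊤ : ℕ∞) u) (bu : BddAbove (Set.range (weighted ω l α u))) :
    BddAbove (Set.range (weighted ω l α (c • u))) := by
  obtain ⟨B, hB⟩ := bu
  refine ⟨‖c‖ * B, ?_⟩
  rintro _ ⟨x, rfl⟩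
  rw [weighted_smul ω l α c hu x]
  exact mul_le_mul_of_nonneg_left (hB (Set.mem_range_self x)) (norm_nonneg c)

lemma multiD_zero (α : Fin d → ℕ) : multiD α (0 : Eucl d → ℂ) = 0 := by
  have h := multiD_smul α 0 (u := (0 : Eucl d → ℂ)) contDiff_const
  simpa using h

lemma fourierT_zero : fourierT (0 : Eucl d → ℂ) = 0 := by
  have h := fourierT_smul 0 (0 : Eucl d → ℂ)
  simpa using h

lemma weighted_zero (ω : ℝ → ℝ) (l : ℝ) (α : Fin d → ℕ) :
    weighted ω l α (0 : Eucl d → ℂ) = fun _ => 0 := by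
  funext x
  simp [weighted, multiD_zero]

end Helpers

/-- `S_ω(ℝ^d)` as a linear subspace of the functions on `ℝ^d`. -/
def submoduleSω (d : ℕ) (ω : ℝ → ℝ) : Submodule ℂ (Eucl d → ℂ) where
  carrier := {u | MemSω ω u}
  zero_mem' := by
    refine ⟨integrable_zero _ _ _, contDiff_const, ?_, fun l _ α => ?_, fun l _ α => ?_⟩
    · rw [fourierT_zero]; exact contDiff_const
    · rw [weighted_zero]; exact ⟨0, by rintro _ ⟨x, rfl⟩; exact le_rfl⟩
    · rw [fourierT_zero, weighted_zero]; exact ⟨0, by rintro _ ⟨x, rfl⟩; exact le_rfl⟩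
  add_mem' := by
    intro u v hu hv
    have hF := fourierT_add hu.integrable hv.integrable
    refine ⟨hu.integrable.add hv.integrable, hu.smooth.add hv.smooth, ?_, fun l hl α => ?_,
      fun l hl α => ?_⟩
    · rw [hF]; exact hu.smooth_fourier.add hv.smooth_fourier
    · exact weighted_bdd_add ω l α hu.smooth hv.smooth (hu.bdd l hl α) (hv.bdd l hl α)
    · rw [hF]
      exact weighted_bdd_add ω l α hu.smooth_fourier hv.smooth_fourier (hu.bdd_fourier l hl α)
        (hv.bdd_fourier l hl α)
  smul_mem' := by
    intro c u hu
    have hF := fourierT_smul c u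
    refine ⟨hu.integrable.smul c, hu.smooth.const_smul c, ?_, fun l hl α => ?_, fun l hl α => ?_⟩
    · rw [hF]; exact hu.smooth_fourier.const_smul c
    · exact weighted_bdd_smul ω l α c hu.smooth (hu.bdd l hl α)
    · rw [hF]; exact weighted_bdd_smul ω l α c hu.smooth_fourier (hu.bdd_fourier l hl α)

/-- The space `S_ω(ℝ^d)` (a type of its own, so that it does not inherit the topology of pointwise
convergence). -/
def Sω (d : ℕ) (ω : ℝ → ℝ) : Type := submoduleSω d ω

instance (d : ℕ) (ω : ℝ → ℝ) : AddCommGroup (Sω d ω) :=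
  inferInstanceAs (AddCommGroup (submoduleSω d ω))

instance (d : ℕ) (ω : ℝ → ℝ) : Module ℂ (Sω d ω) :=
  inferInstanceAs (Module ℂ (submoduleSω d ω))

instance (d : ℕ) (ω : ℝ → ℝ) : CoeFun (Sω d ω) (fun _ => Eucl d → ℂ) :=
  ⟨fun f => f.1⟩

lemma Sω.mem {d : ℕ} {ω : ℝ → ℝ} (f : Sω d ω) : MemSω ω (f : Eucl d → ℂ) := f.2

lemma Sω.coe_add {d : ℕ} {ω : ℝ → ℝ} (f g : Sω d ω) :
    ((f + g : Sω d ω) : Eucl d → ℂ) = (f : Eucl d → ℂ) + (g : Eucl d → ℂ) := rfl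

lemma Sω.coe_smul {d : ℕ} {ω : ℝ → ℝ} (c : ℂ) (f : Sω d ω) :
    ((c • f : Sω d ω) : Eucl d → ℂ) = c • (f : Eucl d → ℂ) := rfl

/-- The seminorm `f ↦ sup_x e^{l ω(x)} |D^α f(x)|` on `S_ω(ℝ^d)`, for `l > 0`. -/
def seminormSpace (d : ℕ) (ω : ℝ → ℝ) (l : {l : ℝ // 0 < l}) (α : Fin d → ℕ) :
    Seminorm ℂ (Sω d ω) :=
  Seminorm.of (fun f => ⨆ x, weighted ω l.1 α (f : Eucl d → ℂ) x)
    (by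
      intro f g
      refine ciSup_le fun x => ?_
      rw [Sω.coe_add]
      exact (weighted_add_le ω l.1 α f.mem.smooth g.mem.smooth x).trans
        (add_le_add (le_ciSup (f.mem.bdd l.1 l.2 α) x) (le_ciSup (g.mem.bdd l.1 l.2 α) x)))
    (by
      intro c f
      rw [Real.mul_iSup_of_nonneg (norm_nonneg c), Sω.coe_smul]
      exact iSup_congr fun x => weighted_smul ω l.1 α c f.mem.smooth x)

/-- The seminorm `f ↦ sup_ξ e^{l ω(ξ)} |D^α f̂(ξ)|` on `S_ω(ℝ^d)`, for `l > 0`. -/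
def seminormFourier (d : ℕ) (ω : ℝ → ℝ) (l : {l : ℝ // 0 < l}) (α : Fin d → ℕ) :
    Seminorm ℂ (Sω d ω) :=
  Seminorm.of (fun f => ⨆ ξ, weighted ω l.1 α (fourierT (f : Eucl d → ℂ)) ξ)
    (by
      intro f g
      refine ciSup_le fun x => ?_
      rw [Sω.coe_add, fourierT_add f.mem.integrable g.mem.integrable]
      exact (weighted_add_le ω l.1 α f.mem.smooth_fourier g.mem.smooth_fourier x).trans
        (add_le_add (le_ciSup (f.mem.bdd_fourier l.1 l.2 α) x)
          (le_ciSup (g.mem.bdd_fourier l.1 l.2 α) x)))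
    (by
      intro c f
      rw [Real.mul_iSup_of_nonneg (norm_nonneg c), Sω.coe_smul, fourierT_smul]
      exact iSup_congr fun x => weighted_smul ω l.1 α c f.mem.smooth_fourier x)

/-- The family of all seminorms `sup e^{l ω} |D^α f|` and `sup e^{l ω} |D^α f̂|`. -/
def seminormFamily (d : ℕ) (ω : ℝ → ℝ) :
    SeminormFamily ℂ (Sω d ω)
      (({l : ℝ // 0 < l} × (Fin d → ℕ)) ⊕ ({l : ℝ // 0 < l} × (Fin d → ℕ))) :=
  Sum.elim (fun i => seminormSpace d ω i.1 i.2) (fun i => seminormFourier d ω i.1 i.2)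

instance : Nonempty {l : ℝ // 0 < l} := ⟨⟨1, one_pos⟩⟩

/-- The locally convex topology of `S_ω(ℝ^d)`, generated by the above seminorms. -/
instance (d : ℕ) (ω : ℝ → ℝ) : TopologicalSpace (Sω d ω) :=
  (seminormFamily d ω).moduleFilterBasis.topology

lemma withSeminorms (d : ℕ) (ω : ℝ → ℝ) : WithSeminorms (seminormFamily d ω) := ⟨rfl⟩

/-- The Japanese bracket `⟨x⟩ = (1 + |x|²)^{1/2}`. -/
def bracket {d : ℕ} (x : Eucl d) : ℝ := Real.sqrt (1 + ‖x‖ ^ 2)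

/-- The Japanese bracket `⟨(x,y,ξ)⟩` on `ℝ^{3d}`. -/
def bracket₃ {d : ℕ} (x y ξ : Eucl d) : ℝ := Real.sqrt (1 + ‖x‖ ^ 2 + ‖y‖ ^ 2 + ‖ξ‖ ^ 2)

/-- The class `GA_ρ^{m,ω}` of global amplitudes `a(x,y,ξ)`. -/
structure IsAmplitude {d : ℕ} (ω : ℝ → ℝ) (m ρ : ℝ) (a : Eucl d → Eucl d → Eucl d → ℂ) : Prop where
  smooth : ContDiff ℝ (⊤ : ℕ∞) (fun p : Eucl d × Eucl d × Eucl d => a p.1 p.2.1 p.2.2)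
  bound : ∀ n : ℕ, 0 < n → ∃ C : ℝ, 0 < C ∧ ∀ (x y ξ : Eucl d) (α β γ : Fin d → ℕ),
    ‖multiD α (fun x' => multiD β (fun y' => multiD γ (fun ξ' => a x' y' ξ') ξ) y) x‖ ≤
      C * (bracket (x - y) ^ (ρ * ((∑ j, (α + β + γ) j : ℕ) : ℝ)) /
            bracket₃ x y ξ ^ (ρ * ((∑ j, (α + β + γ) j : ℕ) : ℝ))) *
        Real.exp (n * ρ * youngConj ω (((∑ j, (α + β + γ) j : ℕ) : ℝ) / n)) *
        Real.exp (m * (ω ‖x‖ + ω ‖y‖ + ω ‖ξ‖))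

/-- The point `(x,ξ)` of `ℝ^{2d}`. -/
def pair {d : ℕ} (x ξ : Eucl d) : Eucl (d + d) :=
  WithLp.toLp 2 (Fin.append (fun j => x j) (fun j => ξ j))

/-- The integrand `e^{i(x-y)ξ} a(x,y,ξ) f(y)`. -/
def kernelFun {d : ℕ} (a : Eucl d → Eucl d → Eucl d → ℂ) (f : Eucl d → ℂ) (x y ξ : Eucl d) : ℂ :=
  Complex.exp (Complex.I * ((inner ℝ (x - y) ξ : ℝ) : ℂ)) * a x y ξ * f y

/-- The integrand `e^{i(x-y)ξ} a(x,y,ξ) χ(δx,δξ) f(y)` of the regularized operator. -/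
def regKernelFun {d : ℕ} (a : Eucl d → Eucl d → Eucl d → ℂ) (χ : Eucl (d + d) → ℂ) (δ : ℝ)
    (f : Eucl d → ℂ) (x y ξ : Eucl d) : ℂ :=
  Complex.exp (Complex.I * ((inner ℝ (x - y) ξ : ℝ) : ℂ)) * a x y ξ *
    χ (pair (δ • x) (δ • ξ)) * f y

end UltraPseudo

end

/-! The amplitude enters only through joint estimates. Since ⟨x-y⟩ ≤ 2⟨(x,y,ξ)⟩ and ρ ≤ 1, the
quotient of brackets costs at most 2^K at order K. Hence for every l > 0 the K-th total derivative
of `a` is bounded by C (6d)^K e^{lφ*(K/l)} e^{|m|(ω(x)+ω(y)+ω(ξ))}. Everything is then proved for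
symbols with such bounds (`IsSymbol`), where the geometric constant and the growth exponent do not
depend on l.

The operator is a composition of two partial Fourier transforms, y to ξ and then ξ to x. The main
estimate, `IsWeight.exists_derivBound_oscInt`, treats p ↦ ∫ e^{i⟨y,Lp⟩} g(p,y) dy. Decay of g in y
pays for the derivatives in p that fall on the phase. Ultradifferentiable regularity of g in y gives
decay e^{-lω(Lp)} by integrating by parts k times and optimizing over k, which is the biconjugate
estimate `IsWeight.exists_youngExp_le`. As l is arbitrary, this decay beats the growth e^{|m|ω(ξ)}
after the first transform and e^{|m|ω(x)} after the second. So the iterated integral exists without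
regularization and lies in `Sω`.

To read this as continuity, the seminorms of `Sω` must control bounds on all derivatives at once,
weighted and with ultradifferentiable constants. This is `IsWeight.exists_derivBound_of_decay`: f is
localized by a Gaussian window at each point x, the Fourier transform of the localized function
decays both in the frequency and in x, and Fourier inversion gives the derivatives of f at x.

For the regularization, χ(δx,δξ) - χ(0) is a symbol of growth exponent 1 with constant O(|δ|). The
seminorm bounds for the operator are linear in the constant of the symbol, so the difference of the
operators applied to f tends to 0. -/

set_option maxSynthPendingDepth 3

noncomputable section

namespace UltraPseudo

/-! ### Weight functions and the sequences e^{lφ*(j/l)} -/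

/-- The sequence `e^{l φ*(j / l)}`, which is `sup_{t ≥ 1} t^j e^{-l ω(t)}`. -/
def youngExp (ω : ℝ → ℝ) (l : ℝ) (j : ℕ) : ℝ := Real.exp (l * youngConj ω (j / l))

lemma youngExp_pos (ω : ℝ → ℝ) (l : ℝ) (j : ℕ) : 0 < youngExp ω l j := Real.exp_pos _

/-- Substituting t = e^s turns the supremum defining φ* into a supremum of t^j e^{-lω(t)} over t ≥
1. Bounds from above need no finiteness of that supremum, hence no hypothesis on ω. -/
lemma youngExp_le {ω : ℝ → ℝ} {l : ℝ} (hl : 0 < l) {j : ℕ} {B : ℝ}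
    (h : ∀ t : ℝ, 1 ≤ t → t ^ j * Real.exp (-(l * ω t)) ≤ B) : youngExp ω l j ≤ B := by
  have hB : 0 < B := lt_of_lt_of_le (by positivity) (h 1 le_rfl)
  rw [← Real.exp_log hB]
  refine Real.exp_le_exp.2 ?_
  rw [mul_comm, ← le_div_iff₀ hl]
  refine ciSup_le fun s => ?_
  have h1 := h (Real.exp s) (Real.one_le_exp s.2)
  rw [← Real.exp_nat_mul, ← Real.exp_add] at h1
  have h2 := Real.log_le_log (Real.exp_pos _) h1
  rw [Real.log_exp] at h2
  rw [le_div_iff₀ hl]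
  calc ((s : ℝ) * (j / l) - ω (Real.exp s)) * l = j * s + -(l * ω (Real.exp s)) := by
        field_simp
        ring
    _ ≤ _ := h2

namespace IsWeight

variable {ω : ℝ → ℝ} (hω : IsWeight ω)
include hω

lemma eventually_log_le (k : ℝ) (hk : 0 < k) : ∃ X : ℝ, 1 ≤ X ∧ ∀ t, X ≤ t → k * Real.log t ≤ ω t := by
  have h := hω.log_isLittleO.bound (inv_pos.2 hk)
  obtain ⟨X, hX⟩ := eventually_atTop.1 h
  refine ⟨max X 1, le_max_right _ _, fun t ht => ?_⟩
  have h1 := hX t ((le_max_left _ _).trans ht)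
  have ht1 : 1 ≤ t := (le_max_right _ _).trans ht
  rw [Real.norm_of_nonneg (Real.log_nonneg ht1),
    Real.norm_of_nonneg (hω.nonneg t (by linarith))] at h1
  rw [inv_mul_eq_div, le_div_iff₀ hk] at h1
  linarith

lemma bddAbove_young (t : ℝ) :
    BddAbove (Set.range fun s : ℝ≥0 => (s : ℝ) * t - ω (Real.exp (s : ℝ))) := by
  obtain ⟨X, hX1, hX⟩ := hω.eventually_log_le (|t| + 1) (by positivity)
  refine ⟨|t| * Real.log X, ?_⟩
  rintro _ ⟨s, rfl⟩
  have hs : (s : ℝ) * t ≤ s * |t| := mul_le_mul_of_nonneg_left (le_abs_self t) s.2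
  have h0 : 0 ≤ |t| * Real.log X := mul_nonneg (abs_nonneg _) (Real.log_nonneg hX1)
  have hw := hω.nonneg _ (Real.exp_pos (s : ℝ)).le
  rcases le_total X (Real.exp s) with h | h
  · have h1 := hX _ h
    rw [Real.log_exp] at h1
    have : (0 : ℝ) ≤ s := s.2
    show (s : ℝ) * t - ω (Real.exp s) ≤ _
    nlinarith
  · have h2 : (s : ℝ) ≤ Real.log X := by
      rw [← Real.log_exp (s : ℝ)]; exact Real.log_le_log (Real.exp_pos _) h
    have h3 := mul_le_mul_of_nonneg_right h2 (abs_nonneg t)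
    show (s : ℝ) * t - ω (Real.exp s) ≤ _
    linarith

lemma youngConj_nonneg (t : ℝ) : 0 ≤ youngConj ω t := by
  refine le_trans ?_ (le_ciSup (hω.bddAbove_young t) 0)
  simp [hω.normalized 1 zero_le_one le_rfl]

lemma one_le_youngExp {l : ℝ} (hl : 0 < l) (j : ℕ) : 1 ≤ youngExp ω l j :=
  Real.one_le_exp (mul_nonneg hl.le (hω.youngConj_nonneg _))

lemma pow_mul_exp_le_of_one_le {l : ℝ} (hl : 0 < l) (j : ℕ) {t : ℝ} (ht : 1 ≤ t) :
    t ^ j * Real.exp (-(l * ω t)) ≤ youngExp ω l j := by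
  have ht0 : 0 < t := by linarith
  have h := le_ciSup (hω.bddAbove_young (j / l)) ⟨Real.log t, Real.log_nonneg ht⟩
  have h' : Real.log t * (j / l) - ω t ≤ youngConj ω (j / l) := by
    have h0 : ω (Real.exp (Real.log t)) = ω t := by rw [Real.exp_log ht0]
    rw [← h0]
    exact h
  have e : t ^ j = Real.exp (j * Real.log t) := by
    rw [mul_comm, Real.exp_mul, Real.exp_log ht0, Real.rpow_natCast]
  rw [e, ← Real.exp_add]
  refine Real.exp_le_exp.2 ?_
  have h2 := mul_le_mul_of_nonneg_left h' hl.le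
  have : l * (Real.log t * (j / l) - ω t) = j * Real.log t - l * ω t := by
    field_simp
  linarith

lemma pow_mul_exp_le {l : ℝ} (hl : 0 < l) (j : ℕ) {t : ℝ} (ht : 0 ≤ t) :
    t ^ j * Real.exp (-(l * ω t)) ≤ youngExp ω l j := by
  rcases le_total 1 t with h | h
  · exact hω.pow_mul_exp_le_of_one_le hl j h
  · refine le_trans ?_ (hω.one_le_youngExp hl j)
    rw [hω.normalized t ht h]
    simpa using pow_le_one₀ ht h

lemma youngExp_zero {l : ℝ} (hl : 0 < l) : youngExp ω l 0 = 1 := by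
  refine le_antisymm (youngExp_le hl fun t ht => ?_) (hω.one_le_youngExp hl 0)
  simpa using mul_nonneg hl.le (hω.nonneg t (by linarith))

/-- In t^i s^j e^{-lω(t)} e^{-lω(s)}, raise the smaller of t, s to the larger one and drop its
exponential, which is at most 1. This keeps the parameter l unchanged in the Leibniz rule. -/
lemma youngExp_mul_le {l : ℝ} (hl : 0 < l) (i j : ℕ) :
    youngExp ω l i * youngExp ω l j ≤ youngExp ω l (i + j) := by
  rw [← le_div_iff₀ (youngExp_pos ω l j)]
  refine youngExp_le hl fun t ht => ?_
  rw [le_div_iff₀ (youngExp_pos ω l j), mul_comm, ← le_div_iff₀ (by positivity)]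
  refine youngExp_le hl fun s hs => ?_
  rw [le_div_iff₀ (by positivity)]
  have key : ∀ {t s : ℝ} (i j : ℕ), 1 ≤ t → t ≤ s →
      s ^ j * Real.exp (-(l * ω s)) * (t ^ i * Real.exp (-(l * ω t))) ≤ youngExp ω l (i + j) := by
    intro t s i j ht hts
    have h1 : Real.exp (-(l * ω t)) ≤ 1 :=
      Real.exp_le_one_iff.2 (by
        have := mul_nonneg hl.le (hω.nonneg t (by linarith)); linarith)
    have h2 : t ^ i ≤ s ^ i := pow_le_pow_left₀ (by linarith) hts i
    have h3 : t ^ i * Real.exp (-(l * ω t)) ≤ s ^ i * 1 :=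
      mul_le_mul h2 h1 (Real.exp_pos _).le (pow_nonneg (by linarith) i)
    have hs0 : 0 ≤ s := by linarith
    calc _ ≤ s ^ j * Real.exp (-(l * ω s)) * (s ^ i * 1) := by gcongr
      _ = s ^ (i + j) * Real.exp (-(l * ω s)) := by ring
      _ ≤ _ := hω.pow_mul_exp_le hl _ hs0
  rcases le_total t s with h | h
  · exact key i j ht h
  · rw [mul_comm, add_comm]; exact key j i hs h

/-- Share e^{-2lω(t)} equally between t^i and t^j. Halving the parameter separates two orders of
differentiation that occur only through their sum. -/
lemma youngExp_add_le {l : ℝ} (hl : 0 < l) (i j : ℕ) :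
    youngExp ω (2 * l) (i + j) ≤ youngExp ω l i * youngExp ω l j := by
  refine youngExp_le (by positivity) fun t ht => ?_
  have h1 := hω.pow_mul_exp_le_of_one_le hl i ht
  have h2 := hω.pow_mul_exp_le_of_one_le hl j ht
  calc _ = (t ^ i * Real.exp (-(l * ω t))) * (t ^ j * Real.exp (-(l * ω t))) := by
        rw [show -(2 * l * ω t) = -(l * ω t) + -(l * ω t) by ring, Real.exp_add]; ring
    _ ≤ _ := mul_le_mul h1 h2 (by positivity) (youngExp_pos _ _ _).le

lemma youngExp_anti {l l' : ℝ} (hl : 0 < l) (h : l ≤ l') (j : ℕ) :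
    youngExp ω l' j ≤ youngExp ω l j := by
  refine youngExp_le (by linarith) fun t ht => ?_
  refine le_trans ?_ (hω.pow_mul_exp_le_of_one_le hl j ht)
  have := mul_le_mul_of_nonneg_right h (hω.nonneg t (by linarith))
  gcongr

/-- `ω(c t) ≤ K (ω(t) + 1)`. -/
lemma exists_dilate_le (c : ℝ) (hc : 0 ≤ c) :
    ∃ K : ℝ, 1 ≤ K ∧ ∀ t, 0 ≤ t → ω (c * t) ≤ K * (ω t + 1) := by
  obtain ⟨L, hL, h⟩ := hω.doubling
  have key : ∀ r : ℕ, ∃ K : ℝ, 1 ≤ K ∧ ∀ t, 0 ≤ t → ω (2 ^ r * t) ≤ K * (ω t + 1) := by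
    intro r
    induction r with
    | zero => exact ⟨1, le_rfl, fun t _ => by simp⟩
    | succ r ih =>
      obtain ⟨K, hK, hK'⟩ := ih
      refine ⟨L * (K + 1), by nlinarith, fun t ht => ?_⟩
      have h1 := h (2 ^ r * t) (by positivity)
      have h2 := hK' t ht
      have h3 := hω.nonneg t ht
      rw [pow_succ', mul_assoc]
      refine h1.trans ?_
      rw [mul_assoc]
      refine mul_le_mul_of_nonneg_left ?_ (by linarith)
      nlinarith
  obtain ⟨r, hr⟩ := pow_unbounded_of_one_lt c (one_lt_two : (1 : ℝ) < 2)
  obtain ⟨K, hK, hK'⟩ := key r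
  refine ⟨K, hK, fun t ht => le_trans (hω.monotoneOn ?_ ?_ ?_) (hK' t ht)⟩
  · exact mul_nonneg hc ht
  · exact mul_nonneg (pow_nonneg zero_le_two r) ht
  · exact mul_le_mul_of_nonneg_right hr.le ht

/-- Geometric factors can be absorbed by lowering the parameter. -/
lemma exists_pow_mul_youngExp_le (c : ℝ) (hc : 0 ≤ c) {l : ℝ} (hl : 0 < l) :
    ∃ l' : ℝ, l ≤ l' ∧ ∃ C : ℝ, 0 < C ∧ ∀ μ, l' ≤ μ → ∀ j : ℕ,
      c ^ j * youngExp ω μ j ≤ C * youngExp ω l j := by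
  obtain ⟨K, hK, h⟩ := hω.exists_dilate_le (max c 1) (by positivity)
  -- From ω(ct) ≤ K(ω(t)+1), applied with max c 1, follows e^{-lKω(t)} ≤ e^{lK} e^{-lω(ct)}, and c^j
  -- t^j = (ct)^j.
  refine ⟨l * K, by nlinarith, Real.exp (l * K), Real.exp_pos _, fun μ hμ j => ?_⟩
  have hlK : 0 < l * K := by positivity
  have hc1 : c ^ j ≤ (max c 1) ^ j := pow_le_pow_left₀ hc (le_max_left _ _) j
  have hp : 0 < (max c 1) ^ j := pow_pos (by positivity) j
  refine (mul_le_mul hc1 (hω.youngExp_anti hlK hμ j) (youngExp_pos _ _ _).le hp.le).trans ?_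
  rw [mul_comm, ← le_div_iff₀ hp]
  refine youngExp_le hlK fun t ht => ?_
  have ht0 : 0 ≤ t := by linarith
  rw [le_div_iff₀ hp]
  have h1 := hω.pow_mul_exp_le hl j (t := max c 1 * t) (by positivity)
  have h2 := h t ht0
  have h3 : Real.exp (-(l * K * ω t)) ≤ Real.exp (l * K) * Real.exp (-(l * ω (max c 1 * t))) := by
    rw [← Real.exp_add]
    refine Real.exp_le_exp.2 ?_
    nlinarith [mul_le_mul_of_nonneg_left h2 hl.le]
  calc t ^ j * Real.exp (-(l * K * ω t)) * max c 1 ^ j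
      ≤ t ^ j * (Real.exp (l * K) * Real.exp (-(l * ω (max c 1 * t)))) * max c 1 ^ j := by gcongr
    _ = Real.exp (l * K) * ((max c 1 * t) ^ j * Real.exp (-(l * ω (max c 1 * t)))) := by
        rw [mul_pow]; ring
    _ ≤ _ := by gcongr

/-- A subgradient of the convex function `s ↦ ω(e^s)`. -/
lemma exists_subgradient (s : ℝ) :
    ∃ σ : ℝ, 0 ≤ σ ∧ ∀ s', ω (Real.exp s) + σ * (s' - s) ≤ ω (Real.exp s') := by
  set φ : ℝ → ℝ := fun t => ω (Real.exp t) with hφ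
  have hc : ConvexOn ℝ Set.univ φ := hω.convex
  have hmono : Monotone φ := fun a b hab =>
    hω.monotoneOn (Real.exp_pos a).le (Real.exp_pos b).le (Real.exp_le_exp.2 hab)
  have hslope : ∀ {x y z : ℝ}, x < y → y < z → (φ y - φ x) / (y - x) ≤ (φ z - φ y) / (z - y) :=
    fun hxy hyz => hc.slope_mono_adjacent (Set.mem_univ _) (Set.mem_univ _) hxy hyz
  -- The slopes of the chords ending at s; their supremum is the left derivative there, and every
  -- chord to the right has a larger slope.
  set T : Set ℝ := (fun x => (φ s - φ x) / (s - x)) '' Set.Iio s with hT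
  have hTne : T.Nonempty := ⟨_, s - 1, by simp, rfl⟩
  have hbd : ∀ z, s < z → ∀ t ∈ T, t ≤ (φ z - φ s) / (z - s) := by
    rintro z hz _ ⟨x, hx, rfl⟩
    exact hslope hx hz
  have hTb : BddAbove T := ⟨_, hbd (s + 1) (by linarith)⟩
  refine ⟨sSup T, ?_, fun s' => ?_⟩
  · refine le_trans ?_ (le_csSup hTb ⟨s - 1, by simp, rfl⟩)
    exact div_nonneg (sub_nonneg.2 (hmono (by linarith))) (by linarith)
  · rcases lt_trichotomy s' s with h | h | h
    · have h1 := le_csSup hTb ⟨s', h, rfl⟩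
      have h2 : 0 < s - s' := by linarith
      rw [div_le_iff₀ h2] at h1
      show φ s + _ ≤ φ s'
      linarith
    · subst h; simp
    · have h1 := csSup_le hTne (hbd s' h)
      have h2 : 0 < s' - s := by linarith
      rw [le_div_iff₀ h2] at h1
      show φ s + _ ≤ φ s'
      linarith

/-- The biconjugate estimate: `inf_j t^{-j} e^{l φ*(j / l)} ≤ t e^{-l ω(t)}`. -/
lemma exists_youngExp_le {l : ℝ} (hl : 0 < l) {t : ℝ} (ht : 1 ≤ t) :
    ∃ j : ℕ, youngExp ω l j ≤ t ^ (j + 1) * Real.exp (-(l * ω t)) := by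
  have ht0 : 0 < t := by linarith
  obtain ⟨σ, hσ, h⟩ := hω.exists_subgradient (Real.log t)
  rw [Real.exp_log ht0] at h
  -- If σ is a slope at log t, then t maximizes u^{lσ} e^{-lω(u)}. Replacing lσ by its integer part
  -- lowers the power of u ≥ 1 and costs at most one factor t on the other side.
  refine ⟨⌊l * σ⌋₊, youngExp_le hl fun u hu => ?_⟩
  set j := ⌊l * σ⌋₊
  have hj1 : (j : ℝ) ≤ l * σ := Nat.floor_le (by positivity)
  have hj2 : l * σ < j + 1 := Nat.lt_floor_add_one _
  have hu0 : 0 < u := by linarith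
  have hlu := Real.log_nonneg hu
  have hlt := Real.log_nonneg ht
  have h1 := h (Real.log u)
  rw [Real.exp_log hu0] at h1
  have e : ∀ (x : ℝ) (n : ℕ), 0 < x → x ^ n = Real.exp (n * Real.log x) := fun x n hx => by
    rw [mul_comm, Real.exp_mul, Real.exp_log hx, Real.rpow_natCast]
  rw [e u j hu0, e t (j + 1) ht0, ← Real.exp_add, ← Real.exp_add]
  refine Real.exp_le_exp.2 ?_
  push_cast
  nlinarith [mul_le_mul_of_nonneg_left h1 hl.le, mul_le_mul_of_nonneg_right hj1 hlu,
    mul_le_mul_of_nonneg_right hj2.le hlt]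

/-- `ω(t) = O(t)`. -/
lemma exists_le_linear : ∃ C : ℝ, 0 < C ∧ ∀ t, 0 ≤ t → ω t ≤ C * t := by
  set I := ∫ s in Set.Ioi (1 : ℝ), ω s / s ^ 2 with hI
  have hI0 : 0 ≤ I := setIntegral_nonneg measurableSet_Ioi fun s hs =>
    div_nonneg (hω.nonneg s (by linarith [Set.mem_Ioi.1 hs])) (by positivity)
  -- On (t, 2t] one has ω(s)/s² ≥ ω(t)/(2t)², so integration gives ω(t)/(4t) ≤ I for t ≥ 1. The
  -- summand 1 only makes the constant positive.
  refine ⟨4 * I + 1, by positivity, fun t ht => ?_⟩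
  rcases le_total t 1 with h | h
  · rw [hω.normalized t ht h]; positivity
  have ht0 : 0 < t := by linarith
  have h1 : ∫ s in Set.Ioc t (2 * t), ω t / (2 * t) ^ 2 ≤ ∫ s in Set.Ioc t (2 * t), ω s / s ^ 2 := by
    refine setIntegral_mono_on (by simp) ?_ measurableSet_Ioc fun s hs => ?_
    · exact hω.nonquasianalytic.mono_set fun s hs => lt_of_le_of_lt h hs.1
    · have hs0 : 0 < s := ht0.trans hs.1
      have := hω.monotoneOn ht hs0.le hs.1.le
      have h0 := hω.nonneg t ht
      have h0' := hω.nonneg s hs0.le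
      gcongr
      exact hs.2
  have h2 : ∫ s in Set.Ioc t (2 * t), ω s / s ^ 2 ≤ I := by
    refine setIntegral_mono_set hω.nonquasianalytic ?_ ?_
    · filter_upwards [ae_restrict_mem measurableSet_Ioi] with s hs
      exact div_nonneg (hω.nonneg s (by linarith [Set.mem_Ioi.1 hs])) (by positivity)
    · exact (show Set.Ioc t (2 * t) ⊆ Set.Ioi 1 from
        fun s hs => lt_of_le_of_lt h hs.1).eventuallyLE
  rw [setIntegral_const] at h1
  have h3 : (volume : Measure ℝ).real (Set.Ioc t (2 * t)) = t := by
    rw [Real.volume_real_Ioc_of_le (by linarith)]; ring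
  rw [h3, smul_eq_mul] at h1
  have h4 : t * (ω t / (2 * t) ^ 2) = ω t / (4 * t) := by field_simp; ring
  rw [h4] at h1
  have h5 := h1.trans h2
  rw [div_le_iff₀ (by positivity)] at h5
  nlinarith

/-- If √n ≤ s, the left factor is at most (2s)^n. Otherwise it is at most (2√n)^n, and ω(t) = O(t)
gives lω(√n) ≤ (lB)² + n, so that evaluating the supremum at t = √n bounds √n^n at the price of e^n
≤ 3^n. The form (s+√n)^n is that of the derivatives of exponentials of quadratic forms. -/
lemma exists_add_sqrt_pow_mul_exp_le {l : ℝ} (hl : 0 < l) :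
    ∃ C : ℝ, 0 < C ∧ ∀ (n : ℕ) (s : ℝ), 0 ≤ s →
      (s + Real.sqrt n) ^ n * Real.exp (-(l * ω s)) ≤ C * 6 ^ n * youngExp ω l n := by
  obtain ⟨B, hB, h⟩ := hω.exists_le_linear
  refine ⟨Real.exp ((l * B) ^ 2), Real.exp_pos _, fun n s hs => ?_⟩
  have hC1 : 1 ≤ Real.exp ((l * B) ^ 2) := Real.one_le_exp (by positivity)
  have hw := mul_nonneg hl.le (hω.nonneg s hs)
  rcases le_total (Real.sqrt n) s with h1 | h1
  · have h2 : (s + Real.sqrt n) ^ n ≤ (2 * s) ^ n :=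
      pow_le_pow_left₀ (by positivity) (by linarith) n
    calc _ ≤ (2 * s) ^ n * Real.exp (-(l * ω s)) := by gcongr
      _ = 1 * 2 ^ n * (s ^ n * Real.exp (-(l * ω s))) := by rw [mul_pow]; ring
      _ ≤ Real.exp ((l * B) ^ 2) * 6 ^ n * youngExp ω l n := by
        have := hω.pow_mul_exp_le hl n hs
        gcongr
        norm_num
  · have h2 : (s + Real.sqrt n) ^ n ≤ (2 * Real.sqrt n) ^ n :=
      pow_le_pow_left₀ (by positivity) (by linarith) n
    have h3 := hω.pow_mul_exp_le hl n (Real.sqrt_nonneg n)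
    have h4 := h _ (Real.sqrt_nonneg n)
    have hsq : Real.sqrt n ^ 2 = n := Real.sq_sqrt (Nat.cast_nonneg n)
    have h5 : l * ω (Real.sqrt n) ≤ (l * B) ^ 2 + n := by
      nlinarith [mul_le_mul_of_nonneg_left h4 hl.le, sq_nonneg (l * B - Real.sqrt n / 2),
        sq_nonneg (Real.sqrt n)]
    have h6 : Real.sqrt n ^ n ≤ Real.exp ((l * B) ^ 2) * 3 ^ n * youngExp ω l n := by
      have e3 : Real.exp n ≤ 3 ^ n := by
        rw [← mul_one (n : ℝ), Real.exp_nat_mul]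
        exact pow_le_pow_left₀ (Real.exp_pos _).le (by linarith [Real.exp_one_lt_d9]) n
      calc Real.sqrt n ^ n = Real.exp (l * ω (Real.sqrt n)) *
            (Real.sqrt n ^ n * Real.exp (-(l * ω (Real.sqrt n)))) := by
            rw [Real.exp_neg]; field_simp
        _ ≤ Real.exp ((l * B) ^ 2 + n) * youngExp ω l n := by gcongr
        _ = Real.exp ((l * B) ^ 2) * Real.exp n * youngExp ω l n := by rw [Real.exp_add]
        _ ≤ _ := by gcongr; exact (youngExp_pos _ _ _).le
    have h7 : Real.exp (-(l * ω s)) ≤ 1 := Real.exp_le_one_iff.2 (by linarith)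
    calc _ ≤ (2 * Real.sqrt n) ^ n * 1 := by gcongr
      _ = 2 ^ n * Real.sqrt n ^ n := by rw [mul_pow]; ring
      _ ≤ 2 ^ n * (Real.exp ((l * B) ^ 2) * 3 ^ n * youngExp ω l n) := by gcongr
      _ = _ := by rw [show (6 : ℝ) ^ n = 2 ^ n * 3 ^ n by rw [← mul_pow]; norm_num]; ring

/-- `t^k = O(e^{ω(t)})` for every power. -/
lemma exists_one_add_rpow_le (k : ℝ) (hk : 0 < k) :
    ∃ C : ℝ, 0 < C ∧ ∀ t, 0 ≤ t → (1 + t) ^ k ≤ C * Real.exp (ω t) := by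
  obtain ⟨X, hX1, hX⟩ := hω.eventually_log_le k hk
  refine ⟨(1 + X) ^ k + 2 ^ k, by positivity, fun t ht => ?_⟩
  have hw := Real.one_le_exp (hω.nonneg t ht)
  rcases le_total X t with h | h
  · have ht0 : 0 < t := by linarith
    calc (1 + t) ^ k ≤ (2 * t) ^ k := Real.rpow_le_rpow (by linarith) (by linarith) hk.le
      _ = 2 ^ k * t ^ k := Real.mul_rpow (by norm_num) ht
      _ ≤ 2 ^ k * Real.exp (ω t) := by
        gcongr
        rw [Real.rpow_def_of_pos ht0]
        refine Real.exp_le_exp.2 ?_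
        rw [mul_comm]; exact hX t h
      _ ≤ _ := by
        have : 0 ≤ (1 + X) ^ k := by positivity
        gcongr
        linarith
  · calc (1 + t) ^ k ≤ (1 + X) ^ k := Real.rpow_le_rpow (by linarith) (by linarith) hk.le
      _ ≤ ((1 + X) ^ k + 2 ^ k) * 1 := by
        have : (0 : ℝ) ≤ 2 ^ k := by positivity
        linarith
      _ ≤ _ := by gcongr

lemma continuous_weight_norm {F : Type*} [NormedAddCommGroup F] : Continuous fun y : F => ω ‖y‖ :=
  hω.continuousOn.comp_continuous continuous_norm fun _ => norm_nonneg _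

lemma weight_norm_nonneg {F : Type*} [NormedAddCommGroup F] (y : F) : 0 ≤ ω ‖y‖ :=
  hω.nonneg _ (norm_nonneg _)

/-- `e^{-l ω}` is integrable for large `l`. -/
lemma exists_integrable_exp (F : Type*) [NormedAddCommGroup F] [NormedSpace ℝ F]
    [FiniteDimensional ℝ F] [MeasurableSpace F] [BorelSpace F] (μ : Measure F)
    [μ.IsAddHaarMeasure] :
    ∀ l : ℝ, 1 ≤ l → Integrable (fun y : F => Real.exp (-(l * ω ‖y‖))) μ := by
  intro l hl
  obtain ⟨C, hC, h⟩ := hω.exists_one_add_rpow_le (Module.finrank ℝ F + 1) (by positivity)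
  have hi := (integrable_one_add_norm (μ := μ) (E := F) (r := Module.finrank ℝ F + 1)
    (by linarith)).const_mul C
  refine hi.mono' ?_ ?_
  · exact (Real.continuous_exp.comp
      ((continuous_const.mul hω.continuous_weight_norm).neg)).aestronglyMeasurable
  · refine Eventually.of_forall fun y => ?_
    rw [Real.norm_of_nonneg (Real.exp_pos _).le]
    have h1 := h ‖y‖ (norm_nonneg y)
    have hp : 0 < 1 + ‖y‖ := by positivity
    rw [Real.rpow_neg hp.le, ← div_eq_mul_inv, le_div_iff₀ (by positivity)]
    calc _ ≤ Real.exp (-(l * ω ‖y‖)) * (C * Real.exp (ω ‖y‖)) := by gcongr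
      _ = C * Real.exp (-((l - 1) * ω ‖y‖)) := by
        rw [mul_left_comm, ← Real.exp_add]; ring_nf
      _ ≤ C * 1 := by
        gcongr
        refine Real.exp_le_one_iff.2 ?_
        have := mul_nonneg (sub_nonneg.2 hl) (hω.weight_norm_nonneg y)
        linarith
      _ = C := mul_one C

end IsWeight

/-! ### Derivatives of e^Q, mixed derivatives, and differentiation under the integral -/

section DerivativeBounds

variable {E F G : Type*} [NormedAddCommGroup E] [NormedSpace ℝ E] [NormedAddCommGroup F]
  [NormedSpace ℝ F] [NormedAddCommGroup G] [NormedSpace ℝ G]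

lemma norm_iteratedFDeriv_clm (S : E →L[ℝ] G) (z : E) (j : ℕ) :
    ‖iteratedFDeriv ℝ (j + 1) (fun z => S z) z‖ = if j = 0 then ‖S‖ else 0 := by
  have h : fderiv ℝ (fun z => S z) = fun _ => S := funext fun z => S.fderiv
  rw [← norm_iteratedFDeriv_fderiv, h]
  split_ifs with hj
  · subst hj; simp
  · rw [iteratedFDeriv_const_of_ne hj]; simp

/-- The derivatives of `e^Q` for a quadratic polynomial `Q` without linear part. -/
lemma norm_iteratedFDeriv_cexp_quadratic_le (Q : E → ℂ) (S : E →L[ℝ] E →L[ℝ] ℂ)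
    (hQ : ∀ z, HasFDerivAt Q (S z) z) (n : ℕ) (z : E) :
    ‖iteratedFDeriv ℝ n (fun z => Complex.exp (Q z)) z‖ ≤
      ‖Complex.exp (Q z)‖ * (‖S z‖ + Real.sqrt (n * ‖S‖)) ^ n := by
  have hQs : ContDiff ℝ (⊤ : ℕ∞) Q := by
    rw [contDiff_infty_iff_fderiv]
    refine ⟨fun z => (hQ z).differentiableAt, ?_⟩
    rw [show fderiv ℝ Q = fun z => S z from funext fun z => (hQ z).fderiv]
    exact S.contDiff
  have hes : ContDiff ℝ (⊤ : ℕ∞) (fun z => Complex.exp (Q z)) := hQs.cexp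
  have hfd : fderiv ℝ (fun z => Complex.exp (Q z)) = fun z => Complex.exp (Q z) • S z :=
    funext fun z => (hQ z).cexp.fderiv
  induction n using Nat.strong_induction_on with
  | _ n ih =>
  rcases n with _ | n
  · simp
  have hleib : ‖iteratedFDeriv ℝ (n + 1) (fun z => Complex.exp (Q z)) z‖ ≤
      ∑ i ∈ Finset.range (n + 1), (n.choose i : ℝ) *
        ‖iteratedFDeriv ℝ i (fun z => Complex.exp (Q z)) z‖ *
        ‖iteratedFDeriv ℝ (n - i) (fun z => S z) z‖ := by
    rw [← norm_iteratedFDeriv_fderiv, hfd]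
    exact norm_iteratedFDeriv_smul_le hes (S.contDiff) z (mod_cast le_top)
  refine hleib.trans ?_
  set e0 := ‖Complex.exp (Q z)‖
  set s := ‖S z‖
  set c := ‖S‖
  have hs : 0 ≤ s := norm_nonneg _
  have hc : 0 ≤ c := norm_nonneg S
  have he0 : 0 ≤ e0 := norm_nonneg _
  rw [Finset.sum_range_succ]
  have htop : (n.choose n : ℝ) * ‖iteratedFDeriv ℝ n (fun z => Complex.exp (Q z)) z‖ *
      ‖iteratedFDeriv ℝ (n - n) (fun z => S z) z‖ ≤ e0 * (s + Real.sqrt (n * c)) ^ n * s := by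
    rw [Nat.choose_self, Nat.cast_one, one_mul, Nat.sub_self, norm_iteratedFDeriv_zero]
    exact mul_le_mul_of_nonneg_right (ih n (Nat.lt_succ_self n)) hs
  have hmono : ∀ {a b : ℕ}, a ≤ b → s + Real.sqrt (a * c) ≤ s + Real.sqrt (b * c) := by
    intro a b hab
    gcongr
  rcases n with _ | m
  · simp only [Finset.range_zero, Finset.sum_empty, zero_add] at htop ⊢
    refine htop.trans ?_
    have : 0 ≤ Real.sqrt (c) := Real.sqrt_nonneg _
    simp only [pow_zero, mul_one, pow_one, Nat.cast_one, one_mul]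
    gcongr
    linarith
  rw [Finset.sum_range_succ]
  -- The derivative of e^Q is e^Q times the linear map S, and S has no derivatives of order two or
  -- more; only two Leibniz terms survive.
  have hrest : ∑ i ∈ Finset.range m, ((m + 1).choose i : ℝ) *
      ‖iteratedFDeriv ℝ i (fun z => Complex.exp (Q z)) z‖ *
      ‖iteratedFDeriv ℝ (m + 1 - i) (fun z => S z) z‖ = 0 := by
    refine Finset.sum_eq_zero fun i hi => ?_
    have hi' := Finset.mem_range.1 hi
    rw [show m + 1 - i = (m - i) + 1 by omega, norm_iteratedFDeriv_clm,
      if_neg (by omega), mul_zero]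
  have hm : ((m + 1).choose m : ℝ) * ‖iteratedFDeriv ℝ m (fun z => Complex.exp (Q z)) z‖ *
      ‖iteratedFDeriv ℝ (m + 1 - m) (fun z => S z) z‖ ≤
      (m + 1) * (e0 * (s + Real.sqrt ((m + 1 : ℕ) * c)) ^ m) * c := by
    rw [show m + 1 - m = 0 + 1 by omega, norm_iteratedFDeriv_clm, if_pos rfl,
      Nat.choose_succ_self_right]
    push_cast
    have h1 := ih m (by omega)
    have h2 : (s + Real.sqrt (m * c)) ^ m ≤ (s + Real.sqrt ((m + 1 : ℕ) * c)) ^ m :=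
      pow_le_pow_left₀ (by positivity) (hmono (by omega)) m
    have h3 := h1.trans (mul_le_mul_of_nonneg_left h2 he0)
    push_cast at h3
    gcongr
  rw [hrest, zero_add]
  refine (add_le_add hm htop).trans ?_
  set t := s + Real.sqrt ((m + 1 : ℕ) * c)
  have ht0 : 0 ≤ t := by positivity
  have hsq : Real.sqrt ((m + 1 : ℕ) * c) ^ 2 = (m + 1 : ℕ) * c := Real.sq_sqrt (by positivity)
  -- The recursion a_{m+2} ≤ s a_{m+1} + (m+1)c a_m is closed by t^n because t = s + √((m+1)c)
  -- satisfies t² ≥ st + (m+1)c.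
  have hkey : (m + 1) * c + s * t ≤ t ^ 2 := by
    have h0 := Real.sqrt_nonneg ((m + 1 : ℕ) * c)
    push_cast at hsq h0
    simp only [t]
    push_cast
    nlinarith
  calc (m + 1) * (e0 * t ^ m) * c + e0 * t ^ (m + 1) * s
      = e0 * t ^ m * ((m + 1) * c + s * t) := by ring
    _ ≤ e0 * t ^ m * t ^ 2 := by gcongr
    _ = e0 * t ^ (m + 1 + 1) := by ring
    _ ≤ _ := by
      gcongr
      exact hmono (by omega)

lemma norm_iteratedFDeriv_iteratedFDeriv (f : E → G) (k K : ℕ) (x : E) :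
    ‖iteratedFDeriv ℝ k (iteratedFDeriv ℝ K f) x‖ = ‖iteratedFDeriv ℝ (K + k) f x‖ := by
  induction K generalizing k with
  | zero =>
    rw [iteratedFDeriv_zero_eq_comp, LinearIsometryEquiv.norm_iteratedFDeriv_comp_left, zero_add]
  | succ K ih =>
    rw [iteratedFDeriv_succ_eq_comp_left]
    refine (LinearIsometryEquiv.norm_iteratedFDeriv_comp_left
      (continuousMultilinearCurryLeftEquiv ℝ (fun _ : Fin (K + 1) => E) G).symm
      (fderiv ℝ (iteratedFDeriv ℝ K f)) x k).trans ?_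
    rw [norm_iteratedFDeriv_fderiv, ih, show K + (k + 1) = K + 1 + k by omega]

lemma iteratedFDeriv_comp_prodMk_right {f : E × F → G} (hf : ContDiff ℝ (⊤ : ℕ∞) f) (K : ℕ)
    (p : E) (y : F) :
    iteratedFDeriv ℝ K (fun q => f (q, y)) p =
      (iteratedFDeriv ℝ K f (p, y)).compContinuousLinearMap
        (fun _ => ContinuousLinearMap.inl ℝ E F) := by
  have h1 : (fun q => f (q, y)) =
      (fun z => f (z + (0, y))) ∘ (ContinuousLinearMap.inl ℝ E F) := by
    funext q; simp
  have h2 : ContDiff ℝ (⊤ : ℕ∞) (fun z => f (z + (0, y))) := hf.comp (by fun_prop)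
  rw [h1, ContinuousLinearMap.iteratedFDeriv_comp_right _ h2 _ (mod_cast le_top),
    iteratedFDeriv_comp_add_right]
  simp

lemma iteratedFDeriv_comp_prodMk_left {f : E × F → G} (hf : ContDiff ℝ (⊤ : ℕ∞) f) (K : ℕ)
    (p : E) (y : F) :
    iteratedFDeriv ℝ K (fun y => f (p, y)) y =
      (iteratedFDeriv ℝ K f (p, y)).compContinuousLinearMap
        (fun _ => ContinuousLinearMap.inr ℝ E F) := by
  have h1 : (fun y => f (p, y)) =
      (fun z => f (z + (p, 0))) ∘ (ContinuousLinearMap.inr ℝ E F) := by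
    funext q; simp
  have h2 : ContDiff ℝ (⊤ : ℕ∞) (fun z => f (z + (p, 0))) := hf.comp (by fun_prop)
  rw [h1, ContinuousLinearMap.iteratedFDeriv_comp_right _ h2 _ (mod_cast le_top),
    iteratedFDeriv_comp_add_right]
  simp

lemma norm_compContinuousLinearMap_le_of_le_one {n : ℕ} (f : ContinuousMultilinearMap ℝ (fun _ : Fin n => E) G)
    (T : F →L[ℝ] E) (hT : ‖T‖ ≤ 1) : ‖f.compContinuousLinearMap (fun _ => T)‖ ≤ ‖f‖ := by
  refine (f.norm_compContinuousLinearMap_le _).trans ?_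
  refine mul_le_of_le_one_right (norm_nonneg _) ?_
  exact Finset.prod_le_one (fun _ _ => norm_nonneg _) fun _ _ => hT

lemma norm_iteratedFDeriv_comp_prodMk_left_le {f : E × F → G} (hf : ContDiff ℝ (⊤ : ℕ∞) f) (K : ℕ)
    (p : E) (y : F) :
    ‖iteratedFDeriv ℝ K (fun y => f (p, y)) y‖ ≤ ‖iteratedFDeriv ℝ K f (p, y)‖ := by
  rw [iteratedFDeriv_comp_prodMk_left hf]
  exact norm_compContinuousLinearMap_le_of_le_one _ _ (ContinuousLinearMap.norm_inr_le_one ℝ E F)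

lemma norm_iteratedFDeriv_comp_prodMk_right_le {f : E × F → G} (hf : ContDiff ℝ (⊤ : ℕ∞) f) (K : ℕ)
    (p : E) (y : F) :
    ‖iteratedFDeriv ℝ K (fun q => f (q, y)) p‖ ≤ ‖iteratedFDeriv ℝ K f (p, y)‖ := by
  rw [iteratedFDeriv_comp_prodMk_right hf]
  exact norm_compContinuousLinearMap_le_of_le_one _ _ (ContinuousLinearMap.norm_inl_le_one ℝ E F)

lemma contDiff_iteratedFDeriv_comp_prodMk_right {f : E × F → G} (hf : ContDiff ℝ (⊤ : ℕ∞) f)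
    (K : ℕ) (p : E) :
    ContDiff ℝ (⊤ : ℕ∞) (fun y => iteratedFDeriv ℝ K (fun q => f (q, y)) p) := by
  simp_rw [iteratedFDeriv_comp_prodMk_right hf]
  have h1 : ContDiff ℝ (⊤ : ℕ∞) (iteratedFDeriv ℝ K f) :=
    hf.iteratedFDeriv_right (by exact_mod_cast le_top)
  exact (ContinuousMultilinearMap.compContinuousLinearMapL (𝕜 := ℝ)
    (F := G) (fun _ : Fin K => ContinuousLinearMap.inl ℝ E F)).contDiff.comp
      (h1.comp (by fun_prop))

/-- The mixed derivatives are bounded by the total derivatives. -/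
lemma norm_iteratedFDeriv_iteratedFDeriv_comp_prodMk_right_le {f : E × F → G}
    (hf : ContDiff ℝ (⊤ : ℕ∞) f) (k K : ℕ) (p : E) (y : F) :
    ‖iteratedFDeriv ℝ k (fun y => iteratedFDeriv ℝ K (fun q => f (q, y)) p) y‖ ≤
      ‖iteratedFDeriv ℝ (K + k) f (p, y)‖ := by
  simp_rw [iteratedFDeriv_comp_prodMk_right hf]
  have h1 : ContDiff ℝ (⊤ : ℕ∞) (iteratedFDeriv ℝ K f) :=
    hf.iteratedFDeriv_right (by exact_mod_cast le_top)
  have h2 : ContDiff ℝ (⊤ : ℕ∞) (fun y : F => iteratedFDeriv ℝ K f (p, y)) :=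
    h1.comp (by fun_prop)
  let T := ContinuousMultilinearMap.compContinuousLinearMapL (𝕜 := ℝ)
    (F := G) (fun _ : Fin K => ContinuousLinearMap.inl ℝ E F)
  have hT : ‖T‖ ≤ 1 := by
    refine T.opNorm_le_bound zero_le_one fun m => ?_
    rw [one_mul]
    exact norm_compContinuousLinearMap_le_of_le_one _ _ (ContinuousLinearMap.norm_inl_le_one ℝ E F)
  calc ‖iteratedFDeriv ℝ k (fun y => T (iteratedFDeriv ℝ K f (p, y))) y‖
      ≤ ‖T‖ * ‖iteratedFDeriv ℝ k (fun y => iteratedFDeriv ℝ K f (p, y)) y‖ :=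
        T.norm_iteratedFDeriv_comp_left h2.contDiffAt (mod_cast le_top)
    _ ≤ 1 * ‖iteratedFDeriv ℝ k (iteratedFDeriv ℝ K f) (p, y)‖ := by
        gcongr
        exact norm_iteratedFDeriv_comp_prodMk_left_le h1 k p y
    _ = _ := by rw [one_mul, norm_iteratedFDeriv_iteratedFDeriv]

/-- Differentiation of all orders under the integral sign. -/
theorem hasFTaylorSeriesUpTo_integral [CompleteSpace G] {α : Type*} [MeasurableSpace α]
    {μ : Measure α} {Φ : E → α → G} (hΦ : ∀ y, ContDiff ℝ (⊤ : ℕ∞) fun p => Φ p y)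
    (hm : ∀ K p, AEStronglyMeasurable (fun y => iteratedFDeriv ℝ K (fun p => Φ p y) p) μ)
    (hb : ∀ K p₀, ∃ s ∈ 𝓝 p₀, ∃ b : α → ℝ, Integrable b μ ∧
      ∀ p ∈ s, ∀ y, ‖iteratedFDeriv ℝ K (fun p => Φ p y) p‖ ≤ b y) :
    HasFTaylorSeriesUpTo (⊤ : ℕ∞) (fun p => ∫ y, Φ p y ∂μ)
      (fun p K => ∫ y, iteratedFDeriv ℝ K (fun p => Φ p y) p ∂μ) := by
  have hint : ∀ K p, Integrable (fun y => iteratedFDeriv ℝ K (fun p => Φ p y) p) μ := by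
    intro K p
    obtain ⟨s, hs, b, hbi, hb'⟩ := hb K p
    exact hbi.mono' (hm K p) (Eventually.of_forall fun y => hb' p (mem_of_mem_nhds hs) y)
  have hder : ∀ (K : ℕ) (p : E), HasFDerivAt
      (fun p => ∫ y, iteratedFDeriv ℝ K (fun p => Φ p y) p ∂μ)
      ((∫ y, iteratedFDeriv ℝ (K + 1) (fun p => Φ p y) p ∂μ).curryLeft) p := by
    intro K p
    obtain ⟨s, hs, b, hbi, hb'⟩ := hb (K + 1) p
    -- Currying commutes with the integral, so the derivative obtained by domination is the next
    -- term of the Taylor series.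
    have hcurry : (∫ y, iteratedFDeriv ℝ (K + 1) (fun p => Φ p y) p ∂μ).curryLeft =
        ∫ y, (iteratedFDeriv ℝ (K + 1) (fun p => Φ p y) p).curryLeft ∂μ := by
      ext v m
      have hi : Integrable (fun y => (iteratedFDeriv ℝ (K + 1) (fun p => Φ p y) p).curryLeft) μ := by
        refine Integrable.mono (hint (K + 1) p) ?_ (Eventually.of_forall fun y => ?_)
        · exact (continuousMultilinearCurryLeftEquiv ℝ (fun _ : Fin (K + 1) => E)
            G).continuous.comp_aestronglyMeasurable (hm (K + 1) p)
        · rw [ContinuousMultilinearMap.curryLeft_norm]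
      rw [ContinuousMultilinearMap.curryLeft_apply,
        ContinuousMultilinearMap.integral_apply (hint (K + 1) p),
        ContinuousLinearMap.integral_apply hi,
        ContinuousMultilinearMap.integral_apply (hi.apply_continuousLinearMap v)]
      rfl
    rw [hcurry]
    refine hasFDerivAt_integral_of_dominated_of_fderiv_le (bound := b)
      (F' := fun p y => (iteratedFDeriv ℝ (K + 1) (fun p => Φ p y) p).curryLeft) hs
      (Eventually.of_forall fun q => hm K q) (hint K p) ?_ ?_ hbi ?_
    · exact (continuousMultilinearCurryLeftEquiv ℝ (fun _ : Fin (K + 1) => E)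
        G).continuous.comp_aestronglyMeasurable (hm (K + 1) p)
    · refine Eventually.of_forall fun y q hq => ?_
      have := hb' q hq y
      rwa [ContinuousMultilinearMap.curryLeft_norm]
    · refine Eventually.of_forall fun y q _ => ?_
      have h := ((hΦ y).differentiable_iteratedFDeriv (m := K)
        (by exact_mod_cast ENat.natCast_lt_top K) q).hasFDerivAt
      rwa [fderiv_iteratedFDeriv] at h
  refine ⟨fun p => ?_, fun K _ p => hder K p, fun K _ => ?_⟩
  · rw [ContinuousMultilinearMap.curry0, ContinuousMultilinearMap.integral_apply (hint 0 p)]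
    rfl
  · exact continuous_iff_continuousAt.2 fun p => (hder K p).continuousAt

end DerivativeBounds

/-! ### Decay of Fourier integrals by integration by parts -/

section FourierDecay

variable {F G : Type*} [NormedAddCommGroup F] [InnerProductSpace ℝ F] [FiniteDimensional ℝ F]
  [MeasurableSpace F] [BorelSpace F] [NormedAddCommGroup G] [NormedSpace ℂ G]

open scoped FourierTransform RealInnerProductSpace in
-- Passage between the kernel e^{i⟨y,v⟩} and the normalization e^{-2πi⟨y,w⟩}, with w = -v/(2π).
lemma fourier_eq_integral_cexp (r : F → G) (v : F) :
    ∫ y, Complex.exp (Complex.I * ((⟪y, v⟫ : ℝ) : ℂ)) • r y = 𝓕 r (-(2 * Real.pi)⁻¹ • v) := by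
  rw [Real.fourier_eq']
  refine integral_congr_ae (Eventually.of_forall fun y => ?_)
  simp only [inner_smul_right]
  congr 2
  push_cast
  have : (Real.pi : ℂ) ≠ 0 := mod_cast Real.pi_ne_zero
  field_simp

open scoped FourierTransform RealInnerProductSpace in
-- Integration by parts n times in the direction of the frequency. No boundary terms arise because
-- all derivatives are integrable.
lemma pow_mul_norm_integral_cexp_le {r : F → G} (hr : ContDiff ℝ (⊤ : ℕ∞) r)
    (hi : ∀ n : ℕ, Integrable (iteratedFDeriv ℝ n r)) (n : ℕ) (v : F) :
    ‖v‖ ^ n * ‖∫ y, Complex.exp (Complex.I * ((⟪y, v⟫ : ℝ) : ℂ)) • r y‖ ≤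
      ∫ y, ‖iteratedFDeriv ℝ n r y‖ := by
  rw [fourier_eq_integral_cexp]
  set w : F := -(2 * Real.pi)⁻¹ • v with hw
  have hvw : ‖v‖ = 2 * Real.pi * ‖w‖ := by
    rw [hw, norm_smul, norm_neg, norm_inv, Real.norm_of_nonneg (by positivity)]
    field_simp
  have h1 := congrFun (Real.fourier_iteratedFDeriv hr (fun n _ => hi n) (n := n) le_top) w
  have h2 : ‖𝓕 (iteratedFDeriv ℝ n r) w‖ ≤ ∫ y, ‖iteratedFDeriv ℝ n r y‖ :=
    VectorFourier.norm_fourierIntegral_le_integral_norm _ _ _ _ _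
  -- Evaluated at (w,…,w) the multiplier has modulus (2π|w|²)^n = |v|^n |w|^n; the factor |w|^n is
  -- cancelled against the operator-norm bound when w ≠ 0.
  have h3 := (VectorFourier.fourierPowSMulRight (-innerSL ℝ) (𝓕 r) w n).le_opNorm (fun _ => w)
  rw [VectorFourier.fourierPowSMulRight_apply, ← h1] at h3
  simp only [Finset.prod_const, Finset.card_univ, Fintype.card_fin] at h3
  have h4 : ‖v‖ ^ n * ‖𝓕 r w‖ * ‖w‖ ^ n ≤ ‖𝓕 (iteratedFDeriv ℝ n r) w‖ * ‖w‖ ^ n := by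
    refine le_trans (le_of_eq ?_) h3
    have h5 : ((-innerSL ℝ : F →L[ℝ] F →L[ℝ] ℝ) w) w = -‖w‖ ^ 2 := by
      rw [← real_inner_self_eq_norm_sq]; rfl
    simp only [h5, norm_smul, hvw, norm_pow, norm_neg, norm_mul, Complex.norm_I, Complex.norm_real,
      Real.norm_of_nonneg Real.pi_pos.le, Complex.norm_ofNat, mul_one, norm_norm]
    ring
  rcases eq_or_ne w 0 with h0 | h0
  · rw [hvw, h0]
    rcases n with _ | n
    · simp only [pow_zero, one_mul, norm_iteratedFDeriv_zero]
      exact VectorFourier.norm_fourierIntegral_le_integral_norm _ _ _ _ _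
    · simp only [norm_zero, mul_zero, ne_eq, Nat.add_eq_zero_iff, one_ne_zero, and_false, not_false_eq_true, zero_pow, zero_mul]
      positivity
  · exact (le_of_mul_le_mul_right h4 (by positivity)).trans h2

end FourierDecay

/-! ### Calculus of ultradifferentiable estimates -/

section DerivBound

variable {E F G : Type*} [NormedAddCommGroup E] [NormedSpace ℝ E] [NormedAddCommGroup F]
  [NormedSpace ℝ F] [NormedAddCommGroup G] [NormedSpace ℝ G]

/-- The ultradifferentiable estimates `|D^K g| ≤ M c^K e^{l φ*(K / l)} V`. -/
def DerivBound (ω : ℝ → ℝ) (c l M : ℝ) (V : E → ℝ) (g : E → G) : Prop :=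
  ∀ (K : ℕ) (z : E), ‖iteratedFDeriv ℝ K g z‖ ≤ M * c ^ K * youngExp ω l K * V z

variable {ω : ℝ → ℝ} (hω : IsWeight ω)
include hω

/-- The Leibniz sum: superadditivity of the exponents merges the two sequences into one, and the
binomial theorem adds the geometric constants. -/
lemma IsWeight.sum_choose_mul_le {l : ℝ} (hl : 0 < l) {c₁ c₂ M₁ M₂ : ℝ} (hc₁ : 0 ≤ c₁) (hc₂ : 0 ≤ c₂)
    (hM₁ : 0 ≤ M₁) (hM₂ : 0 ≤ M₂) (u v : ℕ → ℝ) (hv : ∀ i, 0 ≤ v i)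
    (h₁ : ∀ i, u i ≤ M₁ * c₁ ^ i * youngExp ω l i)
    (h₂ : ∀ i, v i ≤ M₂ * c₂ ^ i * youngExp ω l i) (K : ℕ) :
    ∑ i ∈ Finset.range (K + 1), (K.choose i : ℝ) * u i * v (K - i) ≤
      M₁ * M₂ * (c₁ + c₂) ^ K * youngExp ω l K := by
  have hA := fun i => (youngExp_pos ω l i).le
  rw [add_pow, Finset.mul_sum, Finset.sum_mul]
  refine Finset.sum_le_sum fun i hi => ?_
  have hiK : i ≤ K := Nat.lt_succ_iff.1 (Finset.mem_range.1 hi)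
  have h3 := hω.youngExp_mul_le hl i (K - i)
  rw [Nat.add_sub_cancel' hiK] at h3
  calc (K.choose i : ℝ) * u i * v (K - i)
      ≤ (K.choose i : ℝ) * (M₁ * c₁ ^ i * youngExp ω l i) *
        (M₂ * c₂ ^ (K - i) * youngExp ω l (K - i)) := by
        have := hA i
        have h4 := h₁ i
        have h5 := h₂ (K - i)
        have h6 := hv (K - i)
        gcongr
    _ = (K.choose i : ℝ) * (M₁ * M₂ * c₁ ^ i * c₂ ^ (K - i)) *
        (youngExp ω l i * youngExp ω l (K - i)) := by ring
    _ ≤ (K.choose i : ℝ) * (M₁ * M₂ * c₁ ^ i * c₂ ^ (K - i)) * youngExp ω l K := by gcongr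
    _ = _ := by ring

namespace DerivBound

lemma mul {l : ℝ} (hl : 0 < l) {c₁ c₂ M₁ M₂ : ℝ} (hc₁ : 0 ≤ c₁) (hc₂ : 0 ≤ c₂)
    (hM₁ : 0 ≤ M₁) (hM₂ : 0 ≤ M₂) {V₁ V₂ : E → ℝ} (hV₁ : ∀ z, 0 ≤ V₁ z) (hV₂ : ∀ z, 0 ≤ V₂ z)
    {g₁ g₂ : E → ℂ} (hg₁ : ContDiff ℝ (⊤ : ℕ∞) g₁) (hg₂ : ContDiff ℝ (⊤ : ℕ∞) g₂)
    (h₁ : DerivBound ω c₁ l M₁ V₁ g₁) (h₂ : DerivBound ω c₂ l M₂ V₂ g₂) :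
    DerivBound ω (c₁ + c₂) l (M₁ * M₂) (fun z => V₁ z * V₂ z) (fun z => g₁ z * g₂ z) := by
  intro K z
  refine (norm_iteratedFDeriv_mul_le hg₁ hg₂ z (n := K) (mod_cast le_top)).trans ?_
  refine (hω.sum_choose_mul_le hl hc₁ hc₂ (mul_nonneg hM₁ (hV₁ z)) (mul_nonneg hM₂ (hV₂ z))
    (fun i => ‖iteratedFDeriv ℝ i g₁ z‖) (fun i => ‖iteratedFDeriv ℝ i g₂ z‖)
    (fun _ => norm_nonneg _) (fun i => ?_) (fun i => ?_) K).trans (le_of_eq (by ring))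
  · exact (h₁ i z).trans (le_of_eq (by ring))
  · exact (h₂ i z).trans (le_of_eq (by ring))

lemma mono {c c' l l' M M' : ℝ} (hc : 0 ≤ c) (hcc : c ≤ c') (hl : 0 < l) (hll : l ≤ l')
    (hM : 0 ≤ M) (hMM : M ≤ M') {V V' : E → ℝ} (hV : ∀ z, 0 ≤ V z) (hVV : ∀ z, V z ≤ V' z)
    {g : E → G} (h : DerivBound ω c l' M V g) : DerivBound ω c' l M' V' g := by
  intro K z
  refine (h K z).trans ?_
  have h1 := hω.youngExp_anti hl hll K
  have h2 := (youngExp_pos ω l' K).le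
  have h3 := (youngExp_pos ω l K).le
  have h4 := hV z
  have h5 := hVV z
  have h6 : 0 ≤ M' := hM.trans hMM
  have h7 : 0 ≤ c' := hc.trans hcc
  gcongr

omit hω in
lemma comp_clm {c l M : ℝ} {V : F → ℝ} {g : F → G} (hg : ContDiff ℝ (⊤ : ℕ∞) g)
    (h : DerivBound ω c l M V g) (T : E →L[ℝ] F) :
    DerivBound ω (c * ‖T‖) l M (fun z => V (T z)) (fun z => g (T z)) := by
  intro K z
  have e := T.iteratedFDeriv_comp_right hg z (i := K) (mod_cast le_top)
  rw [show (fun z => g (T z)) = g ∘ T from rfl, e]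
  refine ((iteratedFDeriv ℝ K g (T z)).norm_compContinuousLinearMap_le _).trans ?_
  simp only [Finset.prod_const, Finset.card_univ, Fintype.card_fin]
  calc _ ≤ M * c ^ K * youngExp ω l K * V (T z) * ‖T‖ ^ K := by
        gcongr
        exact h K (T z)
    _ = _ := by rw [mul_pow]; ring

omit hω in
lemma comp_add_right {c l M : ℝ} {V : E → ℝ} {g : E → G}
    (h : DerivBound ω c l M V g) (a : E) :
    DerivBound ω c l M (fun z => V (z + a)) (fun z => g (z + a)) := by
  intro K z
  rw [iteratedFDeriv_comp_add_right]
  exact h K (z + a)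

/-- Removal of the geometric factor. -/
lemma _root_.UltraPseudo.IsWeight.exists_derivBound_one (c : ℝ) (hc : 0 ≤ c) {l : ℝ} (hl : 0 < l) :
    ∃ l' : ℝ, l ≤ l' ∧ ∃ C : ℝ, 0 < C ∧ ∀ μ, l' ≤ μ → ∀ (M : ℝ) (V : E → ℝ) (g : E → G), 0 ≤ M →
      (∀ z, 0 ≤ V z) → DerivBound ω c μ M V g → DerivBound ω 1 l (C * M) V g := by
  obtain ⟨l', hl', C, hC, h⟩ := hω.exists_pow_mul_youngExp_le c hc hl
  refine ⟨l', hl', C, hC, fun μ hμ M V g hM hV hg K z => ?_⟩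
  have h1 := h μ hμ K
  have h2 := hV z
  calc _ ≤ M * c ^ K * youngExp ω μ K * V z := hg K z
    _ = M * (c ^ K * youngExp ω μ K) * V z := by ring
    _ ≤ M * (C * youngExp ω l K) * V z := by gcongr
    _ = _ := by rw [one_pow]; ring

end DerivBound

/-- Decay from polynomial bounds. -/
lemma IsWeight.exists_le_exp_of_pow_mul_le {l : ℝ} (hl : 0 < l) :
    ∃ C : ℝ, 0 < C ∧ ∀ t X B : ℝ, 0 ≤ t → 0 ≤ B →
      (∀ k : ℕ, t ^ k * X ≤ B * youngExp ω (l + 1) k) → X ≤ C * B * Real.exp (-(l * ω t)) := by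
  obtain ⟨C, hC, h⟩ := hω.exists_one_add_rpow_le 1 one_pos
  have hl1 : 0 < l + 1 := by linarith
  refine ⟨C + 1, by positivity, fun t X B ht hB hX => ?_⟩
  -- For t ≥ 1 take the k of the biconjugate estimate at parameter l+1; its spare factor t is
  -- swallowed by the extra e^{-ω(t)}. For t ≤ 1 the weight vanishes and k = 0 suffices.
  rcases le_total 1 t with h1 | h1
  · obtain ⟨k, hk⟩ := hω.exists_youngExp_le hl1 h1
    have ht0 : 0 < t := by linarith
    have h2 := h t ht
    rw [Real.rpow_one] at h2
    have h3 : t ^ k * X ≤ t ^ k * (C * B * Real.exp (-(l * ω t))) := by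
      calc t ^ k * X ≤ B * youngExp ω (l + 1) k := hX k
        _ ≤ B * (t ^ (k + 1) * Real.exp (-((l + 1) * ω t))) := by gcongr
        _ = t ^ k * (t * B * Real.exp (-((l + 1) * ω t))) := by ring
        _ ≤ t ^ k * (C * Real.exp (ω t) * B * Real.exp (-((l + 1) * ω t))) := by
          gcongr
          linarith
        _ = t ^ k * (C * B * (Real.exp (ω t) * Real.exp (-((l + 1) * ω t)))) := by ring
        _ = _ := by rw [← Real.exp_add]; ring_nf
    refine (le_of_mul_le_mul_left h3 (by positivity)).trans ?_
    gcongr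
    linarith
  · have h2 := hX 0
    rw [hω.youngExp_zero hl1, hω.normalized t ht h1] at *
    simp only [pow_zero, one_mul, mul_one, mul_zero, neg_zero, Real.exp_zero] at *
    nlinarith

end DerivBound

/-! ### The main estimate for partial Fourier transforms -/

section Oscillatory

variable {E F : Type*} [NormedAddCommGroup E] [NormedSpace ℝ E] [NormedAddCommGroup F]
  [InnerProductSpace ℝ F]

open scoped RealInnerProductSpace

/-- The derivative of `(q, y) ↦ i⟨y, L q⟩`. -/
def phaseDeriv (L : E →L[ℝ] F) : (E × F) →L[ℝ] (E × F) →L[ℝ] ℂ :=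
  let b : (E × F) →L[ℝ] (E × F) →L[ℝ] ℝ :=
    ContinuousLinearMap.bilinearComp (innerSL ℝ) (ContinuousLinearMap.snd ℝ E F)
      (L ∘L ContinuousLinearMap.fst ℝ E F)
  (ContinuousLinearMap.compL ℝ (E × F) ℝ ℂ (Complex.I • Complex.ofRealCLM)) ∘L (b + b.flip)

lemma phaseDeriv_apply (L : E →L[ℝ] F) (z z' : E × F) :
    phaseDeriv L z z' = Complex.I * ((⟪z.2, L z'.1⟫ + ⟪z'.2, L z.1⟫ : ℝ) : ℂ) := by
  simp [phaseDeriv, ContinuousLinearMap.bilinearComp_apply, mul_add]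

lemma hasFDerivAt_phase (L : E →L[ℝ] F) (z : E × F) :
    HasFDerivAt (fun z : E × F => Complex.I * ((⟪z.2, L z.1⟫ : ℝ) : ℂ)) (phaseDeriv L z) z := by
  have h1 : HasFDerivAt (fun z : E × F => ⟪z.2, L z.1⟫) _ z :=
    (hasFDerivAt_snd (𝕜 := ℝ) (p := z)).inner ℝ (L.hasFDerivAt.comp z hasFDerivAt_fst)
  have h2 := (Complex.I • Complex.ofRealCLM).hasFDerivAt.comp z h1
  have h3 : (fun z : E × F => Complex.I * ((⟪z.2, L z.1⟫ : ℝ) : ℂ)) =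
      (fun t : ℝ => (Complex.I • Complex.ofRealCLM) t) ∘ (fun z : E × F => ⟪z.2, L z.1⟫) := by
    funext z; simp
  rw [h3]
  refine h2.congr_fderiv ?_
  refine ContinuousLinearMap.ext fun z' => ?_
  rw [phaseDeriv_apply]
  simp [fderivInnerCLM_apply]

lemma norm_phaseDeriv_apply_le (L : E →L[ℝ] F) (z : E × F) :
    ‖phaseDeriv L z‖ ≤ ‖L‖ * (‖z.1‖ + ‖z.2‖) := by
  refine ContinuousLinearMap.opNorm_le_bound _ (by positivity) fun z' => ?_
  rw [phaseDeriv_apply, norm_mul, Complex.norm_I, one_mul, Complex.norm_real]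
  refine (norm_add_le _ _).trans ?_
  have h1 : ‖⟪z.2, L z'.1⟫‖ ≤ ‖z.2‖ * (‖L‖ * ‖z'‖) :=
    (norm_inner_le_norm _ _).trans (by
      gcongr; exact (L.le_opNorm _).trans (by gcongr; exact norm_fst_le z'))
  have h2 : ‖⟪z'.2, L z.1⟫‖ ≤ ‖z'‖ * (‖L‖ * ‖z.1‖) :=
    (norm_inner_le_norm _ _).trans (by
      gcongr
      · exact norm_snd_le z'
      · exact L.le_opNorm _)
  linarith

lemma norm_phaseDeriv_le (L : E →L[ℝ] F) : ‖phaseDeriv L‖ ≤ 2 * ‖L‖ := by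
  refine ContinuousLinearMap.opNorm_le_bound _ (by positivity) fun z => ?_
  refine (norm_phaseDeriv_apply_le L z).trans ?_
  have h1 := norm_fst_le z
  have h2 := norm_snd_le z
  nlinarith [norm_nonneg L]

lemma contDiff_cexp_phase (L : E →L[ℝ] F) : ContDiff ℝ (⊤ : ℕ∞)
    (fun z : E × F => Complex.exp (Complex.I * ((⟪z.2, L z.1⟫ : ℝ) : ℂ))) := by
  refine ContDiff.cexp (contDiff_const.mul ?_)
  exact Complex.ofRealCLM.contDiff.comp
    (contDiff_snd.inner ℝ (L.contDiff.comp contDiff_fst))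

/-- Only points (0,y) are needed. There the derivative of the phase has size at most ‖L‖|y|, so the
bound contains no power of the parameter p. -/
lemma norm_iteratedFDeriv_cexp_phase_le (L : E →L[ℝ] F) (n : ℕ) (y : F) :
    ‖iteratedFDeriv ℝ n (fun z : E × F => Complex.exp (Complex.I * ((⟪z.2, L z.1⟫ : ℝ) : ℂ)))
      (0, y)‖ ≤ (2 * ‖L‖ + 1) ^ n * (‖y‖ + Real.sqrt n) ^ n := by
  refine (norm_iteratedFDeriv_cexp_quadratic_le _ (phaseDeriv L) (hasFDerivAt_phase L) n
    (0, y)).trans ?_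
  rw [← mul_pow]
  have h1 : ‖Complex.exp (Complex.I * ((⟪((0 : E), y).2, L ((0 : E), y).1⟫ : ℝ) : ℂ))‖ = 1 := by
    simp
  rw [h1, one_mul]
  refine pow_le_pow_left₀ (by positivity) ?_ n
  have h2 := norm_phaseDeriv_apply_le L (0, y)
  have h3 := norm_phaseDeriv_le L
  have hL := norm_nonneg L
  have h4 : Real.sqrt (n * ‖phaseDeriv L‖) ≤ Real.sqrt n * (2 * ‖L‖ + 1) := by
    rw [Real.sqrt_mul (Nat.cast_nonneg n)]
    gcongr
    refine Real.sqrt_le_iff.2 ⟨by positivity, h3.trans ?_⟩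
    nlinarith
  have h5 : ‖L‖ * ‖y‖ ≤ (2 * ‖L‖ + 1) * ‖y‖ := by
    have := norm_nonneg y
    gcongr
    linarith
  simp only [norm_zero, zero_add] at h2
  linarith

variable [FiniteDimensional ℝ F] [MeasurableSpace F] [BorelSpace F]

/-- The oscillatory integral `p ↦ ∫ e^{i⟨y, L p⟩} g(p, y) dy`. -/
def oscInt (L : E →L[ℝ] F) (g : E × F → ℂ) (p : E) : ℂ :=
  ∫ y, Complex.exp (Complex.I * ((⟪y, L p⟫ : ℝ) : ℂ)) * g (p, y)

/-- Partial Fourier transforms preserve ultradifferentiable estimates and turn regularity in the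
integration variable into decay in the dual variable. -/
theorem IsWeight.exists_derivBound_oscInt {ω : ℝ → ℝ} (hω : IsWeight ω) (L : E →L[ℝ] F) {c l : ℝ}
    (hc : 0 ≤ c) (hl : 0 < l) :
    ∃ l' : ℝ, l ≤ l' ∧ ∃ C : ℝ, 0 < C ∧ ∀ (M : ℝ) (W : E → ℝ) (g : E × F → ℂ), 0 ≤ M →
      Continuous W → (∀ p, 0 ≤ W p) → ContDiff ℝ (⊤ : ℕ∞) g →
      DerivBound ω c l' M (fun z => W z.1 * Real.exp (-(l' * ω ‖z.2‖))) g →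
      ContDiff ℝ (⊤ : ℕ∞) (oscInt L g) ∧
      DerivBound ω 1 l (C * M) (fun p => W p * Real.exp (-(l * ω ‖L p‖))) (oscInt L g) := by
  set c₀ := 2 * ‖L‖ + 1
  have hc₀ : 0 ≤ c₀ := by positivity
  -- Leibniz adds the geometric constants of the phase (6c₀, the 6 from (|y|+√n)^n) and of g.
  set c₃ := c₀ * 6 + c
  have hν : 0 < l + 1 := by linarith
  obtain ⟨μ, hμ, C₁, hC₁, habs⟩ := hω.exists_pow_mul_youngExp_le c₃ (by positivity) hν
  have hμ0 : 0 < μ := by linarith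
  have h2μ : 0 < 2 * μ := by linarith
  obtain ⟨C₂, hC₂, hpow⟩ := hω.exists_add_sqrt_pow_mul_exp_le h2μ
  obtain ⟨C₃, hC₃, hdec⟩ := hω.exists_le_exp_of_pow_mul_le hl
  have hint := hω.exists_integrable_exp F volume 1 le_rfl
  simp only [one_mul] at hint
  set I₀ := ∫ y : F, Real.exp (-(ω ‖y‖))
  have hI₀ : 0 ≤ I₀ := integral_nonneg fun y => (Real.exp_pos _).le
  -- Of the decay 2μ+1 in y, the part 2μ absorbs the derivatives of the phase and the part 1 makes
  -- the integral converge. Then 2μ is split as μ+μ between the orders in p and in y, and μ absorbs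
  -- c₃ down to l+1.
  refine ⟨2 * μ + 1, by linarith, C₃ * (C₂ * I₀ * C₁ ^ 2) + 1, by positivity, ?_⟩
  intro M W g hM hW hW0 hg hgb
  set ψ : E × F → ℂ := fun z => Complex.exp (Complex.I * ((⟪z.2, L z.1⟫ : ℝ) : ℂ)) with hψ
  have hψs : ContDiff ℝ (⊤ : ℕ∞) ψ := contDiff_cexp_phase L
  -- Recentring at p: e^{i⟨y,L(p+q)⟩} is e^{i⟨y,Lp⟩} times the phase at q. The first factor is
  -- constant in q and serves as Fourier kernel in y, so it is never differentiated and no powers of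
  -- Lp appear.
  set Ψ : E → E × F → ℂ := fun p z => ψ z * g (z + (p, 0)) with hΨ
  have hgs : ∀ p : E, ContDiff ℝ (⊤ : ℕ∞) (fun z : E × F => g (z + (p, 0))) := fun p =>
    hg.comp (by fun_prop)
  have hΨs : ∀ p, ContDiff ℝ (⊤ : ℕ∞) (Ψ p) := fun p => hψs.mul (hgs p)
  -- the basic estimate on the integrand recentred at `p`
  have hkey : ∀ N p y, ‖iteratedFDeriv ℝ N (Ψ p) (0, y)‖ ≤
      M * W p * C₂ * c₃ ^ N * youngExp ω (2 * μ) N * Real.exp (-(ω ‖y‖)) := by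
    intro N p y
    refine (norm_iteratedFDeriv_mul_le hψs (hgs p) (0, y) (n := N) (mod_cast le_top)).trans ?_
    -- The product e^{-2μω(y)} e^{2μω(y)} = 1 is inserted into each Leibniz term: the phase uses the
    -- decay against (|y|+√i)^i, and the decay of g pays for the growth.
    have h1 : ∀ i : ℕ, ‖iteratedFDeriv ℝ i ψ (0, y)‖ * Real.exp (-(2 * μ * ω ‖y‖)) ≤
        C₂ * (c₀ * 6) ^ i * youngExp ω (2 * μ) i := by
      intro i
      calc _ ≤ c₀ ^ i * (‖y‖ + Real.sqrt i) ^ i * Real.exp (-(2 * μ * ω ‖y‖)) := by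
            gcongr
            exact norm_iteratedFDeriv_cexp_phase_le L i y
        _ = c₀ ^ i * ((‖y‖ + Real.sqrt i) ^ i * Real.exp (-(2 * μ * ω ‖y‖))) := by ring
        _ ≤ c₀ ^ i * (C₂ * 6 ^ i * youngExp ω (2 * μ) i) := by
            have := hpow i ‖y‖ (norm_nonneg y)
            gcongr
        _ = _ := by rw [mul_pow]; ring
    have h2 : ∀ i : ℕ, ‖iteratedFDeriv ℝ i (fun z : E × F => g (z + (p, 0))) (0, y)‖ *
        Real.exp (2 * μ * ω ‖y‖) ≤
        (M * W p * Real.exp (-(ω ‖y‖))) * c ^ i * youngExp ω (2 * μ) i := by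
      intro i
      rw [iteratedFDeriv_comp_add_right]
      have h3 := hgb i ((0, y) + (p, 0))
      have h4 := hω.youngExp_anti h2μ (show 2 * μ ≤ 2 * μ + 1 by linarith) i
      have h5 := hW0 p
      simp only [Prod.mk_add_mk, zero_add, add_zero] at h3 ⊢
      calc _ ≤ M * c ^ i * youngExp ω (2 * μ + 1) i *
            (W p * Real.exp (-((2 * μ + 1) * ω ‖y‖))) * Real.exp (2 * μ * ω ‖y‖) := by gcongr
        _ = M * c ^ i * youngExp ω (2 * μ + 1) i *
            (W p * (Real.exp (-((2 * μ + 1) * ω ‖y‖)) * Real.exp (2 * μ * ω ‖y‖))) := by ring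
        _ = M * c ^ i * youngExp ω (2 * μ + 1) i * (W p * Real.exp (-(ω ‖y‖))) := by
            rw [← Real.exp_add]; ring_nf
        _ ≤ M * c ^ i * youngExp ω (2 * μ) i * (W p * Real.exp (-(ω ‖y‖))) := by gcongr
        _ = _ := by ring
    have h3 := hω.sum_choose_mul_le h2μ (by positivity) hc hC₂.le
      (mul_nonneg (mul_nonneg hM (hW0 p)) (Real.exp_pos _).le) _ _ (fun i => by positivity) h1 h2 N
    refine le_trans (le_of_eq ?_) (h3.trans (le_of_eq ?_))
    · refine Finset.sum_congr rfl fun i _ => ?_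
      have : Real.exp (-(2 * μ * ω ‖y‖)) * Real.exp (2 * μ * ω ‖y‖) = 1 := by
        rw [← Real.exp_add]; simp
      linear_combination (-(N.choose i : ℝ) * ‖iteratedFDeriv ℝ i ψ (0, y)‖ *
        ‖iteratedFDeriv ℝ (N - i) (fun z : E × F => g (z + (p, 0))) (0, y)‖) * this
    · ring
  have hshift : ∀ K p y, iteratedFDeriv ℝ K (fun q => ψ (q, y) * g (q, y)) p =
      Complex.exp (Complex.I * ((⟪y, L p⟫ : ℝ) : ℂ)) •
        iteratedFDeriv ℝ K (fun q => Ψ p (q, y)) 0 := by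
    intro K p y
    have h1 : (fun q => ψ (q, y) * g (q, y)) = fun q => (fun q =>
        Complex.exp (Complex.I * ((⟪y, L p⟫ : ℝ) : ℂ)) • Ψ p (q, y)) (q + -p) := by
      funext q
      simp only [hΨ, hψ, smul_eq_mul, map_add, map_neg, inner_add_right, inner_neg_right,
        Prod.mk_add_mk, add_zero, neg_add_cancel_right]
      rw [← mul_assoc, ← Complex.exp_add]
      congr 2
      push_cast
      ring
    have h2 : ContDiff ℝ (⊤ : ℕ∞) (fun q => Ψ p (q, y)) := (hΨs p).comp (by fun_prop)
    rw [h1, iteratedFDeriv_comp_add_right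
      (f := fun q => Complex.exp (Complex.I * ((⟪y, L p⟫ : ℝ) : ℂ)) • Ψ p (q, y)) K (-p) p,
      add_neg_cancel]
    exact iteratedFDeriv_const_smul_apply' (R := ℂ) (h2.contDiffAt.of_le (mod_cast le_top))
  have hnorm : ∀ p y, ‖Complex.exp (Complex.I * ((⟪y, L p⟫ : ℝ) : ℂ))‖ = 1 := by
    intro p y; rw [Complex.norm_exp]; simp
  have hprods : ContDiff ℝ (⊤ : ℕ∞) (fun z => ψ z * g z) := hψs.mul hg
  have htaylor := hasFTaylorSeriesUpTo_integral (μ := (volume : Measure F))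
    (Φ := fun p y => ψ (p, y) * g (p, y))
    (fun y => hprods.comp (f := fun q => (q, y)) (by fun_prop))
    (fun K p => (contDiff_iteratedFDeriv_comp_prodMk_right hprods
      K p).continuous.aestronglyMeasurable) (fun K p₀ => by
      -- Continuity of W is needed exactly here: it gives a neighbourhood on which the dominating
      -- function is independent of p.
      refine ⟨{p | W p < W p₀ + 1}, (isOpen_lt hW continuous_const).mem_nhds (by simp),
        fun y => M * (W p₀ + 1) * C₂ * c₃ ^ K * youngExp ω (2 * μ) K * Real.exp (-(ω ‖y‖)),
        hint.const_mul _, fun p hp y => ?_⟩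
      rw [hshift, norm_smul, hnorm, one_mul]
      refine ((norm_iteratedFDeriv_comp_prodMk_right_le (hΨs p) K 0 y).trans (hkey K p y)).trans ?_
      have h1 : W p ≤ W p₀ + 1 := le_of_lt hp
      have h2 := (youngExp_pos ω (2 * μ) K).le
      dsimp only
      gcongr)
  have hosc : (fun p => ∫ y, ψ (p, y) * g (p, y)) = oscInt L g := rfl
  rw [hosc] at htaylor
  refine ⟨htaylor.contDiff, fun K p => ?_⟩
  have hD : iteratedFDeriv ℝ K (oscInt L g) p =
      ∫ y, Complex.exp (Complex.I * ((⟪y, L p⟫ : ℝ) : ℂ)) •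
        iteratedFDeriv ℝ K (fun q => Ψ p (q, y)) 0 := by
    rw [← htaylor.eq_iteratedFDeriv (m := K) (mod_cast le_top) p]
    exact integral_congr_ae (Eventually.of_forall fun y => hshift K p y)
  have hrs := contDiff_iteratedFDeriv_comp_prodMk_right (hΨs p) K (0 : E)
  have hrb : ∀ k y, ‖iteratedFDeriv ℝ k (fun y => iteratedFDeriv ℝ K (fun q => Ψ p (q, y)) 0) y‖ ≤
      M * W p * C₂ * c₃ ^ (K + k) * youngExp ω (2 * μ) (K + k) * Real.exp (-(ω ‖y‖)) := fun k y =>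
    (norm_iteratedFDeriv_iteratedFDeriv_comp_prodMk_right_le (hΨs p) k K 0 y).trans
      (hkey (K + k) p y)
  have hri : ∀ k : ℕ, Integrable
      (iteratedFDeriv ℝ k (fun y => iteratedFDeriv ℝ K (fun q => Ψ p (q, y)) 0)) := fun k =>
    (hint.const_mul _).mono' (hrs.continuous_iteratedFDeriv
      (mod_cast le_top)).aestronglyMeasurable (Eventually.of_forall (hrb k))
  have hB : 0 ≤ M * W p * (C₂ * I₀ * C₁ ^ 2) * youngExp ω (l + 1) K := by
    have := hW0 p
    have := (youngExp_pos ω (l + 1) K).le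
    positivity
  -- Integration by parts in y for every k. Splitting the sequence at order K+k isolates the
  -- dependence on k, which is then traded for e^{-lω(Lp)}.
  have hfin := hdec ‖L p‖ ‖iteratedFDeriv ℝ K (oscInt L g) p‖ _ (norm_nonneg _) hB fun k => by
    rw [hD]
    refine (pow_mul_norm_integral_cexp_le hrs hri k (L p)).trans ?_
    have h1 : ∫ y, ‖iteratedFDeriv ℝ k
        (fun y => iteratedFDeriv ℝ K (fun q => Ψ p (q, y)) 0) y‖ ≤
        ∫ y, M * W p * C₂ * c₃ ^ (K + k) * youngExp ω (2 * μ) (K + k) *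
          Real.exp (-(ω ‖(y : F)‖)) :=
      integral_mono (hri k).norm (hint.const_mul _) (hrb k)
    rw [integral_const_mul] at h1
    refine h1.trans ?_
    have h2 := hω.youngExp_add_le hμ0 K k
    have h3 := habs μ le_rfl K
    have h4 := habs μ le_rfl k
    have h5 := hW0 p
    have h6 := (youngExp_pos ω μ k).le
    have h7 := (youngExp_pos ω (l + 1) K).le
    calc M * W p * C₂ * c₃ ^ (K + k) * youngExp ω (2 * μ) (K + k) * I₀
        ≤ M * W p * C₂ * c₃ ^ (K + k) * (youngExp ω μ K * youngExp ω μ k) * I₀ := by gcongr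
      _ = M * W p * C₂ * ((c₃ ^ K * youngExp ω μ K) * (c₃ ^ k * youngExp ω μ k)) * I₀ := by
          rw [pow_add]; ring
      _ ≤ M * W p * C₂ * ((C₁ * youngExp ω (l + 1) K) * (C₁ * youngExp ω (l + 1) k)) * I₀ := by
          gcongr
      _ = _ := by ring
  refine hfin.trans ?_
  have h1 := hω.youngExp_anti hl (show l ≤ l + 1 by linarith) K
  have h2 := hW0 p
  have h3 := (youngExp_pos ω l K).le
  calc C₃ * (M * W p * (C₂ * I₀ * C₁ ^ 2) * youngExp ω (l + 1) K) * Real.exp (-(l * ω ‖L p‖))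
      ≤ C₃ * (M * W p * (C₂ * I₀ * C₁ ^ 2) * youngExp ω l K) * Real.exp (-(l * ω ‖L p‖)) := by
        gcongr
    _ = (C₃ * (C₂ * I₀ * C₁ ^ 2)) * M * 1 ^ K * youngExp ω l K *
        (W p * Real.exp (-(l * ω ‖L p‖))) := by rw [one_pow]; ring
    _ ≤ _ := by
        gcongr
        linarith

end Oscillatory

/-! ### Gaussian windows: from decay of f and of its Fourier transform to bounds on all derivatives
-/

section GaussianWindow

variable {F : Type*} [NormedAddCommGroup F] [InnerProductSpace ℝ F]

open scoped RealInnerProductSpace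

/-- The inner product as a bilinear map with values in `ℂ`. -/
def innerComplex (F : Type*) [NormedAddCommGroup F] [InnerProductSpace ℝ F] : F →L[ℝ] F →L[ℝ] ℂ :=
  (ContinuousLinearMap.compL ℝ F ℝ ℂ Complex.ofRealCLM) ∘L (innerSL ℝ)

lemma innerComplex_apply (y z : F) : innerComplex F y z = ((⟪y, z⟫ : ℝ) : ℂ) := rfl

lemma norm_innerComplex_apply_le (y : F) : ‖innerComplex F y‖ ≤ ‖y‖ := by
  refine ContinuousLinearMap.opNorm_le_bound _ (norm_nonneg _) fun z => ?_
  rw [innerComplex_apply, Complex.norm_real]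
  exact norm_inner_le_norm y z

lemma norm_innerComplex_le : ‖innerComplex F‖ ≤ 1 := by
  refine ContinuousLinearMap.opNorm_le_bound _ zero_le_one fun y => ?_
  rw [one_mul]
  exact norm_innerComplex_apply_le y

/-- The function `e^{σ|y|²/2}`. -/
def gaussExp (σ : ℝ) (y : F) : ℂ := Complex.exp ((σ / 2 * ‖y‖ ^ 2 : ℝ) : ℂ)

lemma gaussExp_contDiff (σ : ℝ) : ContDiff ℝ (⊤ : ℕ∞) (gaussExp σ : F → ℂ) :=
  (Complex.ofRealCLM.contDiff.comp (contDiff_const.mul (contDiff_norm_sq ℝ))).cexp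

omit [InnerProductSpace ℝ F] in
lemma norm_gaussExp (σ : ℝ) (y : F) : ‖gaussExp σ y‖ = Real.exp (σ / 2 * ‖y‖ ^ 2) := by
  rw [gaussExp, Complex.norm_exp, Complex.ofReal_re]

lemma norm_iteratedFDeriv_gaussExp_le {σ : ℝ} (hσ : |σ| = 1) (n : ℕ) (y : F) :
    ‖iteratedFDeriv ℝ n (gaussExp σ) y‖ ≤
      Real.exp (σ / 2 * ‖y‖ ^ 2) * (‖y‖ + Real.sqrt n) ^ n := by
  have hQ : ∀ z : F, HasFDerivAt (fun z : F => ((σ / 2 * ‖z‖ ^ 2 : ℝ) : ℂ))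
      ((σ • innerComplex F) z) z := by
    intro z
    have h1 := ((hasStrictFDerivAt_norm_sq z).hasFDerivAt.const_mul (σ / 2))
    have h2 := Complex.ofRealCLM.hasFDerivAt.comp z h1
    refine h2.congr_fderiv (ContinuousLinearMap.ext fun z' => ?_)
    simp [innerComplex_apply]
    ring
  have hS : ∀ T : F →L[ℝ] ℂ, ‖σ • T‖ = ‖T‖ := fun T => by
    rw [norm_smul, Real.norm_eq_abs, hσ, one_mul]
  refine (norm_iteratedFDeriv_cexp_quadratic_le _ (σ • innerComplex F) hQ n y).trans ?_
  rw [show ‖Complex.exp ((σ / 2 * ‖y‖ ^ 2 : ℝ) : ℂ)‖ = Real.exp (σ / 2 * ‖y‖ ^ 2) from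
    norm_gaussExp σ y]
  gcongr
  · rw [smul_apply, hS]
    exact norm_innerComplex_apply_le y
  · rw [norm_smul, Real.norm_eq_abs, hσ, one_mul]
    exact mul_le_of_le_one_right (Nat.cast_nonneg n) norm_innerComplex_le

variable {ω : ℝ → ℝ} (hω : IsWeight ω)
include hω

/-- With ω(t) ≤ Bt, completing the square gives lBt ≤ t²/2 + (lB)²/2. -/
lemma IsWeight.exists_gauss_le (l : ℝ) (hl : 0 < l) :
    ∃ C : ℝ, 0 < C ∧ ∀ t, 0 ≤ t → Real.exp (-1 / 2 * t ^ 2) ≤ C * Real.exp (-(l * ω t)) := by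
  obtain ⟨B, hB, h⟩ := hω.exists_le_linear
  refine ⟨Real.exp ((l * B) ^ 2 / 2), Real.exp_pos _, fun t ht => ?_⟩
  rw [← Real.exp_add]
  refine Real.exp_le_exp.2 ?_
  nlinarith [mul_le_mul_of_nonneg_left (h t ht) hl.le, sq_nonneg (l * B - t)]

/-- The Gaussian decays faster than e^{-2lω}; one half absorbs the factor (|y|+√n)^n from its
derivatives, the other half remains as weight. -/
lemma IsWeight.exists_derivBound_gaussExp {l : ℝ} (hl : 0 < l) :
    ∃ C : ℝ, 0 < C ∧
      DerivBound ω 6 l C (fun y : F => Real.exp (-(l * ω ‖y‖))) (gaussExp (-1)) := by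
  obtain ⟨C₁, hC₁, h₁⟩ := hω.exists_gauss_le (2 * l) (by positivity)
  obtain ⟨C₂, hC₂, h₂⟩ := hω.exists_add_sqrt_pow_mul_exp_le hl
  refine ⟨C₁ * C₂, by positivity, fun n y => ?_⟩
  refine (norm_iteratedFDeriv_gaussExp_le (by simp) n y).trans ?_
  have h3 := h₁ ‖y‖ (norm_nonneg y)
  have h4 := h₂ n ‖y‖ (norm_nonneg y)
  calc _ ≤ C₁ * Real.exp (-(2 * l * ω ‖y‖)) * (‖y‖ + Real.sqrt n) ^ n := by gcongr
    _ = C₁ * ((‖y‖ + Real.sqrt n) ^ n * Real.exp (-(l * ω ‖y‖))) * Real.exp (-(l * ω ‖y‖)) := by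
      rw [show -(2 * l * ω ‖y‖) = -(l * ω ‖y‖) + -(l * ω ‖y‖) by ring, Real.exp_add]; ring
    _ ≤ C₁ * (C₂ * 6 ^ n * youngExp ω l n) * Real.exp (-(l * ω ‖y‖)) := by gcongr
    _ = _ := by ring

/-- Weights of sums of vectors. -/
lemma IsWeight.exists_weight_le_add (F : Type*) [NormedAddCommGroup F] :
    ∃ K : ℝ, 1 ≤ K ∧ ∀ x y : F, ω ‖x‖ ≤ K * (ω ‖y + x‖ + ω ‖y‖ + 1) := by
  obtain ⟨L, hL, h⟩ := hω.doubling
  refine ⟨L, hL, fun x y => ?_⟩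
  have h1 : ‖x‖ ≤ ‖y + x‖ + ‖y‖ := by
    calc ‖x‖ = ‖(y + x) - y‖ := by rw [add_sub_cancel_left]
      _ ≤ _ := norm_sub_le _ _
  have ha := hω.weight_norm_nonneg (y + x)
  have hb := hω.weight_norm_nonneg y
  have key : ∀ t : ℝ, 0 ≤ t → ‖x‖ ≤ 2 * t → ω ‖x‖ ≤ L * (ω t + 1) := fun t ht hxt =>
    (hω.monotoneOn (norm_nonneg x) (show (0 : ℝ) ≤ 2 * t by positivity) hxt).trans (h t ht)
  rcases le_total ‖y + x‖ ‖y‖ with h2 | h2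
  · exact (key ‖y‖ (norm_nonneg _) (by linarith)).trans (by gcongr; linarith)
  · exact (key ‖y + x‖ (norm_nonneg _) (by linarith)).trans (by gcongr; linarith)

variable [FiniteDimensional ℝ F] [MeasurableSpace F] [BorelSpace F]

open scoped FourierTransform in
/-- Decay of the Fourier transform gives uniform ultradifferentiable estimates. -/
lemma IsWeight.norm_iteratedFDeriv_le_of_fourier_decay {l S : ℝ} (hl : 0 < l) (hS : 0 ≤ S) {u : F → ℂ}
    (hu : Integrable u) (huc : Continuous u)
    (hdec : ∀ v, ‖∫ y, Complex.exp (Complex.I * ((⟪y, v⟫ : ℝ) : ℂ)) * u y‖ ≤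
      S * Real.exp (-((l + 1) * ω ‖v‖))) (K : ℕ) (x : F) :
    ‖iteratedFDeriv ℝ K u x‖ ≤ S * (∫ y : F, Real.exp (-(ω ‖y‖))) * youngExp ω l K := by
  have hint := hω.exists_integrable_exp F volume 1 le_rfl
  simp only [one_mul] at hint
  -- The rescaled frequency 2π|w| can be kept inside ω. Of the decay l+1, the part l controls |w|^n
  -- and the part 1 gives integrability.
  have h1 : ∀ w, ‖𝓕 u w‖ ≤ S * Real.exp (-((l + 1) * ω (2 * Real.pi * ‖w‖))) := by
    intro w
    have h2 := hdec (-(2 * Real.pi) • w)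
    have h3 := fourier_eq_integral_cexp u (-(2 * Real.pi) • w)
    simp only [smul_eq_mul] at h3
    rw [h3, smul_smul] at h2
    have h4 : -(2 * Real.pi)⁻¹ * -(2 * Real.pi) = 1 := by
      have := Real.pi_ne_zero
      field_simp
    rw [h4, one_smul, norm_smul, norm_neg, Real.norm_of_nonneg (by positivity)] at h2
    exact h2
  have hcont : Continuous (𝓕 u) :=
    VectorFourier.fourierIntegral_continuous Real.continuous_fourierChar
      (by exact (innerSL ℝ (E := F)).continuous₂) hu
  have h2pi : 1 ≤ 2 * Real.pi := by linarith [Real.pi_gt_three]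
  have h5 : ∀ (n : ℕ) w, (2 * Real.pi) ^ n * ‖w‖ ^ n * ‖𝓕 u w‖ ≤
      S * youngExp ω l n * Real.exp (-(ω ‖w‖)) := by
    intro n w
    have h6 := hω.pow_mul_exp_le hl n (t := 2 * Real.pi * ‖w‖) (by positivity)
    have h7 : ω ‖w‖ ≤ ω (2 * Real.pi * ‖w‖) :=
      hω.monotoneOn (norm_nonneg w) (show 0 ≤ 2 * Real.pi * ‖w‖ by positivity)
        (le_mul_of_one_le_left (norm_nonneg w) h2pi)
    calc _ ≤ (2 * Real.pi) ^ n * ‖w‖ ^ n *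
          (S * Real.exp (-((l + 1) * ω (2 * Real.pi * ‖w‖)))) := by gcongr; exact h1 w
      _ = S * ((2 * Real.pi * ‖w‖) ^ n * Real.exp (-(l * ω (2 * Real.pi * ‖w‖)))) *
          Real.exp (-(ω (2 * Real.pi * ‖w‖))) := by
        rw [show -((l + 1) * ω (2 * Real.pi * ‖w‖)) = -(l * ω (2 * Real.pi * ‖w‖)) +
          -(ω (2 * Real.pi * ‖w‖)) by ring, Real.exp_add, mul_pow]
        ring
      _ ≤ S * youngExp ω l n * Real.exp (-(ω ‖w‖)) := by
        gcongr
        exact mul_nonneg hS (youngExp_pos _ _ _).le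
  have h8 : ∀ n : ℕ, Integrable fun w => ‖w‖ ^ n * ‖𝓕 u w‖ := by
    intro n
    refine (hint.const_mul (S * youngExp ω l n)).mono'
      ((continuous_norm.pow n).mul hcont.norm).aestronglyMeasurable
      (Eventually.of_forall fun w => ?_)
    rw [Real.norm_of_nonneg (by positivity)]
    refine le_trans ?_ (h5 n w)
    rw [mul_assoc]
    exact le_mul_of_one_le_left (by positivity) (one_le_pow₀ h2pi)
  have hFi : Integrable (𝓕 u) := by
    have := h8 0
    simp only [pow_zero, one_mul] at this
    exact (integrable_norm_iff hcont.aestronglyMeasurable).1 this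
  have hinv : u = (𝓕 (𝓕 u)) ∘ (LinearIsometryEquiv.neg ℝ : F ≃ₗᵢ[ℝ] F) := by
    have h9 := huc.fourierInv_fourier_eq hu hFi
    funext x
    rw [← congrFun h9 x, Real.fourierInv_eq_fourier_neg]
    rfl
  conv_lhs => rw [hinv]
  rw [LinearIsometryEquiv.norm_iteratedFDeriv_comp_right,
    Real.iteratedFDeriv_fourier (N := (⊤ : ℕ∞)) (fun n _ => h8 n) hcont.aestronglyMeasurable le_top]
  refine (VectorFourier.norm_fourierIntegral_le_integral_norm _ _ _ _ _).trans ?_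
  have h10 : ∀ w, ‖VectorFourier.fourierPowSMulRight (innerSL ℝ) (𝓕 u) w K‖ ≤
      S * youngExp ω l K * Real.exp (-(ω ‖w‖)) := by
    intro w
    refine (VectorFourier.norm_fourierPowSMulRight_le (innerSL ℝ) (𝓕 u) w K).trans ?_
    refine le_trans ?_ (h5 K w)
    have h11 : 2 * Real.pi * ‖(innerSL ℝ : F →L[ℝ] F →L[ℝ] ℝ)‖ ≤ 2 * Real.pi :=
      mul_le_of_le_one_right (by positivity) (norm_innerSL_le ℝ)
    exact mul_le_mul_of_nonneg_right (mul_le_mul_of_nonneg_right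
      (pow_le_pow_left₀ (by positivity) h11 K) (by positivity)) (norm_nonneg _)
  refine (integral_mono_of_nonneg (Eventually.of_forall fun _ => norm_nonneg _)
    (hint.const_mul _) (Eventually.of_forall h10)).trans (le_of_eq ?_)
  rw [integral_const_mul]
  ring

/-- Decay of a function and of its Fourier transform give decay of all derivatives, with
ultradifferentiable estimates. -/
theorem IsWeight.exists_derivBound_of_decay (F : Type*) [NormedAddCommGroup F]
    [InnerProductSpace ℝ F] [FiniteDimensional ℝ F] [MeasurableSpace F] [BorelSpace F]
    {l : ℝ} (hl : 0 < l) :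
    ∃ l' : ℝ, 0 < l' ∧ ∃ C : ℝ, 0 < C ∧ ∀ (S : ℝ) (f : F → ℂ), 0 ≤ S → Integrable f →
      ContDiff ℝ (⊤ : ℕ∞) f → (∀ x, ‖f x‖ ≤ S * Real.exp (-(l' * ω ‖x‖))) →
      (∀ v, ‖∫ y, Complex.exp (Complex.I * ((⟪y, v⟫ : ℝ) : ℂ)) * f y‖ ≤
        S * Real.exp (-(l' * ω ‖v‖))) →
      DerivBound ω 1 l (C * S) (fun x => Real.exp (-(l * ω ‖x‖))) f := by
  have hint := hω.exists_integrable_exp F volume 1 le_rfl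
  simp only [one_mul] at hint
  set I₀ := ∫ y : F, Real.exp (-(ω ‖y‖)) with hI₀
  have hI₀0 : 0 ≤ I₀ := integral_nonneg fun y => (Real.exp_pos _).le
  obtain ⟨l₂, hl₂, C₁, hC₁, habs⟩ := hω.exists_derivBound_one (E := F) (G := ℂ) 7 (by norm_num) hl
  have hl₂0 : 0 < l₂ := by linarith
  set ν := l₂ + 1 with hν
  have hν0 : 0 < ν := by linarith
  obtain ⟨l₃, hl₃, C₂, hC₂, hosc⟩ := hω.exists_derivBound_oscInt (ContinuousLinearMap.id ℝ F)
    (c := 7) (l := 2 * ν) (by norm_num) (by positivity)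
  have hl₃0 : 0 < l₃ := by linarith
  obtain ⟨K, hK, hadd⟩ := hω.exists_weight_le_add F
  obtain ⟨C₃, hC₃, hgauss⟩ := hω.exists_gauss_le (2 * ν * K + 1) (by positivity)
  obtain ⟨C₄, hC₄, hψ⟩ := hω.exists_derivBound_gaussExp (F := F) hl₃0
  obtain ⟨C₅, hC₅, hpow⟩ := hω.exists_add_sqrt_pow_mul_exp_le hl₂0
  set B₁ := C₂ * (I₀ * C₄) with hB₁
  set B₂ := C₃ * Real.exp (2 * ν * K) * I₀ with hB₂
  have hB₁0 : 0 ≤ B₁ := by positivity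
  have hB₂0 : 0 ≤ B₂ := by positivity
  -- Decay l₃+1 of the Fourier transform yields unweighted bounds on the derivatives of f at
  -- parameter l₃; decay 2νK of f leaves 2ν after the translation y + x.
  refine ⟨max (l₃ + 1) (2 * ν * K), by positivity, C₁ * ((B₁ + B₂) * I₀ * C₅) + 1, by positivity,
    fun S f hS hfi hfs hdec hfdec => ?_⟩
  have hexp : ∀ (a : ℝ) (v : F), a ≤ max (l₃ + 1) (2 * ν * K) →
      S * Real.exp (-(max (l₃ + 1) (2 * ν * K) * ω ‖v‖)) ≤ S * Real.exp (-(a * ω ‖v‖)) := by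
    intro a v ha
    have := hω.weight_norm_nonneg v
    gcongr
  have hfb : DerivBound ω 1 l₃ (S * I₀) (fun _ => 1) f := fun k x => by
    have := hω.norm_iteratedFDeriv_le_of_fourier_decay hl₃0 hS hfi hfs.continuous
      (fun v => (hfdec v).trans (hexp _ v (le_max_left _ _))) k x
    simpa using this
  -- the localizations `u x`
  set u : F → F → ℂ := fun x y => f (y + x) * gaussExp (-1) y with hu
  have hfx : ∀ x, ContDiff ℝ (⊤ : ℕ∞) fun y => f (y + x) := fun x => hfs.comp (by fun_prop)
  have hus : ∀ x, ContDiff ℝ (⊤ : ℕ∞) (u x) := fun x => (hfx x).mul (gaussExp_contDiff _)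
  have hub : ∀ x, DerivBound ω 7 l₃ (S * I₀ * C₄) (fun y => Real.exp (-(l₃ * ω ‖y‖))) (u x) := by
    intro x
    have := DerivBound.mul hω hl₃0 zero_le_one (by norm_num) (mul_nonneg hS hI₀0) hC₄.le
      (fun _ => zero_le_one) (fun _ => (Real.exp_pos _).le) (hfx x) (gaussExp_contDiff _)
      (hfb.comp_add_right x) hψ
    norm_num at this
    exact this
  -- Frequency decay, uniform in x: the window supplies decay in y and f the regularity. The main
  -- estimate is used at order 0 with an integrand independent of the parameter.
  have hosc1 : ∀ x v, ‖∫ y, Complex.exp (Complex.I * ((⟪y, v⟫ : ℝ) : ℂ)) * u x y‖ ≤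
      S * B₁ * Real.exp (-(2 * ν * ω ‖v‖)) := by
    intro x v
    have hb := (hub x).comp_clm (hus x) (ContinuousLinearMap.snd ℝ F F)
    have hb' : DerivBound ω 7 l₃ (S * I₀ * C₄)
        (fun z : F × F => (1 : ℝ) * Real.exp (-(l₃ * ω ‖z.2‖))) (fun z => u x z.2) := by
      refine DerivBound.mono hω (by positivity) ?_ hl₃0 le_rfl (by positivity) le_rfl
        (fun _ => (Real.exp_pos _).le) (fun _ => by simp) hb
      exact mul_le_of_le_one_right (by norm_num) (ContinuousLinearMap.norm_snd_le ℝ F F)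
    have h1 := (hosc (S * I₀ * C₄) (fun _ => 1) (fun z => u x z.2) (by positivity)
      continuous_const (fun _ => zero_le_one) ((hus x).comp contDiff_snd) hb').2 0 v
    rw [norm_iteratedFDeriv_zero, hω.youngExp_zero (by positivity)] at h1
    simp only [oscInt, ContinuousLinearMap.id_apply, pow_zero, mul_one, one_mul] at h1
    refine h1.trans (le_of_eq ?_)
    rw [hB₁]; ring
  have huxn : ∀ x y, ‖u x y‖ ≤
      S * (C₃ * Real.exp (2 * ν * K) * Real.exp (-(2 * ν * ω ‖x‖))) * Real.exp (-(ω ‖y‖)) := by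
    intro x y
    rw [hu, norm_mul, norm_gaussExp]
    have h1 := (hdec (y + x)).trans (hexp (2 * ν * K) (y + x) (le_max_right _ _))
    have h2 := hgauss ‖y‖ (norm_nonneg y)
    have h3 := hadd x y
    calc _ ≤ S * Real.exp (-(2 * ν * K * ω ‖y + x‖)) *
          (C₃ * Real.exp (-((2 * ν * K + 1) * ω ‖y‖))) := by gcongr
      _ = S * C₃ * Real.exp (-(2 * ν * K * ω ‖y + x‖) + -((2 * ν * K + 1) * ω ‖y‖)) := by
        rw [Real.exp_add]; ring
      _ ≤ S * C₃ * Real.exp (2 * ν * K + -(2 * ν * ω ‖x‖) + -(ω ‖y‖)) := by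
        refine mul_le_mul_of_nonneg_left (Real.exp_le_exp.2 ?_) (by positivity)
        nlinarith [mul_le_mul_of_nonneg_left h3 (show 0 ≤ 2 * ν by positivity)]
      _ = _ := by rw [Real.exp_add, Real.exp_add]; ring
  have hui : ∀ x, Integrable (u x) := fun x =>
    (hint.const_mul _).mono' (hus x).continuous.aestronglyMeasurable
      (Eventually.of_forall (huxn x))
  -- Decay in x, uniform in the frequency, from the size of the localized function alone.
  have hosc2 : ∀ x v, ‖∫ y, Complex.exp (Complex.I * ((⟪y, v⟫ : ℝ) : ℂ)) * u x y‖ ≤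
      S * B₂ * Real.exp (-(2 * ν * ω ‖x‖)) := by
    intro x v
    refine (norm_integral_le_of_norm_le (hint.const_mul
      (S * (C₃ * Real.exp (2 * ν * K) * Real.exp (-(2 * ν * ω ‖x‖)))))
      (Eventually.of_forall fun y => ?_)).trans (le_of_eq ?_)
    · rw [norm_mul, Complex.norm_exp]
      simpa using huxn x y
    · rw [integral_const_mul, hB₂, hI₀]; ring
  -- Both bounds hold with exponent 2ν, and 2 max(ω(x), ω(v)) ≥ ω(x) + ω(v); so decay holds in both
  -- variables with exponent ν = l₂+1.
  have hosc3 : ∀ x v, ‖∫ y, Complex.exp (Complex.I * ((⟪y, v⟫ : ℝ) : ℂ)) * u x y‖ ≤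
      S * (B₁ + B₂) * Real.exp (-(ν * ω ‖x‖)) * Real.exp (-((l₂ + 1) * ω ‖v‖)) := by
    intro x v
    rw [mul_assoc, ← Real.exp_add]
    rcases le_total (ω ‖x‖) (ω ‖v‖) with h | h
    · refine (hosc1 x v).trans ?_
      have : S * B₁ ≤ S * (B₁ + B₂) := by gcongr; linarith
      gcongr
      nlinarith
    · refine (hosc2 x v).trans ?_
      have : S * B₂ ≤ S * (B₁ + B₂) := by gcongr; linarith
      gcongr
      nlinarith
  -- Fourier inversion bounds the derivatives of the localization at y = 0; multiplying by
  -- e^{|y|²/2} removes the window, and 7 = 1 + 6 by Leibniz.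
  have hfin : DerivBound ω 7 l₂ (S * (B₁ + B₂) * I₀ * C₅)
      (fun x => Real.exp (-(ν * ω ‖x‖))) f := by
    intro k x
    have h1 : (fun y => f (y + x)) = fun y => u x y * gaussExp 1 y := by
      funext y
      rw [hu, mul_assoc, gaussExp, gaussExp, ← Complex.exp_add, ← Complex.ofReal_add,
        show -1 / 2 * ‖y‖ ^ 2 + 1 / 2 * ‖y‖ ^ 2 = 0 by ring]
      simp
    have h2 : iteratedFDeriv ℝ k f x = iteratedFDeriv ℝ k (fun y => f (y + x)) 0 := by
      rw [iteratedFDeriv_comp_add_right, zero_add]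
    rw [h2, h1]
    refine (norm_iteratedFDeriv_mul_le (hus x) (gaussExp_contDiff 1) 0 (n := k)
      (mod_cast le_top)).trans ?_
    have h3 := hω.sum_choose_mul_le hl₂0 zero_le_one (show (0 : ℝ) ≤ 6 by norm_num)
      (show 0 ≤ S * (B₁ + B₂) * Real.exp (-(ν * ω ‖x‖)) * I₀ by positivity) hC₅.le
      (fun i => ‖iteratedFDeriv ℝ i (u x) 0‖)
      (fun i => ‖iteratedFDeriv ℝ i (gaussExp 1 : F → ℂ) 0‖) (fun _ => norm_nonneg _)
      (fun i => by
        have := hω.norm_iteratedFDeriv_le_of_fourier_decay hl₂0 (by positivity) (hui x)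
          (hus x).continuous (hosc3 x) i 0
        simpa using this)
      (fun i => by
        have h4 := hpow i 0 le_rfl
        have h5 := norm_iteratedFDeriv_gaussExp_le (F := F) (σ := 1) (by simp) i 0
        rw [hω.normalized 0 le_rfl zero_le_one] at h4
        simp only [norm_zero] at h5
        norm_num at h4 h5
        exact h5.trans h4) k
    refine h3.trans (le_of_eq ?_)
    norm_num
    ring
  have h1 := habs l₂ le_rfl _ _ _ (by positivity) (fun _ => (Real.exp_pos _).le) hfin
  refine DerivBound.mono hω zero_le_one le_rfl hl le_rfl (by positivity) ?_
    (fun _ => (Real.exp_pos _).le) (fun x => ?_) h1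
  · nlinarith
  · have := hω.weight_norm_nonneg x
    gcongr
    linarith

end GaussianWindow

/-! ### Iterated directional derivatives and total derivatives -/

section Directional

variable {E E' : Type*} [NormedAddCommGroup E] [NormedSpace ℝ E] [NormedAddCommGroup E']
  [NormedSpace ℝ E']

/-- The iterated directional derivative along a list of vectors. -/
def dirDeriv (l : List E) (g : E → ℂ) : E → ℂ :=
  l.foldr (fun v h x => fderiv ℝ h x v) g

lemma dirDeriv_cons (v : E) (l : List E) (g : E → ℂ) :
    dirDeriv (v :: l) g = fun x => fderiv ℝ (dirDeriv l g) x v := rfl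

lemma dirDeriv_append (l l' : List E) (g : E → ℂ) :
    dirDeriv (l ++ l') g = dirDeriv l (dirDeriv l' g) := List.foldr_append

lemma dirDeriv_contDiff (l : List E) {g : E → ℂ} (hg : ContDiff ℝ (⊤ : ℕ∞) g) :
    ContDiff ℝ (⊤ : ℕ∞) (dirDeriv l g) := by
  induction l with
  | nil => exact hg
  | cons v l ih =>
    rw [dirDeriv_cons]
    exact (ih.fderiv_right (m := (⊤ : ℕ∞)) (by simp)).clm_apply contDiff_const

lemma dirDeriv_eq_iteratedFDeriv (l : List E) {g : E → ℂ} (hg : ContDiff ℝ (⊤ : ℕ∞) g) (x : E) :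
    dirDeriv l g x = iteratedFDeriv ℝ l.length g x l.get := by
  induction l generalizing x with
  | nil => simp [dirDeriv]
  | cons v l ih =>
    rw [dirDeriv_cons, show dirDeriv l g = fun x => iteratedFDeriv ℝ l.length g x l.get from
      funext ih]
    have h := (hg.differentiable_iteratedFDeriv (m := l.length)
      (by exact_mod_cast ENat.natCast_lt_top _) x)
    exact (h.iteratedFDeriv_succ_apply_left' (m := (v :: l).get)).symm

/-- A permutation is generated by adjacent swaps, and a swap is the symmetry of the second
derivative. -/
lemma dirDeriv_perm {l l' : List E} (h : l.Perm l') {g : E → ℂ} (hg : ContDiff ℝ (⊤ : ℕ∞) g) :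
    dirDeriv l g = dirDeriv l' g := by
  induction h with
  | nil => rfl
  | cons v _ ih => rw [dirDeriv_cons, dirDeriv_cons, ih]
  | swap v w l =>
    have hs := dirDeriv_contDiff l hg
    have hd : Differentiable ℝ (fderiv ℝ (dirDeriv l g)) :=
      (hs.fderiv_right (m := (⊤ : ℕ∞)) (by simp)).differentiable (by simp)
    have key : ∀ (a b : E) x, fderiv ℝ (fun x => fderiv ℝ (dirDeriv l g) x a) x b =
        fderiv ℝ (fderiv ℝ (dirDeriv l g)) x b a := by
      intro a b x
      rw [fderiv_clm_apply (hd x) (differentiableAt_const a)]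
      simp
    funext x
    simp only [dirDeriv_cons]
    rw [key, key]
    exact (hs.contDiffAt.isSymmSndFDerivAt (by
      rw [minSmoothness_of_isRCLikeNormedField]; exact WithTop.coe_le_coe.2 (le_top : (2 : ℕ∞) ≤ ⊤))) _ _
  | trans _ _ ih₁ ih₂ => exact ih₁.trans ih₂

lemma dirDeriv_comp_affine (T : E' →L[ℝ] E) (a : E) (l : List E') {g : E → ℂ}
    (hg : ContDiff ℝ (⊤ : ℕ∞) g) :
    dirDeriv l (fun q => g (T q + a)) = fun q => dirDeriv (l.map T) g (T q + a) := by
  induction l with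
  | nil => rfl
  | cons v l ih =>
    rw [dirDeriv_cons, ih]
    funext q
    rw [List.map_cons, dirDeriv_cons]
    have hd : DifferentiableAt ℝ (dirDeriv (l.map T) g) (T q + a) :=
      (dirDeriv_contDiff _ hg).differentiable (by simp) _
    have h1 := hd.hasFDerivAt.comp q (T.hasFDerivAt.add_const a)
    rw [show (fun q => dirDeriv (l.map T) g (T q + a)) =
      dirDeriv (l.map T) g ∘ fun q => T q + a from rfl, h1.fderiv]
    rfl

lemma norm_dirDeriv_le {l : List E} (hl : ∀ v ∈ l, ‖v‖ ≤ 1) {g : E → ℂ}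
    (hg : ContDiff ℝ (⊤ : ℕ∞) g) (x : E) :
    ‖dirDeriv l g x‖ ≤ ‖iteratedFDeriv ℝ l.length g x‖ := by
  rw [dirDeriv_eq_iteratedFDeriv l hg]
  refine ((iteratedFDeriv ℝ l.length g x).le_opNorm _).trans ?_
  refine mul_le_of_le_one_right (norm_nonneg _) ?_
  exact Finset.prod_le_one (fun _ _ => norm_nonneg _) fun i _ => hl _ (List.get_mem l i)

/-- The total derivative is controlled by the derivatives along a spanning family. -/
lemma norm_iteratedFDeriv_le_of_dirDeriv {ι : Type*} [Fintype ι] (e : ι → E) (c : ι → E → ℝ)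
    (hc : ∀ i v, |c i v| ≤ ‖v‖) (he : ∀ v, v = ∑ i, c i v • e i) {g : E → ℂ}
    (hg : ContDiff ℝ (⊤ : ℕ∞) g) (x : E) (K : ℕ) {B : ℝ} (hB : 0 ≤ B)
    (h : ∀ l : List ι, l.length = K → ‖dirDeriv (l.map e) g x‖ ≤ B) :
    ‖iteratedFDeriv ℝ K g x‖ ≤ (Fintype.card ι : ℝ) ^ K * B := by
  classical
  refine ContinuousMultilinearMap.opNorm_le_bound (by positivity) fun m => ?_
  have h1 : m = fun k => ∑ i, c i (m k) • e i := funext fun k => he (m k)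
  have h2 : ∀ r : Fin K → ι, ‖iteratedFDeriv ℝ K g x (fun k => e (r k))‖ ≤ B := by
    intro r
    have hl : (List.ofFn r).length = K := List.length_ofFn
    have h3 := h (List.ofFn r) hl
    rw [dirDeriv_eq_iteratedFDeriv _ hg] at h3
    have h4 : ((List.ofFn r).map e) = List.ofFn (fun k => e (r k)) := by
      rw [List.map_ofFn]; rfl
    -- The list is made a variable so that its length can be substituted for K in the dependent type
    -- of the derivative.
    have key : ∀ (s : List E) (hs : s = List.ofFn (fun k => e (r k))),
        ‖iteratedFDeriv ℝ s.length g x s.get‖ = ‖iteratedFDeriv ℝ K g x (fun k => e (r k))‖ := by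
      intro s hs
      have hsl : s.length = K := by rw [hs, List.length_ofFn]
      obtain ⟨r', hr'⟩ : ∃ r' : Fin K → E, r' = fun k => e (r k) := ⟨_, rfl⟩
      rw [← hr'] at hs ⊢
      clear hr' h4 h3 hl h1
      subst hsl
      congr 2
      funext k
      have := congrArg (fun t : List E => t[(k : ℕ)]?) hs
      simp only [List.getElem?_ofFn, k.2, List.getElem?_eq_getElem] at this
      simpa using this
    rwa [key _ h4] at h3
  conv_lhs => rw [h1]
  rw [ContinuousMultilinearMap.map_sum]
  refine (norm_sum_le _ _).trans ?_
  have h3 : ∀ r : Fin K → ι, ‖iteratedFDeriv ℝ K g x (fun k => c (r k) (m k) • e (r k))‖ ≤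
      B * ∏ k, ‖m k‖ := by
    intro r
    rw [ContinuousMultilinearMap.map_smul_univ, norm_smul, mul_comm, norm_prod]
    gcongr
    · exact h2 r
    · exact hc _ _
  refine (Finset.sum_le_sum fun r _ => h3 r).trans (le_of_eq ?_)
  rw [Finset.sum_const, Finset.card_univ, Fintype.card_fun, Fintype.card_fin, nsmul_eq_mul]
  push_cast
  ring

end Directional

/-! ### Multi-index derivatives as directional derivatives -/

section MultiIndex

variable {d : ℕ}

/-- The list of indices in which `j` is repeated `α j` times. -/
def indexList (α : Fin d → ℕ) : List (Fin d) :=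
  (List.finRange d).flatMap fun j => List.replicate (α j) j

lemma length_indexList (α : Fin d → ℕ) : (indexList α).length = ∑ j, α j := by
  rw [indexList, List.length_flatMap, Fin.sum_univ_def]
  simp

lemma count_indexList (α : Fin d → ℕ) (j : Fin d) : (indexList α).count j = α j := by
  rw [indexList, List.count_flatMap]
  have h : (List.map (List.count j ∘ fun i => List.replicate (α i) i) (List.finRange d)).sum =
      ∑ i, if i = j then α i else 0 := by
    rw [Fin.sum_univ_def]
    congr 1
    refine List.map_congr_left fun i _ => ?_
    simp [List.count_replicate]
  rw [h]
  simp

lemma partialD_iter_eq_dirDeriv (j : Fin d) (k : ℕ) {u : Eucl d → ℂ}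
    (hu : ContDiff ℝ (⊤ : ℕ∞) u) :
    (partialD j)^[k] u =
      (-Complex.I) ^ k • dirDeriv (List.replicate k (EuclideanSpace.single j 1)) u := by
  induction k with
  | zero => simp [dirDeriv]
  | succ k ih =>
    rw [Function.iterate_succ_apply', ih, partialD_smul j _ (dirDeriv_contDiff _ hu)]
    funext x
    simp only [Pi.smul_apply, List.replicate_succ, dirDeriv_cons, partialD, smul_eq_mul]
    ring

/-- Each D_j contributes a factor -i of modulus one, so bounds pass freely between D^α and
directional derivatives along basis vectors. -/
lemma multiD_eq_dirDeriv (α : Fin d → ℕ) {u : Eucl d → ℂ} (hu : ContDiff ℝ (⊤ : ℕ∞) u) :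
    multiD α u = (-Complex.I) ^ (∑ j, α j) •
      dirDeriv ((indexList α).map fun j => EuclideanSpace.single j 1) u := by
  have key : ∀ r : List (Fin d), r.foldr (fun j v => (partialD j)^[α j] v) u =
      (-Complex.I) ^ ((r.map α).sum) • dirDeriv ((r.flatMap fun j =>
        List.replicate (α j) j).map fun j => (EuclideanSpace.single j 1 : Eucl d)) u := by
    intro r
    induction r with
    | nil => simp [dirDeriv]
    | cons j r ih =>
      rw [List.foldr_cons, ih, partialD_iter_smul _ _ _ (dirDeriv_contDiff _ hu),
        partialD_iter_eq_dirDeriv _ _ (dirDeriv_contDiff _ hu), smul_smul, List.flatMap_cons,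
        List.map_append, dirDeriv_append, List.map_replicate, List.map_cons, List.sum_cons,
        pow_add, mul_comm]
  rw [multiD, key, Fin.sum_univ_def]
  rfl

lemma norm_multiD_le (α : Fin d → ℕ) {u : Eucl d → ℂ} (hu : ContDiff ℝ (⊤ : ℕ∞) u) (x : Eucl d) :
    ‖multiD α u x‖ ≤ ‖iteratedFDeriv ℝ (∑ j, α j) u x‖ := by
  rw [multiD_eq_dirDeriv α hu, Pi.smul_apply, norm_smul, norm_pow, norm_neg, Complex.norm_I,
    one_pow, one_mul]
  refine (norm_dirDeriv_le (fun v hv => ?_) hu x).trans (le_of_eq ?_)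
  · obtain ⟨j, _, rfl⟩ := List.mem_map.1 hv
    simp
  · rw [List.length_map, length_indexList]

end MultiIndex

/-! ### Joint estimates for amplitudes -/

section Amplitude

variable {d : ℕ}

/-- The standard basis of `ℝ^{3d}`. -/
def basis₃ (d : ℕ) : Fin d ⊕ Fin d ⊕ Fin d → Eucl d × Eucl d × Eucl d :=
  Sum.elim (fun j => (EuclideanSpace.single j 1, 0, 0))
    (Sum.elim (fun j => (0, EuclideanSpace.single j 1, 0))
      (fun j => (0, 0, EuclideanSpace.single j 1)))

/-- The coordinates on `ℝ^{3d}`. -/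
def coord₃ (d : ℕ) : Fin d ⊕ Fin d ⊕ Fin d → Eucl d × Eucl d × Eucl d → ℝ :=
  Sum.elim (fun j v => v.1 j) (Sum.elim (fun j v => v.2.1 j) (fun j v => v.2.2 j))

lemma abs_coord₃_le (i : Fin d ⊕ Fin d ⊕ Fin d) (v : Eucl d × Eucl d × Eucl d) :
    |coord₃ d i v| ≤ ‖v‖ := by
  have h : ∀ (w : Eucl d) (j : Fin d), |w j| ≤ ‖w‖ := fun w j => PiLp.norm_apply_le w j
  rcases i with j | j | j
  · exact (h v.1 j).trans (norm_fst_le v)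
  · exact (h v.2.1 j).trans ((norm_fst_le v.2).trans (norm_snd_le v))
  · exact (h v.2.2 j).trans ((norm_snd_le v.2).trans (norm_snd_le v))

lemma eq_sum_single (w : Eucl d) : w = ∑ j, w j • (EuclideanSpace.single j (1 : ℝ) : Eucl d) := by
  ext k
  simp [Finset.sum_apply, Pi.single_apply]

lemma eq_sum_coord₃ (v : Eucl d × Eucl d × Eucl d) : v = ∑ i, coord₃ d i v • basis₃ d i := by
  rw [Fintype.sum_sum_type, Fintype.sum_sum_type]
  obtain ⟨x, y, ξ⟩ := v
  simp only [coord₃, basis₃, Sum.elim_inl, Sum.elim_inr, Prod.smul_mk, smul_zero]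
  refine Prod.ext ?_ (Prod.ext ?_ ?_)
  · simpa [Prod.fst_sum, Prod.snd_sum] using eq_sum_single x
  · simpa [Prod.fst_sum, Prod.snd_sum] using eq_sum_single y
  · simpa [Prod.fst_sum, Prod.snd_sum] using eq_sum_single ξ

lemma multiD_affine (α : Fin d → ℕ) {E : Type*} [NormedAddCommGroup E] [NormedSpace ℝ E]
    {g : E → ℂ} (hg : ContDiff ℝ (⊤ : ℕ∞) g) (T : Eucl d →L[ℝ] E) (a : E) (k : ℂ) :
    multiD α (fun q => k • g (T q + a)) = fun q => ((-Complex.I) ^ (∑ j, α j) * k) •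
      dirDeriv ((indexList α).map fun j => T (EuclideanSpace.single j 1)) g (T q + a) := by
  have hs : ContDiff ℝ (⊤ : ℕ∞) fun q => g (T q + a) := hg.comp (T.contDiff.add contDiff_const)
  have h1 : (fun q => k • g (T q + a)) = k • fun q => g (T q + a) := rfl
  rw [h1, multiD_smul α k hs, multiD_eq_dirDeriv α hs, dirDeriv_comp_affine T a _ hg]
  funext q
  rw [List.map_map, smul_smul, mul_comm]
  rfl

/-- The derivatives in the amplitude class are taken successively in separate variables; on the
product space they form one derivative along basis vectors. The constants -i from inner variables
are carried outwards. -/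
lemma norm_multiD_multiD_multiD {a : Eucl d → Eucl d → Eucl d → ℂ}
    (ha : ContDiff ℝ (⊤ : ℕ∞) (fun p : Eucl d × Eucl d × Eucl d => a p.1 p.2.1 p.2.2))
    (α β γ : Fin d → ℕ) (x y ξ : Eucl d) :
    ‖multiD α (fun x' => multiD β (fun y' => multiD γ (fun ξ' => a x' y' ξ') ξ) y) x‖ =
      ‖dirDeriv (((indexList α).map Sum.inl ++ ((indexList β).map (Sum.inr ∘ Sum.inl) ++
        (indexList γ).map (Sum.inr ∘ Sum.inr))).map (basis₃ d))
        (fun p : Eucl d × Eucl d × Eucl d => a p.1 p.2.1 p.2.2) (x, y, ξ)‖ := by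
  set G := fun p : Eucl d × Eucl d × Eucl d => a p.1 p.2.1 p.2.2 with hG
  let T₁ : Eucl d →L[ℝ] Eucl d × Eucl d × Eucl d := ContinuousLinearMap.inl ℝ _ _
  let T₂ : Eucl d →L[ℝ] Eucl d × Eucl d × Eucl d :=
    ContinuousLinearMap.inr ℝ _ _ ∘L ContinuousLinearMap.inl ℝ _ _
  let T₃ : Eucl d →L[ℝ] Eucl d × Eucl d × Eucl d :=
    ContinuousLinearMap.inr ℝ _ _ ∘L ContinuousLinearMap.inr ℝ _ _
  have e₁ : ∀ x y ξ : Eucl d, T₁ x + (0, y, ξ) = (x, y, ξ) := fun x y ξ => by simp [T₁]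
  have e₂ : ∀ x y ξ : Eucl d, T₂ y + (x, 0, ξ) = (x, y, ξ) := fun x y ξ => by simp [T₂]
  have e₃ : ∀ x y ξ : Eucl d, T₃ ξ + (x, y, 0) = (x, y, ξ) := fun x y ξ => by simp [T₃]
  set l₁ := (indexList α).map fun j => T₁ (EuclideanSpace.single j 1)
  set l₂ := (indexList β).map fun j => T₂ (EuclideanSpace.single j 1)
  set l₃ := (indexList γ).map fun j => T₃ (EuclideanSpace.single j 1)
  set k : (Fin d → ℕ) → ℂ := fun α => (-Complex.I) ^ (∑ j, α j)
  have hk : ∀ α, ‖k α‖ = 1 := fun α => by simp [k]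
  have h3 : ∀ x' y', multiD γ (fun ξ' => a x' y' ξ') ξ =
      k γ • dirDeriv l₃ G (x', y', ξ) := by
    intro x' y'
    have h := congrFun (multiD_affine γ ha T₃ (x', y', 0) 1) ξ
    simp only [e₃, one_smul, mul_one] at h
    exact h
  have hs3 := dirDeriv_contDiff l₃ ha
  have h2 : ∀ x', multiD β (fun y' => multiD γ (fun ξ' => a x' y' ξ') ξ) y =
      (k β * k γ) • dirDeriv l₂ (dirDeriv l₃ G) (x', y, ξ) := by
    intro x'
    simp only [h3]
    have h := congrFun (multiD_affine β hs3 T₂ (x', 0, ξ) (k γ)) y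
    simp only [e₂] at h
    exact h
  have hs2 := dirDeriv_contDiff l₂ hs3
  have h1 : multiD α (fun x' => multiD β (fun y' => multiD γ (fun ξ' => a x' y' ξ') ξ) y) x =
      (k α * (k β * k γ)) • dirDeriv l₁ (dirDeriv l₂ (dirDeriv l₃ G)) (x, y, ξ) := by
    simp only [h2]
    have h := congrFun (multiD_affine α hs2 T₁ (0, y, ξ) (k β * k γ)) x
    simp only [e₁] at h
    exact h
  rw [h1, norm_smul, norm_mul, norm_mul, hk, hk, hk, one_mul, one_mul, one_mul, ← dirDeriv_append,
    ← dirDeriv_append, List.append_assoc, List.map_append, List.map_append, List.map_map, List.map_map,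
    List.map_map]
  rfl

instance {α β : Type*} [BEq α] [LawfulBEq α] [BEq β] [LawfulBEq β] : LawfulBEq (α ⊕ β) where
  eq_of_beq {a b} h := by
    rcases a with a | a <;> rcases b with b | b
    · exact congrArg Sum.inl (eq_of_beq (show (a == b) = true from h))
    · exact absurd (show false = true from h) (by simp)
    · exact absurd (show false = true from h) (by simp)
    · exact congrArg Sum.inr (eq_of_beq (show (a == b) = true from h))
  rfl {a} := by
    rcases a with a | a
    · exact (beq_self_eq_true a : (a == a) = true)
    · exact (beq_self_eq_true a : (a == a) = true)

/-- Any word in the 3d basis directions can be sorted into x-, y- and ξ-letters with multi-indices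
as multiplicities. With symmetry of derivatives, the amplitude bounds therefore cover all
directional derivatives. -/
lemma perm_sorted (l : List (Fin d ⊕ Fin d ⊕ Fin d)) :
    l.Perm ((indexList fun j => l.count (Sum.inl j)).map Sum.inl ++
      ((indexList fun j => l.count (Sum.inr (Sum.inl j))).map (Sum.inr ∘ Sum.inl) ++
        (indexList fun j => l.count (Sum.inr (Sum.inr j))).map (Sum.inr ∘ Sum.inr))) := by
  have i1 : Function.Injective (Sum.inl : Fin d → Fin d ⊕ Fin d ⊕ Fin d) := Sum.inl_injective
  have i2 : Function.Injective (Sum.inr ∘ Sum.inl : Fin d → Fin d ⊕ Fin d ⊕ Fin d) :=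
    Sum.inr_injective.comp Sum.inl_injective
  have i3 : Function.Injective (Sum.inr ∘ Sum.inr : Fin d → Fin d ⊕ Fin d ⊕ Fin d) :=
    Sum.inr_injective.comp Sum.inr_injective
  have hz : ∀ (f : Fin d → Fin d ⊕ Fin d ⊕ Fin d) (s : List (Fin d)) b, (∀ j, f j ≠ b) →
      (s.map f).count b = 0 := by
    intro f s b h
    refine List.count_eq_zero.2 fun hb => ?_
    obtain ⟨j, _, hj⟩ := List.mem_map.1 hb
    exact h j hj
  rw [List.perm_iff_count]
  intro b
  rw [List.count_append, List.count_append]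
  rcases b with j | j | j
  · rw [List.count_map_of_injective _ _ i1, count_indexList, hz _ _ _ (by simp),
      hz _ _ _ (by simp)]
    rfl
  · have h := List.count_map_of_injective
      (indexList fun j => l.count (Sum.inr (Sum.inl j))) _ i2 j
    rw [Function.comp_apply, count_indexList] at h
    rw [h, hz _ _ _ (by simp), hz _ _ _ (by simp)]
    simp
  · have h := List.count_map_of_injective
      (indexList fun j => l.count (Sum.inr (Sum.inr j))) _ i3 j
    rw [Function.comp_apply, count_indexList] at h
    rw [h, hz _ _ _ (by simp), hz _ _ _ (by simp)]
    simp

/-- From |x-y|² ≤ 2|x|² + 2|y|². It reduces the quotient of brackets to a geometric factor. -/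
lemma bracket_sub_le (x y ξ : Eucl d) : bracket (x - y) ≤ 2 * bracket₃ x y ξ := by
  have h2 : (2 : ℝ) = Real.sqrt 4 := by
    rw [show (4 : ℝ) = 2 ^ 2 by norm_num, Real.sqrt_sq (by norm_num)]
  rw [bracket, bracket₃, h2, ← Real.sqrt_mul (by norm_num)]
  refine Real.sqrt_le_sqrt ?_
  have h := norm_sub_le x y
  have h0 := norm_nonneg (x - y)
  nlinarith [sq_nonneg (‖x‖ - ‖y‖), sq_nonneg ‖x‖, sq_nonneg ‖y‖, sq_nonneg ‖ξ‖]

/-- The joint ultradifferentiable estimates of an amplitude. -/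
theorem IsAmplitude.exists_derivBound {ω : ℝ → ℝ} (hω : IsWeight ω) {m ρ : ℝ} (hρ : 0 < ρ)
    (hρ1 : ρ ≤ 1) {a : Eucl d → Eucl d → Eucl d → ℂ} (ha : IsAmplitude ω m ρ a) {l : ℝ}
    (hl : 0 < l) :
    ∃ C : ℝ, 0 < C ∧ DerivBound ω (6 * d) l C
      (fun p : Eucl d × Eucl d × Eucl d =>
        Real.exp (|m| * (ω ‖p.1‖ + ω ‖p.2.1‖ + ω ‖p.2.2‖)))
      (fun p => a p.1 p.2.1 p.2.2) := by
  -- The class gives bounds for integer parameters only; an integer above l suffices, since the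
  -- sequences decrease in the parameter.
  obtain ⟨n, hn⟩ := exists_nat_gt l
  have hn0 : (0 : ℝ) < n := hl.trans hn
  obtain ⟨C, hC, hb⟩ := ha.bound n (by exact_mod_cast hn0)
  refine ⟨C, hC, fun K p => ?_⟩
  obtain ⟨x, y, ξ⟩ := p
  have hA := (youngExp_pos ω l K).le
  -- The constant 6d is 3d, from expanding vectors in the basis, times 2, from the quotient of
  -- brackets.
  have h := norm_iteratedFDeriv_le_of_dirDeriv (basis₃ d) (coord₃ d) abs_coord₃_le eq_sum_coord₃
    ha.smooth (x, y, ξ) K (B := C * 2 ^ K * youngExp ω l K *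
      Real.exp (|m| * (ω ‖x‖ + ω ‖y‖ + ω ‖ξ‖))) (by positivity) fun s hs => ?_
  · refine h.trans (le_of_eq ?_)
    simp only [Fintype.card_sum, Fintype.card_fin]
    push_cast
    rw [show (6 * d : ℝ) = (d + (d + d)) * 2 by ring, mul_pow]
    ring
  · have hp := perm_sorted s
    rw [dirDeriv_perm (hp.map (basis₃ d)) ha.smooth, ← norm_multiD_multiD_multiD ha.smooth]
    have hlen := hp.length_eq
    simp only [List.length_append, List.length_map, length_indexList, hs] at hlen
    refine (hb x y ξ _ _ _).trans ?_
    have hK : (∑ j, ((fun j => s.count (Sum.inl j)) + (fun j => s.count (Sum.inr (Sum.inl j))) +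
        (fun j => s.count (Sum.inr (Sum.inr j)))) j : ℕ) = K := by
      simp only [Pi.add_apply, Finset.sum_add_distrib]
      omega
    rw [hK]
    have hb3 : 0 < bracket₃ x y ξ := Real.sqrt_pos.2 (by positivity)
    have hb1 : 0 ≤ bracket (x - y) := Real.sqrt_nonneg _
    have h1 : bracket (x - y) ^ (ρ * (K : ℝ)) / bracket₃ x y ξ ^ (ρ * (K : ℝ)) ≤ 2 ^ K := by
      rw [← Real.div_rpow hb1 hb3.le]
      have h2 : bracket (x - y) / bracket₃ x y ξ ≤ 2 := by
        rw [div_le_iff₀ hb3]; exact bracket_sub_le x y ξ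
      calc _ ≤ (2 : ℝ) ^ (ρ * (K : ℝ)) :=
            Real.rpow_le_rpow (div_nonneg hb1 hb3.le) h2 (by positivity)
        _ ≤ (2 : ℝ) ^ (K : ℝ) := by
            refine Real.rpow_le_rpow_of_exponent_le (by norm_num) ?_
            exact mul_le_of_le_one_left (Nat.cast_nonneg K) hρ1
        _ = 2 ^ K := Real.rpow_natCast _ _
    -- Since φ* ≥ 0, the factor ρ ≤ 1 in the exponent can be dropped.
    have h3 : Real.exp (n * ρ * youngConj ω ((K : ℝ) / n)) ≤ youngExp ω l K := by
      refine le_trans ?_ (hω.youngExp_anti hl hn.le K)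
      refine Real.exp_le_exp.2 ?_
      refine mul_le_mul_of_nonneg_right ?_ (hω.youngConj_nonneg _)
      exact mul_le_of_le_one_right hn0.le hρ1
    have h4 : Real.exp (m * (ω ‖x‖ + ω ‖y‖ + ω ‖ξ‖)) ≤
        Real.exp (|m| * (ω ‖x‖ + ω ‖y‖ + ω ‖ξ‖)) := by
      have := hω.weight_norm_nonneg x
      have := hω.weight_norm_nonneg y
      have := hω.weight_norm_nonneg ξ
      gcongr
      exact le_abs_self m
    have h0 : 0 ≤ bracket (x - y) ^ (ρ * (K : ℝ)) / bracket₃ x y ξ ^ (ρ * (K : ℝ)) := by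
      positivity
    gcongr

end Amplitude

/-! ### The operator as two successive oscillatory integrals -/

section Operator

variable {d : ℕ}

/-- The weight `e^{m (ω(x) + ω(y) + ω(ξ))}` on `ℝ^{3d}`. -/
def weight₃ (ω : ℝ → ℝ) (m : ℝ) (p : Eucl d × Eucl d × Eucl d) : ℝ :=
  Real.exp (m * (ω ‖p.1‖ + ω ‖p.2.1‖ + ω ‖p.2.2‖))

lemma weight₃_nonneg (ω : ℝ → ℝ) (m : ℝ) (p : Eucl d × Eucl d × Eucl d) : 0 ≤ weight₃ ω m p :=
  (Real.exp_pos _).le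

/-- The weight `e^{-l ω(x)}`. -/
def decayWeight {E : Type*} [NormedAddCommGroup E] (ω : ℝ → ℝ) (l : ℝ) (x : E) : ℝ :=
  Real.exp (-(l * ω ‖x‖))

lemma decayWeight_nonneg {E : Type*} [NormedAddCommGroup E] (ω : ℝ → ℝ) (l : ℝ) (x : E) :
    0 ≤ decayWeight ω l x :=
  (Real.exp_pos _).le

/-- The change of variables `((x, ξ), y) ↦ (x, y, ξ)`. -/
def reorder (d : ℕ) : (Eucl d × Eucl d) × Eucl d →L[ℝ] Eucl d × Eucl d × Eucl d :=
  (ContinuousLinearMap.fst ℝ _ _ ∘L ContinuousLinearMap.fst ℝ _ _).prod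
    ((ContinuousLinearMap.snd ℝ _ _).prod
      (ContinuousLinearMap.snd ℝ _ _ ∘L ContinuousLinearMap.fst ℝ _ _))

lemma reorder_apply (z : (Eucl d × Eucl d) × Eucl d) : reorder d z = (z.1.1, z.2, z.1.2) := rfl

lemma norm_reorder_le : ‖reorder d‖ ≤ 1 := by
  refine ContinuousLinearMap.opNorm_le_bound _ zero_le_one fun z => ?_
  rw [one_mul, reorder_apply]
  refine max_le ?_ (max_le ?_ ?_)
  · exact (norm_fst_le z.1).trans (norm_fst_le z)
  · exact norm_snd_le z
  · exact (norm_snd_le z.1).trans (norm_fst_le z)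

/-- The integrand of the inner integral, without its phase. -/
def innerFun (b : Eucl d × Eucl d × Eucl d → ℂ) (f : Eucl d → ℂ)
    (z : (Eucl d × Eucl d) × Eucl d) : ℂ := b (reorder d z) * f z.2

/-- The inner integral `∫ e^{-i⟨y,ξ⟩} b(x,y,ξ) f(y) dy`. -/
def innerInt (b : Eucl d × Eucl d × Eucl d → ℂ) (f : Eucl d → ℂ) : Eucl d × Eucl d → ℂ :=
  oscInt (-(ContinuousLinearMap.snd ℝ (Eucl d) (Eucl d))) (innerFun b f)

/-- The operator `f ↦ ∫ e^{i⟨x,ξ⟩} ∫ e^{-i⟨y,ξ⟩} b(x,y,ξ) f(y) dy dξ`. -/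
def pseudoOp (b : Eucl d × Eucl d × Eucl d → ℂ) (f : Eucl d → ℂ) : Eucl d → ℂ :=
  oscInt (ContinuousLinearMap.id ℝ (Eucl d)) (innerInt b f)

variable {ω : ℝ → ℝ} (hω : IsWeight ω)
include hω

lemma IsWeight.innerFun_bound {c l m M S : ℝ} (hc : 0 ≤ c) (hl : 0 < l) (hM : 0 ≤ M) (hS : 0 ≤ S)
    {b : Eucl d × Eucl d × Eucl d → ℂ} {f : Eucl d → ℂ} (hb : ContDiff ℝ (⊤ : ℕ∞) b)
    (hf : ContDiff ℝ (⊤ : ℕ∞) f) (hbb : DerivBound ω c l M (weight₃ ω m) b)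
    (hfb : DerivBound ω 1 l S (decayWeight ω l) f) :
    ContDiff ℝ (⊤ : ℕ∞) (innerFun b f) ∧ DerivBound ω (c + 1) l (M * S)
      (fun z => Real.exp (m * (ω ‖z.1.1‖ + ω ‖z.1.2‖)) * Real.exp (-((l - m) * ω ‖z.2‖)))
      (innerFun b f) := by
  have h1 := (hbb.comp_clm hb (reorder d))
  have h2 := (hfb.comp_clm hf (ContinuousLinearMap.snd ℝ (Eucl d × Eucl d) (Eucl d)))
  have s1 : ContDiff ℝ (⊤ : ℕ∞) fun z => b (reorder d z) := hb.comp (reorder d).contDiff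
  have s2 : ContDiff ℝ (⊤ : ℕ∞) fun z : (Eucl d × Eucl d) × Eucl d => f z.2 :=
    hf.comp contDiff_snd
  have h3 := h1.mul hω hl (by positivity) (by positivity) hM hS
    (fun z => weight₃_nonneg ω m _) (fun z => decayWeight_nonneg ω l _) s1 s2 h2
  refine ⟨s1.mul s2, h3.mono hω (by positivity) ?_ hl le_rfl (by positivity) le_rfl
    (fun z => mul_nonneg (weight₃_nonneg ω m _) (decayWeight_nonneg ω l _)) fun z => le_of_eq ?_⟩
  · have := mul_le_mul_of_nonneg_left (norm_reorder_le (d := d)) hc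
    have := ContinuousLinearMap.norm_snd_le ℝ (Eucl d × Eucl d) (Eucl d)
    linarith
  · simp only [weight₃, decayWeight, reorder_apply, ContinuousLinearMap.coe_snd', ← Real.exp_add]
    congr 1
    ring

/-- Decay in ξ is produced at parameter l+m, so that l is left after the growth e^{mω(ξ)} of the
symbol. The growth in x is only carried along. -/
lemma IsWeight.exists_derivBound_innerInt (d : ℕ) {c l m : ℝ} (hc : 0 ≤ c) (hm : 0 ≤ m)
    (hl : 0 < l) :
    ∃ l' : ℝ, 0 < l' ∧ ∃ C : ℝ, 0 < C ∧ ∀ (M S : ℝ) (b : Eucl d × Eucl d × Eucl d → ℂ)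
      (f : Eucl d → ℂ), 0 ≤ M → 0 ≤ S → ContDiff ℝ (⊤ : ℕ∞) b → ContDiff ℝ (⊤ : ℕ∞) f →
      DerivBound ω c l' M (weight₃ ω m) b → DerivBound ω 1 l' S (decayWeight ω l') f →
      ContDiff ℝ (⊤ : ℕ∞) (innerInt b f) ∧ DerivBound ω 1 l (C * (M * S))
        (fun p => Real.exp (m * ω ‖p.1‖) * decayWeight ω l p.2) (innerInt b f) := by
  have hlm : 0 < l + m := by linarith
  obtain ⟨l₁, hl₁, C, hC, H⟩ := hω.exists_derivBound_oscInt
    (-(ContinuousLinearMap.snd ℝ (Eucl d) (Eucl d))) (c := c + 1) (l := l + m) (by positivity) hlm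
  -- The additional decay m of f cancels the growth e^{mω(y)} of the symbol.
  refine ⟨l₁ + m, by linarith, C, hC, fun M S b f hM hS hb hf hbb hfb => ?_⟩
  obtain ⟨hs, hg⟩ := hω.innerFun_bound hc (by linarith) hM hS hb hf hbb hfb
  have hcont : Continuous fun p : Eucl d × Eucl d => Real.exp (m * (ω ‖p.1‖ + ω ‖p.2‖)) :=
    Real.continuous_exp.comp (continuous_const.mul
      ((hω.continuous_weight_norm.comp continuous_fst).add
        (hω.continuous_weight_norm.comp continuous_snd)))
  have h := H (M * S) (fun p => Real.exp (m * (ω ‖p.1‖ + ω ‖p.2‖))) (innerFun b f)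
    (by positivity) hcont (fun p => (Real.exp_pos _).le) hs
    (hg.mono hω (by positivity) le_rfl (by linarith) (by linarith) (by positivity) le_rfl
      (fun z => by positivity) (fun z => by simp))
  refine ⟨h.1, h.2.mono hω zero_le_one le_rfl hl (by linarith) (by positivity) le_rfl
    (fun z => by positivity) fun p => le_of_eq ?_⟩
  simp only [decayWeight, neg_apply, ContinuousLinearMap.coe_snd', norm_neg,
    ← Real.exp_add]
  congr 1
  ring

/-- The same trade for the transform from ξ to x: decay l+m in x beats the growth e^{mω(x)}. -/
lemma IsWeight.exists_derivBound_oscInt_id (d : ℕ) {l m : ℝ} (hm : 0 ≤ m) (hl : 0 < l) :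
    ∃ l' : ℝ, 0 < l' ∧ ∃ C : ℝ, 0 < C ∧ ∀ (M : ℝ) (h : Eucl d × Eucl d → ℂ), 0 ≤ M →
      ContDiff ℝ (⊤ : ℕ∞) h →
      DerivBound ω 1 l' M (fun p => Real.exp (m * ω ‖p.1‖) * decayWeight ω l' p.2) h →
      ContDiff ℝ (⊤ : ℕ∞) (oscInt (ContinuousLinearMap.id ℝ (Eucl d)) h) ∧
      DerivBound ω 1 l (C * M) (decayWeight ω l)
        (oscInt (ContinuousLinearMap.id ℝ (Eucl d)) h) := by
  have hlm : 0 < l + m := by linarith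
  obtain ⟨l₁, hl₁, C, hC, H⟩ := hω.exists_derivBound_oscInt
    (ContinuousLinearMap.id ℝ (Eucl d)) (c := 1) (l := l + m) (by positivity) hlm
  refine ⟨l₁, by linarith, C, hC, fun M h hM hs hb => ?_⟩
  have h := H M (fun x => Real.exp (m * ω ‖x‖)) h hM (Real.continuous_exp.comp
    (continuous_const.mul hω.continuous_weight_norm)) (fun p => (Real.exp_pos _).le) hs hb
  refine ⟨h.1, h.2.mono hω zero_le_one le_rfl hl (by linarith) (by positivity) le_rfl
    (fun z => by positivity) fun p => le_of_eq ?_⟩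
  simp only [decayWeight, ContinuousLinearMap.coe_id', id, ← Real.exp_add]
  congr 1
  ring

/-- Parameters are chosen backwards, from the required output to the input. The bound is bilinear in
the constants of `b` and `f`, which gives both continuity and the limit δ → 0. -/
lemma IsWeight.exists_derivBound_pseudoOp (d : ℕ) {c l m : ℝ} (hc : 0 ≤ c) (hm : 0 ≤ m)
    (hl : 0 < l) :
    ∃ l' : ℝ, 0 < l' ∧ ∃ C : ℝ, 0 < C ∧ ∀ (M S : ℝ) (b : Eucl d × Eucl d × Eucl d → ℂ)
      (f : Eucl d → ℂ), 0 ≤ M → 0 ≤ S → ContDiff ℝ (⊤ : ℕ∞) b → ContDiff ℝ (⊤ : ℕ∞) f →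
      DerivBound ω c l' M (weight₃ ω m) b → DerivBound ω 1 l' S (decayWeight ω l') f →
      ContDiff ℝ (⊤ : ℕ∞) (pseudoOp b f) ∧
        DerivBound ω 1 l (C * (M * S)) (decayWeight ω l) (pseudoOp b f) := by
  obtain ⟨l₁, hl₁, C₁, hC₁, H₁⟩ := hω.exists_derivBound_oscInt_id d hm hl
  obtain ⟨l₂, hl₂, C₂, hC₂, H₂⟩ := hω.exists_derivBound_innerInt d hc hm hl₁
  refine ⟨l₂, hl₂, C₁ * C₂, by positivity, fun M S b f hM hS hb hf hbb hfb => ?_⟩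
  obtain ⟨h1, h2⟩ := H₂ M S b f hM hS hb hf hbb hfb
  rw [mul_assoc]
  exact H₁ _ _ (by positivity) h1 h2

omit hω in
-- Presents the Fourier transform as the case L = -id with an integrand independent of the
-- parameter, so the main estimate also serves the Fourier side of the seminorms.
lemma fourierT_eq_oscInt (u : Eucl d → ℂ) :
    fourierT u = oscInt (-(ContinuousLinearMap.id ℝ (Eucl d))) (fun z => u z.2) := by
  funext ξ
  simp only [fourierT, oscInt, neg_apply, ContinuousLinearMap.coe_id', id,
    inner_neg_right]
  push_cast
  simp only [mul_neg, mul_comm]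

lemma IsWeight.exists_derivBound_fourierT (d : ℕ) {l : ℝ} (hl : 0 < l) :
    ∃ l' : ℝ, 0 < l' ∧ ∃ C : ℝ, 0 < C ∧ ∀ (M : ℝ) (u : Eucl d → ℂ), 0 ≤ M →
      ContDiff ℝ (⊤ : ℕ∞) u → DerivBound ω 1 l' M (decayWeight ω l') u →
      ContDiff ℝ (⊤ : ℕ∞) (fourierT u) ∧
      DerivBound ω 1 l (C * M) (decayWeight ω l) (fourierT u) := by
  obtain ⟨l₁, hl₁, C, hC, H⟩ := hω.exists_derivBound_oscInt
    (-(ContinuousLinearMap.id ℝ (Eucl d))) (c := 1) (l := l) (by positivity) hl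
  refine ⟨l₁, by linarith, C, hC, fun M u hM hs hb => ?_⟩
  have h2 := hb.comp_clm hs (ContinuousLinearMap.snd ℝ (Eucl d) (Eucl d))
  have h := H M (fun _ => 1) (fun z => u z.2) hM continuous_const (fun p => zero_le_one)
    (hs.comp contDiff_snd) (h2.mono hω (by positivity)
      (by rw [one_mul]; exact ContinuousLinearMap.norm_snd_le ℝ (Eucl d) (Eucl d))
      (by linarith) le_rfl hM le_rfl
      (fun z => decayWeight_nonneg ω _ _) (fun z => by simp [decayWeight]))
  rw [fourierT_eq_oscInt]
  refine ⟨h.1, h.2.mono hω zero_le_one le_rfl hl le_rfl (by positivity) le_rfl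
    (fun z => by positivity) fun p => le_of_eq ?_⟩
  simp [decayWeight]

omit hω in
lemma DerivBound.norm_le {E : Type*} [NormedAddCommGroup E] [NormedSpace ℝ E] {c l M : ℝ}
    (hω : IsWeight ω) (hl : 0 < l) {V : E → ℝ} {g : E → ℂ} (h : DerivBound ω c l M V g) (z : E) :
    ‖g z‖ ≤ M * V z := by
  simpa [hω.youngExp_zero hl] using h 0 z

omit hω in
/-- The seminorm estimate behind a `DerivBound`. -/
lemma DerivBound.weighted_le {l M : ℝ} {u : Eucl d → ℂ} (hu : ContDiff ℝ (⊤ : ℕ∞) u)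
    (h : DerivBound ω 1 l M (decayWeight ω l) u) (α : Fin d → ℕ) (x : Eucl d) :
    weighted ω l α u x ≤ youngExp ω l (∑ j, α j) * M := by
  have h1 := (norm_multiD_le α hu x).trans (h _ x)
  rw [one_pow, mul_one, decayWeight] at h1
  calc _ ≤ Real.exp (l * ω ‖x‖) * (M * youngExp ω l (∑ j, α j) * Real.exp (-(l * ω ‖x‖))) := by
        rw [weighted]; gcongr
    _ = (Real.exp (l * ω ‖x‖) * Real.exp (-(l * ω ‖x‖))) * (youngExp ω l (∑ j, α j) * M) := by
        ring
    _ = _ := by rw [← Real.exp_add, add_neg_cancel, Real.exp_zero, one_mul]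

lemma DerivBound.integrable {l M : ℝ} (hl : 1 ≤ l) {u : Eucl d → ℂ} (hu : Continuous u)
    (h : DerivBound ω 1 l M (decayWeight ω l) u) : Integrable u := by
  refine ((hω.exists_integrable_exp (Eucl d) volume l hl).const_mul M).mono'
    hu.aestronglyMeasurable (Eventually.of_forall fun x => ?_)
  exact h.norm_le hω (by linarith) x

/-- The conditions on the Fourier transform need no separate hypothesis: the main estimate transfers
the bounds on u to it. -/
lemma IsWeight.memSω {u : Eucl d → ℂ} (hu : ContDiff ℝ (⊤ : ℕ∞) u)
    (h : ∀ l, 0 < l → ∃ M, 0 ≤ M ∧ DerivBound ω 1 l M (decayWeight ω l) u) : MemSω ω u := by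
  have hF : ∀ l, 0 < l → ContDiff ℝ (⊤ : ℕ∞) (fourierT u) ∧
      ∃ M, DerivBound ω 1 l M (decayWeight ω l) (fourierT u) := by
    intro l hl
    obtain ⟨l', hl', C, -, H⟩ := hω.exists_derivBound_fourierT d hl
    obtain ⟨M, hM, hb⟩ := h l' hl'
    exact ⟨(H M u hM hu hb).1, _, (H M u hM hu hb).2⟩
  refine ⟨?_, hu, (hF 1 one_pos).1, fun l hl α => ?_, fun l hl α => ?_⟩
  · obtain ⟨M, _, hM⟩ := h 1 one_pos
    exact hM.integrable hω le_rfl hu.continuous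
  · obtain ⟨M, _, hM⟩ := h l hl
    exact ⟨_, by rintro _ ⟨x, rfl⟩; exact hM.weighted_le hu α x⟩
  · obtain ⟨hs, M, hM⟩ := hF l hl
    exact ⟨_, by rintro _ ⟨x, rfl⟩; exact hM.weighted_le hs α x⟩

/-- Ultradifferentiable estimates control the seminorms of `S_ω`. -/
lemma IsWeight.exists_seminormFamily_le
    (i : ({l : ℝ // 0 < l} × (Fin d → ℕ)) ⊕ ({l : ℝ // 0 < l} × (Fin d → ℕ))) :
    ∃ l : ℝ, 0 < l ∧ ∃ C : ℝ, 0 < C ∧ ∀ (M : ℝ) (f : Sω d ω), 0 ≤ M →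
      DerivBound ω 1 l M (decayWeight ω l) (f : Eucl d → ℂ) →
      seminormFamily d ω i f ≤ C * M := by
  rcases i with ⟨⟨l, hl⟩, α⟩ | ⟨⟨l, hl⟩, α⟩
  · exact ⟨l, hl, _, youngExp_pos ω l _, fun M f _ h =>
      ciSup_le fun x => h.weighted_le f.mem.smooth α x⟩
  · obtain ⟨l', hl', C, hC, H⟩ := hω.exists_derivBound_fourierT d hl
    refine ⟨l', hl', youngExp ω l (∑ j, α j) * C, mul_pos (youngExp_pos ω l _) hC,
      fun M f hM h => ?_⟩
    obtain ⟨hs, hb⟩ := H M f hM f.mem.smooth h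
    rw [mul_assoc]
    exact ciSup_le fun x => hb.weighted_le hs α x

/-- The seminorms of `S_ω` control the ultradifferentiable estimates. -/
lemma IsWeight.exists_seminorm_derivBound (d : ℕ) {l : ℝ} (hl : 0 < l) :
    ∃ q : Seminorm ℂ (Sω d ω), Continuous q ∧ ∃ C : ℝ, 0 < C ∧ ∀ f : Sω d ω,
      DerivBound ω 1 l (C * q f) (decayWeight ω l) (f : Eucl d → ℂ) := by
  obtain ⟨l', hl', C, hC, H⟩ := hω.exists_derivBound_of_decay (Eucl d) hl
  have h0 : ∀ u : Eucl d → ℂ, multiD 0 u = u := by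
    intro u
    simp [multiD]
  have key : ∀ u : Eucl d → ℂ, BddAbove (Set.range (weighted ω l' 0 u)) → ∀ x,
      ‖u x‖ ≤ (⨆ x, weighted ω l' 0 u x) * Real.exp (-(l' * ω ‖x‖)) := by
    intro u hu x
    have h := le_ciSup hu x
    rw [weighted, h0] at h
    rw [Real.exp_neg, ← div_eq_mul_inv, le_div_iff₀ (Real.exp_pos _), mul_comm]
    exact h
  have c1 := (withSeminorms d ω).continuous_seminorm (Sum.inl (⟨l', hl'⟩, 0))
  have c2 := (withSeminorms d ω).continuous_seminorm (Sum.inr (⟨l', hl'⟩, 0))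
  refine ⟨seminormSpace d ω ⟨l', hl'⟩ 0 + seminormFourier d ω ⟨l', hl'⟩ 0, c1.add c2, C, hC,
    fun f => ?_⟩
  have n1 : 0 ≤ seminormSpace d ω ⟨l', hl'⟩ 0 f := apply_nonneg _ _
  have n2 : 0 ≤ seminormFourier d ω ⟨l', hl'⟩ 0 f := apply_nonneg _ _
  -- Only the two seminorms without derivatives are used. The argument -v accounts for the opposite
  -- sign of the phase.
  refine H _ _ (apply_nonneg _ _) f.mem.integrable f.mem.smooth (fun x => ?_) fun v => ?_
  · refine (key f (f.mem.bdd l' hl' 0) x).trans ?_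
    exact mul_le_mul_of_nonneg_right (le_add_of_nonneg_right n2) (Real.exp_pos _).le
  · have h := key _ (f.mem.bdd_fourier l' hl' 0) (-v)
    rw [norm_neg] at h
    have e : fourierT (f : Eucl d → ℂ) (-v) =
        ∫ y, Complex.exp (Complex.I * ((inner ℝ y v : ℝ) : ℂ)) * f.1 y := by
      simp only [fourierT, inner_neg_right]
      push_cast
      simp only [mul_neg, neg_neg, mul_comm]
    rw [e] at h
    refine h.trans ?_
    exact mul_le_mul_of_nonneg_right (le_add_of_nonneg_left n1) (Real.exp_pos _).le

end Operator

/-! ### Linearity of oscillatory integrals -/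

section Linearity

variable {E F : Type*} [NormedAddCommGroup E] [NormedSpace ℝ E] [NormedAddCommGroup F]
  [InnerProductSpace ℝ F] [FiniteDimensional ℝ F] [MeasurableSpace F] [BorelSpace F]

open scoped RealInnerProductSpace

lemma norm_cexp_I_mul_ofReal (t : ℝ) : ‖Complex.exp (Complex.I * (t : ℂ))‖ = 1 := by
  rw [mul_comm, Complex.norm_exp_ofReal_mul_I]

lemma integrable_phase_mul (v : F) {g : F → ℂ} (hg : Integrable g) :
    Integrable fun y => Complex.exp (Complex.I * ((⟪y, v⟫ : ℝ) : ℂ)) * g y := by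
  refine hg.bdd_mul (c := 1) (Continuous.aestronglyMeasurable (by fun_prop)) ?_
  exact Eventually.of_forall fun y => (norm_cexp_I_mul_ofReal _).le

lemma oscInt_add (L : E →L[ℝ] F) {g h : E × F → ℂ} (hg : ∀ p, Integrable fun y => g (p, y))
    (hh : ∀ p, Integrable fun y => h (p, y)) : oscInt L (g + h) = oscInt L g + oscInt L h := by
  funext p
  simp only [oscInt, Pi.add_apply, mul_add]
  exact integral_add (integrable_phase_mul _ (hg p)) (integrable_phase_mul _ (hh p))

lemma oscInt_smul (L : E →L[ℝ] F) (c : ℂ) (g : E × F → ℂ) :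
    oscInt L (c • g) = c • oscInt L g := by
  funext p
  simp only [oscInt, Pi.smul_apply, smul_eq_mul, mul_left_comm _ c]
  exact integral_const_mul c _

end Linearity

/-! ### Continuity of the operators on S_ω -/

section Symbol

variable {d : ℕ}

/-- Symbols of exponential type on `ℝ^{3d}`. -/
structure IsSymbol (ω : ℝ → ℝ) (b : Eucl d × Eucl d × Eucl d → ℂ) : Prop where
  smooth : ContDiff ℝ (⊤ : ℕ∞) b
  bound : ∃ c, 0 ≤ c ∧ ∃ m, 0 ≤ m ∧ ∀ l, 0 < l → ∃ M, 0 ≤ M ∧ DerivBound ω c l M (weight₃ ω m) b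

variable {ω : ℝ → ℝ} (hω : IsWeight ω)
include hω

lemma Sω.exists_derivBound (f : Sω d ω) {l : ℝ} (hl : 0 < l) :
    ∃ S, 0 ≤ S ∧ DerivBound ω 1 l S (decayWeight ω l) (f : Eucl d → ℂ) := by
  obtain ⟨q, -, C, hC, h⟩ := hω.exists_seminorm_derivBound d hl
  exact ⟨C * q f, mul_nonneg hC.le (apply_nonneg _ _), h f⟩

namespace IsSymbol

variable {b : Eucl d × Eucl d × Eucl d → ℂ} (hb : IsSymbol ω b)
include hb

lemma integrable_innerFun (f : Sω d ω) (p : Eucl d × Eucl d) :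
    Integrable fun y => innerFun b f (p, y) := by
  obtain ⟨c, hc, m, hm, h⟩ := hb.bound
  have hm1 : 0 < m + 1 := by linarith
  obtain ⟨M, hM, hbM⟩ := h (m + 1) hm1
  obtain ⟨S, hS, hfS⟩ := f.exists_derivBound hω hm1
  obtain ⟨hs, hB⟩ := hω.innerFun_bound hc hm1 hM hS hb.smooth f.mem.smooth hbM hfS
  refine ((hω.exists_integrable_exp (Eucl d) volume 1 le_rfl).const_mul
    (M * S * Real.exp (m * (ω ‖p.1‖ + ω ‖p.2‖)))).mono'
    (hs.continuous.comp (Continuous.prodMk_right p)).aestronglyMeasurable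
    (Eventually.of_forall fun y => ?_)
  refine (hB.norm_le hω hm1 (p, y)).trans (le_of_eq ?_)
  simp only [add_sub_cancel_left]
  ring

lemma integrable_innerInt (f : Sω d ω) (x : Eucl d) :
    Integrable fun ξ => innerInt b f (x, ξ) := by
  obtain ⟨c, hc, m, hm, h⟩ := hb.bound
  obtain ⟨l, hl, C, hC, H⟩ := hω.exists_derivBound_innerInt d hc hm one_pos
  obtain ⟨M, hM, hbM⟩ := h l hl
  obtain ⟨S, hS, hfS⟩ := f.exists_derivBound hω hl
  obtain ⟨hs, hB⟩ := H M S b f hM hS hb.smooth f.mem.smooth hbM hfS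
  refine ((hω.exists_integrable_exp (Eucl d) volume 1 le_rfl).const_mul
    (C * (M * S) * Real.exp (m * ω ‖x‖))).mono'
    (hs.continuous.comp (Continuous.prodMk_right x)).aestronglyMeasurable
    (Eventually.of_forall fun ξ => ?_)
  refine (hB.norm_le hω one_pos (x, ξ)).trans (le_of_eq ?_)
  simp only [decayWeight]
  ring

lemma memSω_pseudoOp (f : Sω d ω) : MemSω ω (pseudoOp b (f : Eucl d → ℂ)) := by
  obtain ⟨c, hc, m, hm, h⟩ := hb.bound
  have key : ∀ l, 0 < l → ContDiff ℝ (⊤ : ℕ∞) (pseudoOp b (f : Eucl d → ℂ)) ∧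
      ∃ M, 0 ≤ M ∧ DerivBound ω 1 l M (decayWeight ω l) (pseudoOp b (f : Eucl d → ℂ)) := by
    intro l hl
    obtain ⟨l', hl', C, hC, H⟩ := hω.exists_derivBound_pseudoOp d hc hm hl
    obtain ⟨M, hM, hbM⟩ := h l' hl'
    obtain ⟨S, hS, hfS⟩ := f.exists_derivBound hω hl'
    obtain ⟨hs, hB⟩ := H M S b f hM hS hb.smooth f.mem.smooth hbM hfS
    exact ⟨hs, _, by positivity, hB⟩
  exact hω.memSω (key 1 one_pos).1 fun l hl => (key l hl).2

/-- Additivity is stated for the products b(x,y,ξ)f(y), so that it serves both sums of functions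
with one symbol and sums of symbols with one function. -/
lemma pseudoOp_add {b₁ b₂ : Eucl d × Eucl d × Eucl d → ℂ} (hb₁ : IsSymbol ω b₁) (f f₁ : Sω d ω)
    (f₂ : Eucl d → ℂ)
    (h : innerFun b f + innerFun b₁ f₁ = innerFun b₂ f₂) :
    pseudoOp b f + pseudoOp b₁ f₁ = pseudoOp b₂ f₂ := by
  rw [pseudoOp, pseudoOp, pseudoOp, ← oscInt_add _ (hb.integrable_innerInt hω f)
    (hb₁.integrable_innerInt hω f₁), innerInt, innerInt, innerInt,
    ← oscInt_add _ (hb.integrable_innerFun hω f) (hb₁.integrable_innerFun hω f₁), h]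

omit hω hb in
lemma _root_.UltraPseudo.pseudoOp_smul (b : Eucl d × Eucl d × Eucl d → ℂ) (c : ℂ)
    (f : Eucl d → ℂ) : pseudoOp b (c • f) = c • pseudoOp b f := by
  have h : innerFun b (c • f) = c • innerFun b f := by
    funext z
    simp only [innerFun, Pi.smul_apply, smul_eq_mul]
    ring
  rw [pseudoOp, innerInt, h, oscInt_smul, oscInt_smul]
  rfl

end IsSymbol

/-- The seminorms of `pseudoOp b f` are bounded linearly in the constant of `b` and continuously
in `f`. -/
lemma IsWeight.exists_seminormFamily_pseudoOp_le {c m : ℝ} (hc : 0 ≤ c) (hm : 0 ≤ m)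
    (i : ({l : ℝ // 0 < l} × (Fin d → ℕ)) ⊕ ({l : ℝ // 0 < l} × (Fin d → ℕ))) :
    ∃ l : ℝ, 0 < l ∧ ∃ q : Seminorm ℂ (Sω d ω), Continuous q ∧ ∃ C : ℝ, 0 ≤ C ∧
      ∀ (M : ℝ) (b : Eucl d × Eucl d × Eucl d → ℂ), 0 ≤ M → ContDiff ℝ (⊤ : ℕ∞) b →
      DerivBound ω c l M (weight₃ ω m) b → ∀ f g : Sω d ω,
      (g : Eucl d → ℂ) = pseudoOp b (f : Eucl d → ℂ) →
      seminormFamily d ω i g ≤ C * M * q f := by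
  obtain ⟨l₁, hl₁, C₁, hC₁, H₁⟩ := hω.exists_seminormFamily_le i
  obtain ⟨l₂, hl₂, C₂, hC₂, H₂⟩ := hω.exists_derivBound_pseudoOp d hc hm hl₁
  obtain ⟨q, hq, C₃, hC₃, H₃⟩ := hω.exists_seminorm_derivBound d hl₂
  refine ⟨l₂, hl₂, q, hq, C₁ * C₂ * C₃, by positivity, fun M b hM hb hbb f g hg => ?_⟩
  have hqf : 0 ≤ q f := apply_nonneg _ _
  have h := (H₂ M (C₃ * q f) b f hM (by positivity) hb f.mem.smooth hbb (H₃ f)).2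
  rw [← hg] at h
  exact (H₁ _ g (by positivity) h).trans (le_of_eq (by ring))

/-- The operator with symbol `b` on `S_ω`. -/
lemma IsSymbol.exists_continuousLinearMap {b : Eucl d × Eucl d × Eucl d → ℂ}
    (hb : IsSymbol ω b) :
    ∃ A : Sω d ω →L[ℂ] Sω d ω, ∀ f : Sω d ω,
      (A f : Eucl d → ℂ) = pseudoOp b (f : Eucl d → ℂ) := by
  let A : Sω d ω →ₗ[ℂ] Sω d ω :=
    { toFun := fun f => ⟨pseudoOp b (f : Eucl d → ℂ), hb.memSω_pseudoOp hω f⟩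
      map_add' := fun f g => Subtype.ext (hb.pseudoOp_add hω hb f g _ (by
        funext z
        exact (mul_add _ _ _).symm)).symm
      map_smul' := fun c f => Subtype.ext (pseudoOp_smul b c _) }
  obtain ⟨c, hc, m, hm, h⟩ := hb.bound
  have : IsTopologicalAddGroup (Sω d ω) := (withSeminorms d ω).topologicalAddGroup
  refine ⟨⟨A, (withSeminorms d ω).continuous_of_continuous_comp A fun i => ?_⟩,
    fun f => rfl⟩
  obtain ⟨l, hl, q, hq, C, hC, H⟩ := hω.exists_seminormFamily_pseudoOp_le hc hm i
  obtain ⟨M, hM, hbM⟩ := h l hl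
  let r : ℝ≥0 := ⟨C * M, mul_nonneg hC hM⟩
  have hcont : Continuous (r • q) := by
    have h : ⇑(r • q) = fun f => C * M * q f := rfl
    rw [h]
    exact continuous_const.mul hq
  exact Seminorm.continuous_of_le hcont fun f => H M b hM hb.smooth hbM f (A f) rfl

end Symbol

/-! ### Identification with the iterated integral -/

section Kernel

variable {d : ℕ} {ω : ℝ → ℝ}

lemma kernelFun_eq (b : Eucl d × Eucl d × Eucl d → ℂ) (f : Eucl d → ℂ) (x y ξ : Eucl d) :
    kernelFun (fun x y ξ => b (x, y, ξ)) f x y ξ =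
      Complex.exp (Complex.I * ((inner ℝ ξ x : ℝ) : ℂ)) *
        (Complex.exp (Complex.I * ((inner ℝ y (-ξ) : ℝ) : ℂ)) * innerFun b f ((x, ξ), y)) := by
  have h : Complex.exp (Complex.I * ((inner ℝ (x - y) ξ : ℝ) : ℂ)) =
      Complex.exp (Complex.I * ((inner ℝ ξ x : ℝ) : ℂ)) *
        Complex.exp (Complex.I * ((inner ℝ y (-ξ) : ℝ) : ℂ)) := by
    rw [← Complex.exp_add, inner_sub_left, inner_neg_right, real_inner_comm x ξ]
    push_cast
    ring_nf
  simp only [kernelFun, h, innerFun, reorder_apply]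
  ring

lemma integral_kernelFun (b : Eucl d × Eucl d × Eucl d → ℂ) (f : Eucl d → ℂ) (x ξ : Eucl d) :
    ∫ y, kernelFun (fun x y ξ => b (x, y, ξ)) f x y ξ =
      Complex.exp (Complex.I * ((inner ℝ ξ x : ℝ) : ℂ)) * innerInt b f (x, ξ) := by
  simp only [kernelFun_eq, integral_const_mul]
  rfl

lemma pseudoOp_eq_integral (b : Eucl d × Eucl d × Eucl d → ℂ) (f : Eucl d → ℂ) (x : Eucl d) :
    pseudoOp b f x = ∫ ξ, ∫ y, kernelFun (fun x y ξ => b (x, y, ξ)) f x y ξ := by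
  simp only [integral_kernelFun]
  rfl

lemma IsSymbol.integrable_kernelFun (hω : IsWeight ω) {b : Eucl d × Eucl d × Eucl d → ℂ}
    (hb : IsSymbol ω b) (f : Sω d ω) (x ξ : Eucl d) :
    Integrable fun y => kernelFun (fun x y ξ => b (x, y, ξ)) f x y ξ := by
  simp only [kernelFun_eq]
  exact (integrable_phase_mul _ (hb.integrable_innerFun hω f (x, ξ))).const_mul _

lemma IsSymbol.integrable_integral_kernelFun (hω : IsWeight ω)
    {b : Eucl d × Eucl d × Eucl d → ℂ} (hb : IsSymbol ω b) (f : Sω d ω) (x : Eucl d) :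
    Integrable fun ξ => ∫ y, kernelFun (fun x y ξ => b (x, y, ξ)) f x y ξ := by
  simp only [integral_kernelFun]
  exact integrable_phase_mul x (hb.integrable_innerInt hω f x)

lemma regKernelFun_eq (a : Eucl d → Eucl d → Eucl d → ℂ) (χ : Eucl (d + d) → ℂ) (δ : ℝ)
    (f : Eucl d → ℂ) (x y ξ : Eucl d) :
    regKernelFun a χ δ f x y ξ =
      kernelFun (fun x y ξ => a x y ξ * χ (pair (δ • x) (δ • ξ))) f x y ξ := by
  simp only [regKernelFun, kernelFun]
  ring

end Kernel

/-! ### The regularized operators and their limit -/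

section Regularization

variable {d : ℕ}

/-- The linear map `(x, y, ξ) ↦ (x, ξ)` into `ℝ^{2d}`. -/
def pairCLM (d : ℕ) : Eucl d × Eucl d × Eucl d →L[ℝ] Eucl (d + d) :=
  LinearMap.toContinuousLinearMap
    { toFun := fun p => pair p.1 p.2.2
      map_add' := fun p q => by
        ext i
        refine Fin.addCases (fun i => ?_) (fun i => ?_) i <;>
          simp [pair, -Fin.natAdd_eq_addNat]
      map_smul' := fun c p => by
        ext i
        refine Fin.addCases (fun i => ?_) (fun i => ?_) i <;>
          simp [pair, -Fin.natAdd_eq_addNat] }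

lemma pair_smul (δ : ℝ) (p : Eucl d × Eucl d × Eucl d) :
    pair (δ • p.1) (δ • p.2.2) = (δ • pairCLM d) p := by
  rw [smul_apply, ← map_smul]
  rfl

lemma norm_le_norm_pair (x ξ : Eucl d) : ‖ξ‖ ≤ ‖pair x ξ‖ := by
  refine le_of_sq_le_sq ?_ (norm_nonneg _)
  rw [EuclideanSpace.norm_sq_eq, EuclideanSpace.norm_sq_eq, Fin.sum_univ_add]
  simp only [pair, Fin.append_left, Fin.append_right]
  exact le_add_of_nonneg_left (Finset.sum_nonneg fun _ _ => sq_nonneg _)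

/-- The symbol `b(x,y,ξ) χ(δx,δξ)`. -/
def cutoff (b : Eucl d × Eucl d × Eucl d → ℂ) (χ : Eucl (d + d) → ℂ) (δ : ℝ)
    (p : Eucl d × Eucl d × Eucl d) : ℂ :=
  b p * χ ((δ • pairCLM d) p)

variable {ω : ℝ → ℝ} (hω : IsWeight ω)
include hω

/-- The decay of χ(δ·) is not uniform as δ → 0, so the weight is bounded by 1; δ survives only in
the geometric constant of the chain rule. -/
lemma Sω.exists_derivBound_dilate (χ : Sω (d + d) ω) {l : ℝ} (hl : 0 < l) :
    ∃ X, 0 ≤ X ∧ ∀ δ : ℝ, DerivBound ω (‖pairCLM d‖ * |δ|) l X (fun _ => 1)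
      (fun p => χ ((δ • pairCLM d) p)) := by
  obtain ⟨X, hX, h⟩ := χ.exists_derivBound hω hl
  refine ⟨X, hX, fun δ => ?_⟩
  have h1 := h.comp_clm χ.mem.smooth (δ • pairCLM d)
  refine h1.mono hω (by positivity) ?_ hl le_rfl hX le_rfl
    (fun z => decayWeight_nonneg ω l _) fun z => ?_
  · rw [norm_smul, one_mul, mul_comm, Real.norm_eq_abs]
  · refine Real.exp_le_one_iff.2 (neg_nonpos.2 (mul_nonneg hl.le (hω.weight_norm_nonneg _)))

/-- At order 0, χ is Lipschitz, so the difference is O(|δ||p|), and |p| is O(e^{ω(x)+ω(y)+ω(ξ)});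
this costs one unit of the growth exponent. At order K ≥ 1 the constant χ(0) disappears and the
chain rule gives |δ|^K ≤ |δ|. -/
lemma Sω.exists_derivBound_dilate_sub (χ : Sω (d + d) ω) {l : ℝ} (hl : 0 < l) :
    ∃ X, 0 ≤ X ∧ ∀ δ : ℝ, |δ| ≤ 1 → DerivBound ω ‖pairCLM d‖ l (X * |δ|) (weight₃ ω 1)
      (fun p => χ ((δ • pairCLM d) p) - χ 0) := by
  obtain ⟨X, hX, h⟩ := χ.exists_derivBound_dilate hω hl
  obtain ⟨B, hB, hχ⟩ := χ.exists_derivBound hω hl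
  obtain ⟨C, hC, hw⟩ := hω.exists_one_add_rpow_le 1 one_pos
  set κ := ‖pairCLM d‖
  have hκ : 0 ≤ κ := norm_nonneg _
  have hY := (youngExp_pos ω l 1).le
  have hw1 : ∀ p : Eucl d × Eucl d × Eucl d, 1 ≤ weight₃ ω 1 p := by
    intro p
    refine Real.one_le_exp ?_
    have := hω.weight_norm_nonneg p.1
    have := hω.weight_norm_nonneg p.2.1
    have := hω.weight_norm_nonneg p.2.2
    linarith
  have hnorm : ∀ p : Eucl d × Eucl d × Eucl d, ‖p‖ ≤ C * weight₃ ω 1 p := by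
    intro p
    have a1 := hω.weight_norm_nonneg p.1
    have a2 := hω.weight_norm_nonneg p.2.1
    have a3 := hω.weight_norm_nonneg p.2.2
    have key : ∀ x : Eucl d, ω ‖x‖ ≤ ω ‖p.1‖ + ω ‖p.2.1‖ + ω ‖p.2.2‖ →
        ‖x‖ ≤ C * weight₃ ω 1 p := by
      intro x hx
      have h1 := hw ‖x‖ (norm_nonneg x)
      rw [Real.rpow_one] at h1
      have h2 : Real.exp (ω ‖x‖) ≤ weight₃ ω 1 p := Real.exp_le_exp.2 (by linarith)
      have h3 := mul_le_mul_of_nonneg_left h2 hC.le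
      linarith
    exact max_le (key _ (by linarith)) (max_le (key _ (by linarith)) (key _ (by linarith)))
  have hlip : ∀ z, ‖χ z - χ 0‖ ≤ B * youngExp ω l 1 * ‖z‖ := by
    intro z
    have h2 := Convex.norm_image_sub_le_of_norm_fderiv_le (𝕜 := ℝ) (f := (χ : Eucl (d + d) → ℂ))
      (C := B * youngExp ω l 1) (s := Set.univ) (x := 0) (y := z)
      (fun x _ => χ.mem.smooth.differentiable (by simp) x) (fun x _ => ?_) convex_univ
      (Set.mem_univ _) (Set.mem_univ _)
    · simpa using h2
    · have h3 := hχ 1 x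
      rw [norm_iteratedFDeriv_one, one_pow, mul_one] at h3
      refine h3.trans (mul_le_of_le_one_right (by positivity) ?_)
      exact Real.exp_le_one_iff.2 (neg_nonpos.2 (mul_nonneg hl.le (hω.weight_norm_nonneg _)))
  refine ⟨B * youngExp ω l 1 * κ * C + X, by positivity, fun δ hδ K p => ?_⟩
  have hp := hw1 p
  have hp0 := weight₃_nonneg ω 1 p
  rcases K with _ | k
  · rw [norm_iteratedFDeriv_zero, pow_zero, mul_one, hω.youngExp_zero hl, mul_one]
    have h1 : ‖(δ • pairCLM d) p‖ ≤ |δ| * (κ * ‖p‖) := by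
      rw [smul_apply, norm_smul, Real.norm_eq_abs]
      exact mul_le_mul_of_nonneg_left ((pairCLM d).le_opNorm p) (abs_nonneg δ)
    calc _ ≤ B * youngExp ω l 1 * ‖(δ • pairCLM d) p‖ := hlip _
      _ ≤ B * youngExp ω l 1 * (|δ| * (κ * (C * weight₃ ω 1 p))) := by
        refine mul_le_mul_of_nonneg_left (h1.trans ?_) (by positivity)
        have := hnorm p
        gcongr
      _ = B * youngExp ω l 1 * κ * C * |δ| * weight₃ ω 1 p := by ring
      _ ≤ _ := by
        gcongr
        exact le_add_of_nonneg_right hX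
  · have hfd : (fderiv ℝ fun p => χ ((δ • pairCLM d) p) - χ 0) =
        fderiv ℝ fun p => χ ((δ • pairCLM d) p) := funext fun z => fderiv_sub_const _
    rw [← norm_iteratedFDeriv_fderiv, hfd, norm_iteratedFDeriv_fderiv]
    have hYk := (youngExp_pos ω l (k + 1)).le
    have hd : |δ| ^ (k + 1) ≤ |δ| := by
      rw [pow_succ]
      exact mul_le_of_le_one_left (abs_nonneg δ) (pow_le_one₀ (abs_nonneg δ) hδ)
    calc _ ≤ X * (κ * |δ|) ^ (k + 1) * youngExp ω l (k + 1) * 1 := h δ (k + 1) p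
      _ = X * |δ| ^ (k + 1) * κ ^ (k + 1) * youngExp ω l (k + 1) * 1 := by rw [mul_pow]; ring
      _ ≤ X * |δ| * κ ^ (k + 1) * youngExp ω l (k + 1) * weight₃ ω 1 p := by gcongr
      _ ≤ _ := by
        gcongr
        exact le_add_of_nonneg_left (by positivity)

lemma IsSymbol.cutoff {b : Eucl d × Eucl d × Eucl d → ℂ} (hb : IsSymbol ω b)
    (χ : Sω (d + d) ω) (δ : ℝ) : IsSymbol ω (cutoff b χ δ) := by
  have hs : ContDiff ℝ (⊤ : ℕ∞) fun p => χ ((δ • pairCLM d) p) :=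
    χ.mem.smooth.comp (δ • pairCLM d).contDiff
  obtain ⟨c, hc, m, hm, h⟩ := hb.bound
  refine ⟨hb.smooth.mul hs, c + ‖pairCLM d‖ * |δ|, by positivity, m, hm, fun l hl => ?_⟩
  obtain ⟨M, hM, hbM⟩ := h l hl
  obtain ⟨X, hX, hχ⟩ := χ.exists_derivBound_dilate hω hl
  have h1 := hbM.mul hω hl hc (by positivity) hM hX (weight₃_nonneg ω m) (fun _ => zero_le_one)
    hb.smooth hs (hχ δ)
  simp only [mul_one] at h1
  exact ⟨M * X, by positivity, h1⟩

/-- Decay in y comes from f and decay in ξ from χ, the latter only because δ ≠ 0. -/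
lemma IsSymbol.integrable_regularized {b : Eucl d × Eucl d × Eucl d → ℂ} (hb : IsSymbol ω b)
    (χ : Sω (d + d) ω) {δ : ℝ} (hδ : δ ≠ 0) (f : Sω d ω) (x : Eucl d) :
    Integrable fun p : Eucl d × Eucl d =>
      regKernelFun (fun x y ξ => b (x, y, ξ)) χ δ f x p.1 p.2 := by
  obtain ⟨c, hc, m, hm, h⟩ := hb.bound
  obtain ⟨M, hM, hbM⟩ := h 1 one_pos
  obtain ⟨S, hS, hfS⟩ := f.exists_derivBound hω (l := m + 1) (by linarith)
  -- Undoing the dilation costs the factor K, since ω(ξ) ≤ K(ω(δξ)+1). Decay (m+1)K of χ then leaves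
  -- m+1 in ξ: m against the symbol and 1 for integrability.
  obtain ⟨K, hK, hdil⟩ := hω.exists_dilate_le |δ|⁻¹ (by positivity)
  have hmK : 0 < (m + 1) * K := mul_pos (by linarith) (by linarith)
  obtain ⟨X, hX, hχX⟩ := χ.exists_derivBound hω hmK
  have hχb : ∀ ξ : Eucl d, ‖χ (pair (δ • x) (δ • ξ))‖ ≤
      X * Real.exp ((m + 1) * K) * Real.exp (-((m + 1) * ω ‖ξ‖)) := by
    intro ξ
    refine (hχX.norm_le hω hmK _).trans ?_
    rw [mul_assoc, ← Real.exp_add]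
    refine mul_le_mul_of_nonneg_left (Real.exp_le_exp.2 ?_) hX
    have h1 := hdil (|δ| * ‖ξ‖) (by positivity)
    rw [inv_mul_cancel_left₀ (abs_ne_zero.2 hδ)] at h1
    have h2 : ω (|δ| * ‖ξ‖) ≤ ω ‖pair (δ • x) (δ • ξ)‖ := by
      refine hω.monotoneOn (Set.mem_Ici.2 (by positivity)) (Set.mem_Ici.2 (norm_nonneg _)) ?_
      have := norm_le_norm_pair (δ • x) (δ • ξ)
      rwa [norm_smul, Real.norm_eq_abs] at this
    have h3 : (m + 1) * ω ‖ξ‖ ≤ (m + 1) * (K * (ω ‖pair (δ • x) (δ • ξ)‖ + 1)) := by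
      refine mul_le_mul_of_nonneg_left (h1.trans ?_) (by linarith)
      exact mul_le_mul_of_nonneg_left (by linarith) (by linarith)
    linarith
  have hI := hω.exists_integrable_exp (Eucl d) volume 1 le_rfl
  refine ((hI.mul_prod hI).const_mul (M * Real.exp (m * ω ‖x‖) * S *
    (X * Real.exp ((m + 1) * K)))).mono' (Continuous.aestronglyMeasurable ?_)
    (Eventually.of_forall fun p => ?_)
  · have c1 : Continuous fun p : Eucl d × Eucl d => b (x, p.1, p.2) :=
      hb.smooth.continuous.comp (by fun_prop)
    have c2 : Continuous fun p : Eucl d × Eucl d => χ (pair (δ • x) (δ • p.2)) := by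
      have : Continuous fun p : Eucl d × Eucl d => (δ • pairCLM d) (x, p.1, p.2) :=
        (δ • pairCLM d).continuous.comp (by fun_prop)
      simp only [← pair_smul] at this
      exact χ.mem.smooth.continuous.comp this
    have c3 : Continuous fun p : Eucl d × Eucl d => f p.1 :=
      f.mem.smooth.continuous.comp continuous_fst
    have c4 : Continuous fun p : Eucl d × Eucl d =>
        Complex.exp (Complex.I * ((inner ℝ (x - p.1) p.2 : ℝ) : ℂ)) := by fun_prop
    exact ((c4.mul c1).mul c2).mul c3
  · obtain ⟨y, ξ⟩ := p
    have n1 := hbM.norm_le hω one_pos (x, y, ξ)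
    have n2 := hfS.norm_le hω (by linarith) y
    have n3 := hχb ξ
    have hw := weight₃_nonneg ω m (x, y, ξ)
    rw [regKernelFun, norm_mul, norm_mul, norm_mul, norm_cexp_I_mul_ofReal, one_mul]
    calc _ ≤ M * weight₃ ω m (x, y, ξ) *
          (X * Real.exp ((m + 1) * K) * Real.exp (-((m + 1) * ω ‖ξ‖))) *
          (S * decayWeight ω (m + 1) y) := by gcongr
      _ = M * S * X * Real.exp ((m + 1) * K) * (weight₃ ω m (x, y, ξ) *
          Real.exp (-((m + 1) * ω ‖ξ‖)) * decayWeight ω (m + 1) y) := by ring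
      _ = M * S * X * Real.exp ((m + 1) * K) * (Real.exp (m * ω ‖x‖) *
          (Real.exp (-(1 * ω ‖y‖)) * Real.exp (-(1 * ω ‖ξ‖)))) := by
        simp only [weight₃, decayWeight, ← Real.exp_add]
        congr 2
        ring
      _ = _ := by ring

/-- Convergence of the regularized operators. -/
lemma IsSymbol.tendsto_regularized {b : Eucl d × Eucl d × Eucl d → ℂ} (hb : IsSymbol ω b)
    (χ : Sω (d + d) ω) (hχ : χ 0 = 1) (f g : Sω d ω) (gδ : ℝ → Sω d ω)
    (hg : (g : Eucl d → ℂ) = pseudoOp b (f : Eucl d → ℂ))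
    (hgδ : ∀ δ, (gδ δ : Eucl d → ℂ) =
      pseudoOp (UltraPseudo.cutoff b χ δ) (f : Eucl d → ℂ)) :
    Tendsto gδ (𝓝[≠] 0) (𝓝 g) := by
  obtain ⟨c, hc, m, hm, h⟩ := hb.bound
  have hs : ∀ δ : ℝ, ContDiff ℝ (⊤ : ℕ∞) fun p => χ ((δ • pairCLM d) p) - χ 0 := fun δ =>
    (χ.mem.smooth.comp (δ • pairCLM d).contDiff).sub contDiff_const
  -- Both the geometric constant and the growth exponent m+1 are uniform in |δ| ≤ 1; only the
  -- overall constant carries |δ|.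
  have hprod : ∀ l, 0 < l → ∃ M, 0 ≤ M ∧ ∀ δ : ℝ, |δ| ≤ 1 →
      DerivBound ω (c + ‖pairCLM d‖) l (M * |δ|) (weight₃ ω (m + 1))
        (fun p => b p * (χ ((δ • pairCLM d) p) - χ 0)) := by
    intro l hl
    obtain ⟨M, hM, hbM⟩ := h l hl
    obtain ⟨X, hX, hχX⟩ := χ.exists_derivBound_dilate_sub hω hl
    refine ⟨M * X, by positivity, fun δ hδ => ?_⟩
    have h1 := hbM.mul hω hl hc (norm_nonneg _) hM (by positivity) (weight₃_nonneg ω m)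
      (weight₃_nonneg ω 1) hb.smooth (hs δ) (hχX δ hδ)
    refine h1.mono hω (by positivity) le_rfl hl le_rfl (by positivity) (le_of_eq (by ring))
      (fun z => mul_nonneg (weight₃_nonneg ω m z) (weight₃_nonneg ω 1 z)) fun z => le_of_eq ?_
    simp only [weight₃, ← Real.exp_add]
    congr 1
    ring
  have hdiff : ∀ δ : ℝ, |δ| ≤ 1 → ((gδ δ - g : Sω d ω) : Eucl d → ℂ) =
      pseudoOp (fun p => b p * (χ ((δ • pairCLM d) p) - χ 0)) (f : Eucl d → ℂ) := by
    intro δ hδ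
    have hsym : IsSymbol ω (fun p => b p * (χ ((δ • pairCLM d) p) - χ 0)) := by
      refine ⟨hb.smooth.mul (hs δ), c + ‖pairCLM d‖, by positivity, m + 1, by linarith, fun l hl => ?_⟩
      obtain ⟨M, hM, hbM⟩ := hprod l hl
      exact ⟨M * |δ|, by positivity, hbM δ hδ⟩
    have h1 := hb.pseudoOp_add hω hsym f f f (b₂ := UltraPseudo.cutoff b χ δ) (by
      funext z
      simp only [innerFun, UltraPseudo.cutoff, Pi.add_apply, hχ]
      ring)
    rw [← hg, ← hgδ] at h1
    exact (eq_sub_of_add_eq' h1).symm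
  rw [(withSeminorms d ω).tendsto_nhds]
  intro i ε hε
  obtain ⟨l, hl, q, -, C, hC, H⟩ := hω.exists_seminormFamily_pseudoOp_le
    (c := c + ‖pairCLM d‖) (m := m + 1) (by positivity) (by positivity) i
  obtain ⟨M, hM, hbM⟩ := hprod l hl
  have hlim : Tendsto (fun δ : ℝ => C * (M * |δ|) * q f) (𝓝[≠] 0) (𝓝 0) := by
    have : Tendsto (fun δ : ℝ => C * (M * |δ|) * q f) (𝓝 0) (𝓝 (C * (M * |(0 : ℝ)|) * q f)) :=
      Continuous.tendsto (by fun_prop) 0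
    simp only [abs_zero, mul_zero, zero_mul] at this
    exact this.mono_left nhdsWithin_le_nhds
  have hball : ∀ᶠ δ : ℝ in 𝓝[≠] 0, |δ| ≤ 1 := by
    refine nhdsWithin_le_nhds ?_
    filter_upwards [Metric.closedBall_mem_nhds (0 : ℝ) one_pos] with δ hδ
    simpa using hδ
  filter_upwards [hlim.eventually_lt_const hε, hball] with δ h1 h2
  exact (H _ _ (by positivity) (hb.smooth.mul (hs δ)) (hbM δ h2) f _ (hdiff δ h2)).trans_lt h1

lemma IsAmplitude.isSymbol {m ρ : ℝ} (hρ : 0 < ρ) (hρ1 : ρ ≤ 1)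
    {a : Eucl d → Eucl d → Eucl d → ℂ} (ha : IsAmplitude ω m ρ a) :
    IsSymbol ω (fun p => a p.1 p.2.1 p.2.2) := by
  refine ⟨ha.smooth, 6 * d, by positivity, |m|, abs_nonneg m, fun l hl => ?_⟩
  obtain ⟨C, hC, h⟩ := ha.exists_derivBound hω hρ hρ1 hl
  exact ⟨C, hC.le, h⟩

end Regularization

end UltraPseudo

end

/-! ### The theorem -/

theorem theorem3p3 (d : ℕ) (ω : ℝ → ℝ) (hω : UltraPseudo.IsWeight ω) (m ρ : ℝ)
    (hρ : 0 < ρ) (hρ1 : ρ ≤ 1)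
    (a : UltraPseudo.Eucl d → UltraPseudo.Eucl d → UltraPseudo.Eucl d → ℂ)
    (ha : UltraPseudo.IsAmplitude ω m ρ a) :
    ∃ A : UltraPseudo.Sω d ω →L[ℂ] UltraPseudo.Sω d ω,
      (∀ (f : UltraPseudo.Sω d ω) (x : UltraPseudo.Eucl d),
        (∀ ξ : UltraPseudo.Eucl d, Integrable (fun y => UltraPseudo.kernelFun a f x y ξ)) ∧
        Integrable (fun ξ => ∫ y, UltraPseudo.kernelFun a f x y ξ) ∧
        A f x = ∫ ξ, ∫ y, UltraPseudo.kernelFun a f x y ξ) ∧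
      ∀ χ : UltraPseudo.Sω (d + d) ω, χ 0 = 1 → ∀ f : UltraPseudo.Sω d ω,
        ∃ Aδ : ℝ → UltraPseudo.Sω d ω,
          (∀ δ : ℝ, δ ≠ 0 → ∀ x : UltraPseudo.Eucl d,
            Integrable (fun p : UltraPseudo.Eucl d × UltraPseudo.Eucl d =>
              UltraPseudo.regKernelFun a χ δ f x p.1 p.2) ∧
            Aδ δ x = ∫ ξ, ∫ y, UltraPseudo.regKernelFun a χ δ f x y ξ) ∧
          Tendsto Aδ (𝓝[≠] 0) (𝓝 (A f)) := by
  have hb := ha.isSymbol hω hρ hρ1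
  obtain ⟨A, hA⟩ := hb.exists_continuousLinearMap hω
  refine ⟨A, fun f x => ⟨fun ξ => hb.integrable_kernelFun hω f x ξ,
    hb.integrable_integral_kernelFun hω f x, ?_⟩, fun χ hχ f => ?_⟩
  · rw [hA f]
    exact UltraPseudo.pseudoOp_eq_integral _ _ x
  -- The regularized operator is the operator of the cut-off symbol, which makes sense for all δ,
  -- including 0; δ ≠ 0 matters only for absolute convergence of the double integral.
  · refine ⟨fun δ => ⟨_, (hb.cutoff hω χ δ).memSω_pseudoOp hω f⟩, fun δ hδ x =>
      ⟨hb.integrable_regularized hω χ hδ f x, ?_⟩,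
      hb.tendsto_regularized hω χ hχ f (A f) _ (hA f) fun δ => rfl⟩
    refine (UltraPseudo.pseudoOp_eq_integral _ _ x).trans ?_
    simp only [UltraPseudo.regKernelFun_eq, UltraPseudo.cutoff, ← UltraPseudo.pair_smul]
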